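/- Let $N\ge 0$ and let $0=\delta_0<\delta_1<\delta_2<\dots$ be a strictly increasing sequence of weights. Let $\beta:\mathbb R\to[0,1]$ be smooth with $\beta(s)=1$ for $s\le -1$, $\beta'(s)<0$ for $s\in(-1,1)$ and $\beta(s)+\beta(-s)=1$ for all $s$. A vector field along a path in $\mathbb R^N$ is a map $h:\mathbb R\to\mathbb R^N$. For linear subspaces $\Sigma,\Sigma'\subset\mathbb R^N$ let $E^{\Sigma,\Sigma'}$ be the space of pairs $(h,k)$ of vector fields (along a path from $a$ to $b$ and a path from $b$ to $c$) of class $H^2(\mathbb R,\mathbb R^N)$ with $h(0)\in\Sigma$ and $k(0)\in\Sigma'$. Its level $m$ consists of the pairs $(h,k)\in E^{\Sigma,\Sigma'}$ such that $h$ and $k$ are of class $H^{m+2,\delta_m}$, i.e. $e^{\delta_m|s|}D^jh$ and $e^{\delta_m|s|}D^jk$ belong to $L^2$ for all $j\le m+2$, with the corresponding Hilbert norm. For $0\le R<\infty$ put $$\oplus_R(h,k)(s)=\beta(s-\tfrac R2)h(s)+(1-\beta(s-\tfrac R2))k(s-R),$$ $$\ominus_R(h,k)(s)=-(1-\beta(s-\tfrac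 R2))h(s)+\beta(s-\tfrac R2)k(s-R),$$ and for $R=\infty$ let $\ker(\ominus_\infty)$ be the whole space and $\ker(\oplus_\infty)=\{0\}$. Put $\varphi(r)=e^{1/r}-e$ for $0<r<1$ and $\varphi(0)=\infty$. A map $f:U\to F$ on a subset $U$ of a scale $E=E_0\supset E_1\supset\dots$ is sc$^0$ if it maps $U\cap E_m$ continuously into $F_m$ for every $m$. It is sc$^{k+1}$ if it is sc$^0$, for every $x\in U\cap E_1$ there is a bounded linear operator $Df(x):E_0\to F_0$ with $\|f(x+h)-f(x)-Df(x)h\|_0/\|h\|_1\to0$ as $h\to 0$ in $E_1$, $x+h\in U$, and the tangent map $(x,h)\mapsto(f(x),Df(x)h)$ on $TU=U^1\oplus E$, $(TU)_m=(U\cap E_{m+1})\oplus E_m$, is sc$^k$. It is sc-smooth if it is sc$^k$ for all $k$. A sc-smooth splicing $(\pi,E,V)$ consists of a Banach space $E$ with a sc-smooth structure (a nested sequence of Banach spaces $E=E_0\supset E_1\supset\dots$ with compact inclusions $E_n\to E_m$ for $n>m$ and with $\bigcap_n E_n$ dense in every $E_m$), a relatively open subset $V$ of a partial cone, and linear projections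 $\pi_v$ of $E$, $v\in V$, that are bounded on every level, such that $V\oplus E\to E$, $(v,e)\mapsto\pi_v(e)$, is sc-smooth. **Theorem.** (i) Let $E=E^{\mathbb R^N,\mathbb R^N}$ be the space of all pairs of vector fields and let $V=[0,1)$. For every $r\in V$ and $R=\varphi(r)$ the subspaces $\ker(\ominus_R)$ and $\ker(\oplus_R)$ of $E$ are complementary on every level. If $\pi_r$ denotes the projection of $E$ onto $\ker(\ominus_R)$ along $\ker(\oplus_R)$, then $(\pi,E,V)$ is a sc-smooth splicing. (ii) For all linear subspaces $\Sigma,\Sigma'\subset\mathbb R^N$ (in particular for hyperplanes, such as those orthogonal to the velocities at time $0$ of the two paths) the same assertions hold for $E=E^{\Sigma,\Sigma'}$ (with the kernels taken in $E^{\Sigma,\Sigma'}$) and $V=\{r\in[0,1)\mid\varphi(r)>2\}=[0,1/\log(e+2))$. -/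

import Mathlib

open Set Filter Topology MeasureTheory
open scoped ContDiff ENNReal

universe u

noncomputable section

/-! ### Scales of Banach spaces and sc-smooth maps -/

/-- A nested sequence of normed spaces `E₀ ⊇ E₁ ⊇ …` inside a real vector space `X`. The level `E_m`
is the image of the normed space `Lvl m` under the injective linear map `emb m`. The requirements on
a sc-smooth structure (nestedness, completeness, compactness, density) are stated in
`NormedScale.IsScStructure`. The space `E` itself is the level `E₀`. -/
structure NormedScale (X : Type u) [AddCommGroup X] [Module ℝ X] where
  Lvl : ℕ → Type u
  [grp : ∀ m, NormedAddCommGroup (Lvl m)]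
  [spc : ∀ m, NormedSpace ℝ (Lvl m)]
  emb : ∀ m, Lvl m →ₗ[ℝ] X
  emb_injective : ∀ m, Function.Injective (emb m)

attribute [instance] NormedScale.grp NormedScale.spc

namespace NormedScale

variable {X Y : Type u} [AddCommGroup X] [Module ℝ X] [AddCommGroup Y] [Module ℝ Y]

/-- The scale is a sc-smooth structure on the Banach space `E₀`: all levels are Banach spaces, for
`m < n` the level `E_n` is contained in `E_m` with compact inclusion, and `E_∞ = ⋂ E_n` is dense
in every `E_m`. -/
structure IsScStructure (E : NormedScale X) : Prop where
  complete : ∀ m, CompleteSpace (E.Lvl m)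
  compact : ∀ m n, m < n → ∃ ι : E.Lvl n →L[ℝ] E.Lvl m,
    (∀ x, E.emb m (ι x) = E.emb n x) ∧ IsCompactOperator ι
  dense : ∀ m, Dense {x : E.Lvl m | ∀ n, E.emb m x ∈ range (E.emb n)}

/-- The direct sum `E ⊕ F`, with `(E ⊕ F)_m = E_m ⊕ F_m`. -/
def prod (E : NormedScale X) (F : NormedScale Y) : NormedScale (X × Y) where
  Lvl m := E.Lvl m × F.Lvl m
  emb m := (E.emb m).prodMap (F.emb m)
  emb_injective m := (E.emb_injective m).prodMap (F.emb_injective m)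

/-- The shifted scale `E¹`, with `(E¹)_m = E_{m+1}`. -/
def shift (E : NormedScale X) : NormedScale X where
  Lvl m := E.Lvl (m + 1)
  emb m := E.emb (m + 1)
  emb_injective m := E.emb_injective (m + 1)

/-- The tangent scale `TE = E¹ ⊕ E`, with `(TE)_m = E_{m+1} ⊕ E_m`. -/
def tangent (E : NormedScale X) : NormedScale (X × X) := E.shift.prod E

end NormedScale

/-- The constant scale on a normed space `A`; for finite-dimensional `A` this is its only
sc-smooth structure. -/
def constScale (A : Type u) [NormedAddCommGroup A] [NormedSpace ℝ A] : NormedScale A where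
  Lvl _ := A
  emb _ := LinearMap.id
  emb_injective _ := Function.injective_id

section ScMaps

/-- `f : U → F` is sc⁰: for every `m` it maps `U_m = U ∩ E_m` continuously into `F_m`. -/
def IsScZero {X Y : Type u} [AddCommGroup X] [Module ℝ X] [AddCommGroup Y] [Module ℝ Y]
    (E : NormedScale X) (F : NormedScale Y) (U : Set X) (f : X → Y) : Prop :=
  ∀ m, ∃ g : E.Lvl m → F.Lvl m, ContinuousOn g (E.emb m ⁻¹' U) ∧
    ∀ x, E.emb m x ∈ U → F.emb m (g x) = f (E.emb m x)

/-- `Df` is the linearization of `f : U → F`: for every `x ∈ U₁` the map `Df x` is a bounded linear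
operator `E₀ → F₀` and `‖f (x + h) - f x - Df x h‖₀ / ‖h‖₁ → 0` as `h → 0` in `E₁`
(with `x + h ∈ U`). -/
def IsLinearization {X Y : Type u} [AddCommGroup X] [Module ℝ X] [AddCommGroup Y] [Module ℝ Y]
    (E : NormedScale X) (F : NormedScale Y) (U : Set X) (f : X → Y) (Df : X → X → Y) : Prop :=
  ∀ x : E.Lvl 1, E.emb 1 x ∈ U →
    (∃ L : E.Lvl 0 →L[ℝ] F.Lvl 0, ∀ h, F.emb 0 (L h) = Df (E.emb 1 x) (E.emb 0 h)) ∧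
    ∀ ε > (0 : ℝ), ∃ d > (0 : ℝ), ∀ h : E.Lvl 1, ‖h‖ < d → E.emb 1 (x + h) ∈ U →
      ∃ y : F.Lvl 0,
        F.emb 0 y = f (E.emb 1 (x + h)) - f (E.emb 1 x) - Df (E.emb 1 x) (E.emb 1 h) ∧
        ‖y‖ ≤ ε * ‖h‖

/-- `f : U → F` is sc^k. Inductively, `f` is sc^{k+1} if it is sc⁰, has a linearization, and the
tangent map `Tf (x, h) = (f x, Df x h)`, defined on `TU = U¹ ⊕ E`, is sc^k. -/
def IsScOfOrder : ℕ → ∀ {X Y : Type u} [AddCommGroup X] [Module ℝ X] [AddCommGroup Y] [Module ℝ Y],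
    NormedScale X → NormedScale Y → Set X → (X → Y) → Prop
  | 0, _, _, _, _, _, _, E, F, U, f => IsScZero E F U f
  | k + 1, X, Y, _, _, _, _, E, F, U, f =>
      IsScZero E F U f ∧ ∃ Df : X → X → Y, IsLinearization E F U f Df ∧
        IsScOfOrder k E.tangent F.tangent {p | p.1 ∈ U} (fun p => (f p.1, Df p.1 p.2))

/-- `f : U → F` is sc-smooth. -/
def IsScSmooth {X Y : Type u} [AddCommGroup X] [Module ℝ X] [AddCommGroup Y] [Module ℝ Y]
    (E : NormedScale X) (F : NormedScale Y) (U : Set X) (f : X → Y) : Prop :=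
  ∀ k, IsScOfOrder k E F U f

end ScMaps

/-! ### Splicings -/

/-- A partial cone: the preimage of `[0,∞)^k × ℝ^{n-k}` under a linear isomorphism `A ≃ ℝⁿ`. -/
def IsPartialCone {A : Type u} [AddCommGroup A] [Module ℝ A] (C : Set A) : Prop :=
  ∃ (n k : ℕ) (T : A ≃ₗ[ℝ] (Fin n → ℝ)), k ≤ n ∧ C = {a | ∀ i : Fin n, (i : ℕ) < k → 0 ≤ T a i}

section Splicing

variable {X : Type u} [AddCommGroup X] [Module ℝ X]

/-- `p` is a sc-projection of `E`: a linear idempotent map of `E₀` which restricts to a bounded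
operator of every level. -/
structure IsScProjection (E : NormedScale X) (p : X → X) : Prop where
  bounded : ∀ m, ∃ P : E.Lvl m →L[ℝ] E.Lvl m, ∀ x, E.emb m (P x) = p (E.emb m x)
  idem : ∀ x : E.Lvl 0, p (p (E.emb 0 x)) = p (E.emb 0 x)

/-- `(π, E, V)` is a sc-smooth splicing. -/
structure IsScSmoothSplicing {A : Type u} [NormedAddCommGroup A] [NormedSpace ℝ A]
    (π : A → X → X) (E : NormedScale X) (V : Set A) : Prop where
  isScStructure : E.IsScStructure
  relOpen : ∃ C O : Set A, IsPartialCone C ∧ IsOpen O ∧ V = C ∩ O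
  isScProjection : ∀ v ∈ V, IsScProjection E (π v)
  smooth : IsScSmooth ((constScale A).prod E) E {p | p.1 ∈ V} (fun p => π p.1 p.2)

/-- The subspaces `K ∩ E` and `L ∩ E` of `E` are complementary, on every level of the scale. -/
def AreScComplementary (E : NormedScale X) (K L : Submodule ℝ X) : Prop :=
  ∀ m, IsCompl (K.comap (E.emb m)) (L.comap (E.emb m))

/-- `p` is the projection of `E` onto `K ∩ E` along `L ∩ E`. -/
def IsProjectionAlong (E : NormedScale X) (K L : Submodule ℝ X) (p : X → X) : Prop :=
  ∀ x : E.Lvl 0, ∃ y : E.Lvl 0, p (E.emb 0 x) = E.emb 0 y ∧ E.emb 0 y ∈ K ∧ E.emb 0 (x - y) ∈ L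

end Splicing

/-! ### Weighted Sobolev spaces on the line -/

section Sobolev

variable {N : ℕ}

/-- `v` is the weak derivative of `w` on `ℝ`. -/
def IsWeakDeriv (w v : ℝ → EuclideanSpace ℝ (Fin N)) : Prop :=
  LocallyIntegrable w ∧ LocallyIntegrable v ∧
    ∀ φ : ℝ → ℝ, ContDiff ℝ ∞ φ → HasCompactSupport φ →
      ∫ s, deriv φ s • w s = -∫ s, φ s • v s

theorem IsWeakDeriv.add {w v w' v' : ℝ → EuclideanSpace ℝ (Fin N)}
    (h : IsWeakDeriv w v) (h' : IsWeakDeriv w' v') : IsWeakDeriv (w + w') (v + v') := by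
  refine ⟨h.1.add h'.1, h.2.1.add h'.2.1, fun φ hφ hc => ?_⟩
  have hd : Continuous (deriv φ) := hφ.continuous_deriv (by simp)
  have e := h.2.2 φ hφ hc
  have e' := h'.2.2 φ hφ hc
  simp only [Pi.add_apply, smul_add]
  rw [integral_add (h.1.integrable_smul_left_of_hasCompactSupport hd hc.deriv)
      (h'.1.integrable_smul_left_of_hasCompactSupport hd hc.deriv),
    integral_add (h.2.1.integrable_smul_left_of_hasCompactSupport hφ.continuous hc)
      (h'.2.1.integrable_smul_left_of_hasCompactSupport hφ.continuous hc), e, e', neg_add]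

theorem IsWeakDeriv.const_smul {w v : ℝ → EuclideanSpace ℝ (Fin N)}
    (h : IsWeakDeriv w v) (c : ℝ) : IsWeakDeriv (c • w) (c • v) := by
  refine ⟨h.1.smul c, h.2.1.smul c, fun φ hφ hc => ?_⟩
  have e := h.2.2 φ hφ hc
  simp only [Pi.smul_apply, smul_comm _ c]
  rw [integral_smul, integral_smul, e, smul_neg]

theorem IsWeakDeriv.ae_eq {w v w' v' : ℝ → EuclideanSpace ℝ (Fin N)}
    (h : IsWeakDeriv w v) (h' : IsWeakDeriv w' v') (hw : w =ᵐ[volume] w') :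
    v =ᵐ[volume] v' := by
  have key : ∀ᵐ s, (v - v') s = 0 := by
    refine ae_eq_zero_of_integral_contDiff_smul_eq_zero (h.2.1.sub h'.2.1) fun φ hφ hc => ?_
    have e := h.2.2 φ hφ hc
    have e' := h'.2.2 φ hφ hc
    have e2 : ∫ s, deriv φ s • w s = ∫ s, deriv φ s • w' s :=
      integral_congr_ae (hw.mono fun s hs => by simp only [hs])
    simp only [Pi.sub_apply, smul_sub]
    rw [integral_sub (h.2.1.integrable_smul_left_of_hasCompactSupport hφ.continuous hc)
      (h'.2.1.integrable_smul_left_of_hasCompactSupport hφ.continuous hc), sub_eq_zero]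
    exact neg_injective (e.symm.trans (e2.trans e'))
  exact key.mono fun s hs => sub_eq_zero.1 hs

/-- `w 0 = h, w 1, …, w k` are the successive weak derivatives of `h`, and all
`e^{δ|s|} w j (s)` with `j ≤ k` belong to `L²`. -/
def IsSobolevJet (k : ℕ) (δ : ℝ) (h : ℝ → EuclideanSpace ℝ (Fin N))
    (w : ℕ → ℝ → EuclideanSpace ℝ (Fin N)) : Prop :=
  w 0 = h ∧ (∀ j < k, IsWeakDeriv (w j) (w (j + 1))) ∧
    ∀ j ≤ k, MemLp (fun s => Real.exp (δ * |s|) • w j s) 2 volume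

theorem IsSobolevJet.ae_eq {k : ℕ} {δ : ℝ} {h : ℝ → EuclideanSpace ℝ (Fin N)}
    {w w' : ℕ → ℝ → EuclideanSpace ℝ (Fin N)}
    (hw : IsSobolevJet k δ h w) (hw' : IsSobolevJet k δ h w') :
    ∀ j ≤ k, w j =ᵐ[volume] w' j := by
  intro j
  induction j with
  | zero => intro _; rw [hw.1, hw'.1]
  | succ j ih =>
    intro hj
    exact (hw.2.1 j hj).ae_eq (hw'.2.1 j hj) (ih (Nat.le_of_succ_le hj))

theorem IsSobolevJet.add {k : ℕ} {δ : ℝ} {h h' : ℝ → EuclideanSpace ℝ (Fin N)}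
    {w w' : ℕ → ℝ → EuclideanSpace ℝ (Fin N)}
    (hw : IsSobolevJet k δ h w) (hw' : IsSobolevJet k δ h' w') :
    IsSobolevJet k δ (h + h') (w + w') := by
  refine ⟨by simp [hw.1, hw'.1], fun j hj => (hw.2.1 j hj).add (hw'.2.1 j hj), fun j hj => ?_⟩
  refine ((hw.2.2 j hj).add (hw'.2.2 j hj)).congr_norm ?_ ?_
  · have := ((hw.2.2 j hj).add (hw'.2.2 j hj)).1
    refine this.congr (Eventually.of_forall fun s => ?_)
    simp
  · exact Eventually.of_forall fun s => by simp

theorem IsSobolevJet.const_smul {k : ℕ} {δ : ℝ} {h : ℝ → EuclideanSpace ℝ (Fin N)}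
    {w : ℕ → ℝ → EuclideanSpace ℝ (Fin N)}
    (hw : IsSobolevJet k δ h w) (c : ℝ) : IsSobolevJet k δ (c • h) (c • w) := by
  refine ⟨by simp [hw.1], fun j hj => (hw.2.1 j hj).const_smul c, fun j hj => ?_⟩
  have e : (fun s => Real.exp (δ * |s|) • (c • w) j s) =
      c • fun s => Real.exp (δ * |s|) • w j s := by
    funext s; simp [smul_comm c]
  rw [e]
  exact (hw.2.2 j hj).const_smul c

theorem isSobolevJet_zero (k : ℕ) (δ : ℝ) :
    IsSobolevJet k δ (0 : ℝ → EuclideanSpace ℝ (Fin N)) 0 := by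
  refine ⟨rfl, fun j _ => ⟨locallyIntegrable_zero, locallyIntegrable_zero, by simp⟩,
    fun j _ => by simp⟩

/-- The space of all `h` of class `H^{k,δ}(ℝ, ℝ^N)`, `k ≥ 1`, i.e. with weak derivatives up to
order `k` in `L²` with weight `e^{δ|s|}`, such that `h 0 ∈ S`. Elements are represented by their
continuous representatives. -/
def sobolevSubmodule (k : ℕ) (δ : ℝ) (S : Submodule ℝ (EuclideanSpace ℝ (Fin N))) :
    Submodule ℝ (ℝ → EuclideanSpace ℝ (Fin N)) where
  carrier := {h | Continuous h ∧ h 0 ∈ S ∧ ∃ w, IsSobolevJet k δ h w}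
  zero_mem' := ⟨continuous_zero, S.zero_mem, 0, isSobolevJet_zero k δ⟩
  add_mem' := by
    rintro h h' ⟨hc, hS, w, hw⟩ ⟨hc', hS', w', hw'⟩
    exact ⟨hc.add hc', S.add_mem hS hS', w + w', hw.add hw'⟩
  smul_mem' := by
    rintro c h ⟨hc, hS, w, hw⟩
    exact ⟨hc.const_smul c, S.smul_mem c hS, c • w, hw.const_smul c⟩

/-- The type of elements of `sobolevSubmodule k δ S`, to be normed below. -/
def SobolevSpace (k : ℕ) (δ : ℝ) (S : Submodule ℝ (EuclideanSpace ℝ (Fin N))) : Type :=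
  ↥(sobolevSubmodule k δ S)

variable (k : ℕ) (δ : ℝ) (S : Submodule ℝ (EuclideanSpace ℝ (Fin N)))

instance : AddCommGroup (SobolevSpace k δ S) :=
  inferInstanceAs (AddCommGroup ↥(sobolevSubmodule k δ S))

instance : Module ℝ (SobolevSpace k δ S) :=
  inferInstanceAs (Module ℝ ↥(sobolevSubmodule k δ S))

/-- The underlying function of an element of `SobolevSpace k δ S`. -/
def sobolevEmb : SobolevSpace k δ S →ₗ[ℝ] (ℝ → EuclideanSpace ℝ (Fin N)) :=
  (sobolevSubmodule k δ S).subtype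

theorem sobolevEmb_injective : Function.Injective (sobolevEmb k δ S) :=
  Subtype.coe_injective

variable {k δ S}

/-- A choice of weak derivatives; it is unique up to null sets. -/
def sobolevJet (h : SobolevSpace k δ S) : ℕ → ℝ → EuclideanSpace ℝ (Fin N) :=
  h.2.2.2.choose

theorem sobolevJet_spec (h : SobolevSpace k δ S) :
    IsSobolevJet k δ (sobolevEmb k δ S h) (sobolevJet h) :=
  h.2.2.2.choose_spec

variable (k δ S)

/-- The linear map `h ↦ (e^{δ|s|} D^j h)_{j ≤ k} ∈ (L²)^{k+1}`. -/
def sobolevToLp : SobolevSpace k δ S →ₗ[ℝ]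
    PiLp 2 (fun _ : Fin (k + 1) => Lp (EuclideanSpace ℝ (Fin N)) 2 (volume : Measure ℝ)) where
  toFun h := WithLp.toLp 2 fun j =>
    ((sobolevJet_spec h).2.2 j (Nat.le_of_lt_succ j.2)).toLp _
  map_add' h h' := by
    ext1 j
    have hj := Nat.le_of_lt_succ j.2
    have hs : IsSobolevJet k δ (sobolevEmb k δ S (h + h')) (sobolevJet h + sobolevJet h') := by
      rw [map_add]; exact (sobolevJet_spec h).add (sobolevJet_spec h')
    have e := (sobolevJet_spec (h + h')).ae_eq hs j hj
    simp only [PiLp.add_apply]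
    rw [← MemLp.toLp_add]
    exact (MemLp.toLp_eq_toLp_iff _ _).2 (e.mono fun s hs => by simp [hs])
  map_smul' c h := by
    ext1 j
    have hj := Nat.le_of_lt_succ j.2
    have hs : IsSobolevJet k δ (sobolevEmb k δ S (c • h)) (c • sobolevJet h) := by
      rw [map_smul]; exact (sobolevJet_spec h).const_smul c
    have e := (sobolevJet_spec (c • h)).ae_eq hs j hj
    simp only [PiLp.smul_apply, RingHom.id_apply]
    rw [← MemLp.toLp_const_smul]
    exact (MemLp.toLp_eq_toLp_iff _ _).2 (e.mono fun s hs => by simp [hs, smul_comm c])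

theorem sobolevToLp_injective : Function.Injective (sobolevToLp k δ S) := by
  rw [injective_iff_map_eq_zero]
  intro h hh
  have h1 : ((sobolevJet_spec h).2.2 0 (Nat.zero_le k)).toLp _ =
      (0 : Lp (EuclideanSpace ℝ (Fin N)) 2 (volume : Measure ℝ)) := by
    change (sobolevToLp k δ S h) (0 : Fin (k + 1)) = 0
    rw [hh]
    rfl
  have h2 := (MemLp.toLp_eq_toLp_iff ((sobolevJet_spec h).2.2 0 (Nat.zero_le k))
    (MemLp.zero (p := 2) (μ := (volume : Measure ℝ)))).1 (h1.trans (MemLp.toLp_zero _).symm)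
  have h3 : sobolevEmb k δ S h =ᵐ[volume] (0 : ℝ → EuclideanSpace ℝ (Fin N)) := by
    filter_upwards [h2] with s hs
    rw [(sobolevJet_spec h).1] at hs
    simpa [(Real.exp_pos _).ne'] using hs
  have hc : Continuous (sobolevEmb k δ S h) := h.2.1
  refine sobolevEmb_injective k δ S ?_
  rw [map_zero]
  exact hc.ae_eq_iff_eq volume continuous_zero |>.1 h3

/-- The norm `‖h‖² = ∑_{j ≤ k} ∫ |e^{δ|s|} D^j h(s)|² ds`. -/
instance : NormedAddCommGroup (SobolevSpace k δ S) :=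
  NormedAddCommGroup.induced _ _ (sobolevToLp k δ S) (sobolevToLp_injective k δ S)

instance : NormedSpace ℝ (SobolevSpace k δ S) :=
  NormedSpace.induced ℝ _ _ (sobolevToLp k δ S)

end Sobolev

/-- The scale with levels `E_m = {h ∈ H^{m+2,δ_m}(ℝ, ℝ^N) | h 0 ∈ S}` of vector fields along a path
in `ℝ^N`. -/
def pathScale {N : ℕ} (δ : ℕ → ℝ) (S : Submodule ℝ (EuclideanSpace ℝ (Fin N))) :
    NormedScale (ℝ → EuclideanSpace ℝ (Fin N)) where
  Lvl m := SobolevSpace (m + 2) (δ m) S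
  emb m := sobolevEmb (m + 2) (δ m) S
  emb_injective m := sobolevEmb_injective (m + 2) (δ m) S

/-- Pairs of maps `ℝ → ℝ^N`. -/
abbrev PathPairs (N : ℕ) : Type :=
  (ℝ → EuclideanSpace ℝ (Fin N)) × (ℝ → EuclideanSpace ℝ (Fin N))

/-- The scale `E` of pairs `(h, k)` of vector fields with `h 0 ∈ S` and `k 0 ∈ S'`, with
`E_m = H^{m+2,δ_m} ⊕ H^{m+2,δ_m}`. -/
def pathPairScale {N : ℕ} (δ : ℕ → ℝ) (S S' : Submodule ℝ (EuclideanSpace ℝ (Fin N))) :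
    NormedScale (PathPairs N) :=
  (pathScale δ S).prod (pathScale δ S')

/-! ### Gluing and anti-gluing -/

section Gluing

variable {N : ℕ}

/-- The cut-off functions used for gluing. -/
structure IsGluingCutoff (β : ℝ → ℝ) : Prop where
  smooth : ContDiff ℝ ∞ β
  mem_Icc : ∀ s, β s ∈ Icc (0 : ℝ) 1
  eq_one : ∀ s ≤ -1, β s = 1
  deriv_neg : ∀ s ∈ Ioo (-1 : ℝ) 1, deriv β s < 0
  add_neg : ∀ s, β s + β (-s) = 1

/-- The exponential gluing profile `φ(r) = e^{1/r} - e`, with `φ(0) = ∞`. -/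
def expProfile (r : ℝ) : WithTop ℝ :=
  if r = 0 then ⊤ else ((Real.exp (1 / r) - Real.exp 1 : ℝ) : WithTop ℝ)

/-- `⊕_R (h, k) (s) = β(s - R/2) h(s) + (1 - β(s - R/2)) k(s - R)`. -/
def glue (β : ℝ → ℝ) (R : ℝ) :
    PathPairs N →ₗ[ℝ] (ℝ → EuclideanSpace ℝ (Fin N)) where
  toFun p s := β (s - R / 2) • p.1 s + (1 - β (s - R / 2)) • p.2 (s - R)
  map_add' p q := by funext s; simp only [Prod.fst_add, Prod.snd_add, Pi.add_apply]; module
  map_smul' c p := by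
    funext s; simp only [Prod.smul_fst, Prod.smul_snd, Pi.smul_apply, RingHom.id_apply]; module

/-- `⊖_R (h, k) (s) = -(1 - β(s - R/2)) h(s) + β(s - R/2) k(s - R)`. -/
def antiGlue (β : ℝ → ℝ) (R : ℝ) :
    PathPairs N →ₗ[ℝ] (ℝ → EuclideanSpace ℝ (Fin N)) where
  toFun p s := -((1 - β (s - R / 2)) • p.1 s) + β (s - R / 2) • p.2 (s - R)
  map_add' p q := by funext s; simp only [Prod.fst_add, Prod.snd_add, Pi.add_apply]; module
  map_smul' c p := by
    funext s; simp only [Prod.smul_fst, Prod.smul_snd, Pi.smul_apply, RingHom.id_apply]; module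

/-- `ker ⊕_R` for `R ∈ [0,∞]`; since `⊕_∞ (h, k) = (h, k)`, it is `0` for `R = ∞`. -/
def kerGlue (β : ℝ → ℝ) : WithTop ℝ → Submodule ℝ (PathPairs N)
  | ⊤ => ⊥
  | (R : ℝ) => LinearMap.ker (glue β R)

/-- `ker ⊖_R` for `R ∈ [0,∞]`; it is the whole space for `R = ∞`. -/
def kerAntiGlue (β : ℝ → ℝ) : WithTop ℝ → Submodule ℝ (PathPairs N)
  | ⊤ => ⊤
  | (R : ℝ) => LinearMap.ker (antiGlue β R)

end Gluing

end

/-! Write R = φ(r) and b = β(s - R/2). At each s the pair (⊕_R, ⊖_R) acts on (h(s), k(s-R)) by the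
matrix with rows (b, 1-b) and (-(1-b), b), whose determinant b² + (1-b)² is positive. So the kernels
meet only in zero and the projection is explicit (`glueProj`): with α = b²/det and γ = b(1-b)/det it
replaces h(s) by αh(s) + γk(s-R) and k(s-R) by γh(s) + (1-α)k(s-R). The substance of the theorem is
the sc-smoothness in r, up to and including r = 0.

The projection is the identity plus four terms σ(s - θR) f(s - ηR) (`MovingFam`). Each r-derivative
produces factors r^{-a}e^{b/r} and may put a derivative on f. Where σ lives on [-1,1], both |s| and
|s - ηR| are within 1 of R/2, so passing from weight δ_n to a smaller weight δ_m gains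
e^{-(δ_n-δ_m)R/2}. As R = e^{1/r} - e, this beats every r^{-a}e^{b/r}; hence j derivatives cost j
levels, with bounds uniform in r (`MovingFam.bound`). The unshifted terms have σ = α - 1 or α, which
is not localized, but their derivatives are. On a fixed test function every term vanishes for r near
0, so differentiability at r = 0 is trivial there (`MovingFam.exists_deriv`), and the uniform bounds
carry it to the whole space by density (`exists_smoothFam_of_dense`).

The result is a `SmoothFam`: operators A_j(r) that lose j levels, with A_{j+1} the r-derivative of
A_j. The maps built from such a family in `Adm` are stable under the tangent functor, because the
base point in TE is one level better and pays for the passage from A_j to A_{j+1}. Induction gives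
sc^k for every k (`Adm.isScOfOrder`).

For the sc-structure, completeness follows from passing to the limit in weak derivatives, density
from cutting off and mollifying with a correction of the value at 0 (`dense_test`), and compactness
from an Ehrling inequality with point values on a finite grid (`isCompactOperator_sobolevIncl`). The
conditions at 0 survive because for R > 2 a localized cut-off vanishes at s = 0, while an unshifted
term only rescales f(0). -/

/-! ### Families of operators which are smooth on a scale -/

namespace NormedScale

variable {X Y Z : Type u} [AddCommGroup X] [Module ℝ X] [AddCommGroup Y] [Module ℝ Y]
  [AddCommGroup Z] [Module ℝ Z]

/-- The map `e` restricts to a bounded linear operator `E_m → F_n`. -/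
def Bdd (E : NormedScale X) (m : ℕ) (F : NormedScale Y) (n : ℕ) (e : X → Y) : Prop :=
  ∃ L : E.Lvl m →L[ℝ] F.Lvl n, ∀ x, F.emb n (L x) = e (E.emb m x)

theorem Bdd.comp {E : NormedScale X} {F : NormedScale Y} {G : NormedScale Z} {m n k : ℕ}
    {e : X → Y} {g : Y → Z} (hg : Bdd F n G k g) (he : Bdd E m F n e) :
    Bdd E m G k (fun x => g (e x)) := by
  obtain ⟨L, hL⟩ := he
  obtain ⟨K, hK⟩ := hg
  exact ⟨K.comp L, fun x => by simp [hK, hL]⟩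

/-- All inclusions between levels are bounded. -/
def Nested (E : NormedScale X) : Prop := ∀ m n, m ≤ n → Bdd E n E m id

theorem IsScStructure.nested {E : NormedScale X} (hE : E.IsScStructure) : E.Nested := by
  intro m n hmn
  rcases hmn.eq_or_lt with rfl | h
  · exact ⟨ContinuousLinearMap.id ℝ _, fun x => rfl⟩
  · obtain ⟨ι, hι, -⟩ := hE.compact m n h
    exact ⟨ι, hι⟩

theorem Nested.tangent {E : NormedScale X} (hE : E.Nested) : E.tangent.Nested := by
  intro m n hmn
  obtain ⟨K, hK⟩ := hE (m + 1) (n + 1) (by omega)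
  obtain ⟨L, hL⟩ := hE m n hmn
  refine ⟨(K.prodMap L : E.Lvl (n + 1) × E.Lvl n →L[ℝ] E.Lvl (m + 1) × E.Lvl m), fun x => ?_⟩
  exact Prod.ext (hK x.1) (hL x.2)

theorem Nested.prod {E : NormedScale X} {F : NormedScale Y} (hE : E.Nested) (hF : F.Nested) :
    (E.prod F).Nested := by
  intro m n hmn
  obtain ⟨K, hK⟩ := hE m n hmn
  obtain ⟨L, hL⟩ := hF m n hmn
  refine ⟨(K.prodMap L : E.Lvl n × F.Lvl n →L[ℝ] E.Lvl m × F.Lvl m), fun x => ?_⟩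
  exact Prod.ext (hK x.1) (hL x.2)

theorem bdd_fst_tangent {E : NormedScale X} {m : ℕ} :
    Bdd E.tangent m E (m + 1) Prod.fst :=
  ⟨(ContinuousLinearMap.fst ℝ (E.Lvl (m + 1)) (E.Lvl m)), fun _ => rfl⟩

theorem bdd_snd_tangent {E : NormedScale X} {m : ℕ} : Bdd E.tangent m E m Prod.snd :=
  ⟨(ContinuousLinearMap.snd ℝ (E.Lvl (m + 1)) (E.Lvl m)), fun _ => rfl⟩

theorem bdd_fst {E : NormedScale X} {F : NormedScale Y} {m : ℕ} :
    Bdd (E.prod F) m E m Prod.fst :=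
  ⟨(ContinuousLinearMap.fst ℝ (E.Lvl m) (F.Lvl m)), fun _ => rfl⟩

theorem bdd_snd {E : NormedScale X} {F : NormedScale Y} {m : ℕ} :
    Bdd (E.prod F) m F m Prod.snd :=
  ⟨(ContinuousLinearMap.snd ℝ (E.Lvl m) (F.Lvl m)), fun _ => rfl⟩

theorem bdd_inl {E : NormedScale X} {F : NormedScale Y} {m : ℕ} :
    Bdd E m (E.prod F) m (fun x => (x, 0)) :=
  ⟨(ContinuousLinearMap.inl ℝ (E.Lvl m) (F.Lvl m)),
    fun _ => Prod.ext rfl ((F.emb m).map_zero)⟩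

theorem bdd_inr {E : NormedScale X} {F : NormedScale Y} {m : ℕ} :
    Bdd F m (E.prod F) m (fun x => (0, x)) :=
  ⟨(ContinuousLinearMap.inr ℝ (E.Lvl m) (F.Lvl m)),
    fun _ => Prod.ext ((E.emb m).map_zero) rfl⟩

end NormedScale

open NormedScale

/-! ### Calculus of smooth families: sc-continuity, linearization, and the tangent functor. -/

section Fam

variable {W W' : Type u} [AddCommGroup W] [Module ℝ W] [AddCommGroup W'] [Module ℝ W']

/-- A sequence of families of operators `A j r`, `r ∈ V`, where `A j r` maps `E_{m+j}` to `E'_m` and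
`A (j + 1)` is the derivative of `A j` with respect to `r`. -/
structure SmoothFam (E : NormedScale W) (E' : NormedScale W') (V : Set ℝ)
    (A : ℕ → ℝ → W → W') : Prop where
  -- Translations are only strongly continuous, so continuity in r is asked for each vector,
  -- together with a uniform operator bound.
  op : ∀ j m n, m + j ≤ n → ∃ L : ℝ → E.Lvl n →L[ℝ] E'.Lvl m,
    (∀ r ∈ V, ∀ x, E'.emb m (L r x) = A j r (E.emb n x)) ∧
    (∀ x, ContinuousOn (fun r => L r x) V) ∧ ∃ C, ∀ r ∈ V, ‖L r‖ ≤ C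
  -- The strict inequality leaves the level that A (j + 1) needs. All choices of L, L' may be
  -- allowed, since injectivity of the embeddings determines them on V.
  deriv : ∀ j m n, m + j < n → ∀ L L' : ℝ → E.Lvl n →L[ℝ] E'.Lvl m,
    (∀ r ∈ V, ∀ x, E'.emb m (L r x) = A j r (E.emb n x)) →
    (∀ r ∈ V, ∀ x, E'.emb m (L' r x) = A (j + 1) r (E.emb n x)) →
    ∀ x, ∀ r ∈ V, HasDerivWithinAt (fun r => L r x) (L' r x) V r

/-- Finite sums of products of linear functionals with maps `x ↦ q (A j (ρ x) (e x))`, where `e` gains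
at least as many levels as `q` and `A j` lose. -/
inductive Adm (A : ℕ → ℝ → W → W') (E : NormedScale W) (E' : NormedScale W')
    {X Y : Type u} [AddCommGroup X] [Module ℝ X] [AddCommGroup Y] [Module ℝ Y]
    (F : NormedScale X) (G : NormedScale Y) (ρ : X →ₗ[ℝ] ℝ) : (X → Y) → Prop
  | atom (j p i : ℕ) (e : X → W) (q : W' → Y) (hij : i + j ≤ p)
      (he : ∀ m n, n ≤ m + p → Bdd F m E n e) (hq : ∀ m n, m + i ≤ n → Bdd E' n G m q) :
      Adm A E E' F G ρ (fun x => q (A j (ρ x) (e x)))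
  | add (f g : X → Y) : Adm A E E' F G ρ f → Adm A E E' F G ρ g →
      Adm A E E' F G ρ (fun x => f x + g x)
  | smul (l : X →ₗ[ℝ] ℝ) (hl : ∀ m, Continuous fun x => l (F.emb m x)) (f : X → Y) :
      Adm A E E' F G ρ f → Adm A E E' F G ρ (fun x => l x • f x)

variable {X Y Z : Type u} [AddCommGroup X] [Module ℝ X] [AddCommGroup Y] [Module ℝ Y]
  [AddCommGroup Z] [Module ℝ Z]
  {A : ℕ → ℝ → W → W'} {E : NormedScale W} {E' : NormedScale W'}
  {F : NormedScale X} {G : NormedScale Y} {H : NormedScale Z} {ρ : X →ₗ[ℝ] ℝ} {f : X → Y}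
  {V : Set ℝ}

theorem Adm.postcomp (hf : Adm A E E' F G ρ f) (Q : Y →ₗ[ℝ] Z) (hQ : ∀ m, Bdd G m H m Q) :
    Adm A E E' F H ρ (fun x => Q (f x)) := by
  induction hf with
  | atom j p i e q hij he hq =>
    exact Adm.atom j p i e (fun y => Q (q y)) hij he fun m n h => (hQ m).comp (hq m n h)
  | add f g _ _ hf hg => simpa only [map_add] using Adm.add _ _ hf hg
  | smul l hl f _ hf => simpa only [map_smul] using Adm.smul l hl _ hf

theorem continuous_comp_fst_tangent {l : X →ₗ[ℝ] ℝ} (hl : ∀ m, Continuous fun x => l (F.emb m x))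
    (m : ℕ) : Continuous fun x => (l ∘ₗ LinearMap.fst ℝ X X) (F.tangent.emb m x) :=
  (hl (m + 1)).comp (continuous_fst (X := F.Lvl (m + 1)) (Y := F.Lvl m))

theorem continuous_comp_snd_tangent {l : X →ₗ[ℝ] ℝ} (hl : ∀ m, Continuous fun x => l (F.emb m x))
    (m : ℕ) : Continuous fun x => (l ∘ₗ LinearMap.snd ℝ X X) (F.tangent.emb m x) :=
  (hl m).comp (continuous_snd (X := F.Lvl (m + 1)) (Y := F.Lvl m))

theorem bdd_comp_fst_tangent {p : ℕ} {e : X → W} (he : ∀ m n, n ≤ m + p → Bdd F m E n e)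
    (m n : ℕ) (h : n ≤ m + (p + 1)) : Bdd F.tangent m E n (fun x => e x.1) :=
  (he (m + 1) n (by omega)).comp bdd_fst_tangent

theorem bdd_comp_snd_tangent {p : ℕ} {e : X → W} (he : ∀ m n, n ≤ m + p → Bdd F m E n e)
    (m n : ℕ) (h : n ≤ m + p) : Bdd F.tangent m E n (fun x => e x.2) :=
  (he m n h).comp bdd_snd_tangent

/-- First component of the tangent map. The base point of the tangent scale lies one level higher,
so e gains p + 1 levels, which pays for the level that q loses by landing in `G.shift`. -/
theorem Adm.comp_fst_shift (hf : Adm A E E' F G ρ f) :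
    Adm A E E' F.tangent G.shift (ρ ∘ₗ LinearMap.fst ℝ X X) (fun x => f x.1) := by
  induction hf with
  | atom j p i e q hij he hq =>
    exact Adm.atom (ρ := ρ ∘ₗ LinearMap.fst ℝ X X) j (p + 1) (i + 1) (fun x => e x.1) q (by omega)
      (bdd_comp_fst_tangent he) fun m n h => hq (m + 1) n (by omega)
  | add f g _ _ hf hg => exact Adm.add _ _ hf hg
  | smul l hl f _ hf =>
    exact Adm.smul (l ∘ₗ LinearMap.fst ℝ X X) (continuous_comp_fst_tangent hl) _ hf

/-- Used for the term l(h) f(x) of the product rule; here the extra level of the base point is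
thrown away. -/
theorem Adm.comp_fst (hf : Adm A E E' F G ρ f) :
    Adm A E E' F.tangent G (ρ ∘ₗ LinearMap.fst ℝ X X) (fun x => f x.1) := by
  induction hf with
  | atom j p i e q hij he hq =>
    exact Adm.atom (ρ := ρ ∘ₗ LinearMap.fst ℝ X X) j (p + 1) i (fun x => e x.1) q (by omega)
      (bdd_comp_fst_tangent he) hq
  | add f g _ _ hf hg => exact Adm.add _ _ hf hg
  | smul l hl f _ hf =>
    exact Adm.smul (l ∘ₗ LinearMap.fst ℝ X X) (continuous_comp_fst_tangent hl) _ hf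

/-- For an atom, strong continuity and the uniform bound give joint continuity: L_r y - L_{r₀} y₀ =
L_r(y - y₀) + (L_r - L_{r₀})y₀. The levels run m → m + p → m + i → m, which is possible because i +
j ≤ p. -/
theorem Adm.isScZero (hA : SmoothFam E E' V A) (hρ : ∀ m, Continuous fun x => ρ (F.emb m x))
    (hf : Adm A E E' F G ρ f) : IsScZero F G {x | ρ x ∈ V} f := by
  induction hf with
  | atom j p i e q hij he hq =>
    intro m
    obtain ⟨K, hK⟩ := he m (m + p) le_rfl
    obtain ⟨Q, hQ⟩ := hq m (m + i) le_rfl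
    obtain ⟨L, hL, hLc, C, hC⟩ := hA.op j (m + i) (m + p) (by omega)
    refine ⟨fun x => Q (L (ρ (F.emb m x)) (K x)), ?_, fun x hx => ?_⟩
    · refine Q.continuous.comp_continuousOn fun x₀ hx₀ => ?_
      have h1 : Tendsto (fun x => L (ρ (F.emb m x)) (K x₀)) (𝓝[F.emb m ⁻¹' {x | ρ x ∈ V}] x₀)
          (𝓝 (L (ρ (F.emb m x₀)) (K x₀))) :=
        ((hLc (K x₀)).comp (hρ m).continuousOn fun x hx => hx) x₀ hx₀
      have h2 : Tendsto (fun x => L (ρ (F.emb m x)) (K x) - L (ρ (F.emb m x)) (K x₀))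
          (𝓝[F.emb m ⁻¹' {x | ρ x ∈ V}] x₀) (𝓝 0) := by
        have h3 : Tendsto (fun x => C * ‖K x - K x₀‖) (𝓝[F.emb m ⁻¹' {x | ρ x ∈ V}] x₀) (𝓝 0) := by
          have : Continuous fun x => C * ‖K x - K x₀‖ := by fun_prop
          have h4 := (this.tendsto x₀).mono_left (nhdsWithin_le_nhds (s := F.emb m ⁻¹' {x | ρ x ∈ V}))
          simpa only [sub_self, norm_zero, mul_zero] using h4
        refine squeeze_zero_norm' ?_ h3
        filter_upwards [self_mem_nhdsWithin] with x hx
        rw [← map_sub]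
        exact (L _).le_of_opNorm_le (hC _ hx) _
      have := h2.add h1
      simpa [ContinuousWithinAt] using this
    · rw [hQ, hL _ hx, hK]
  | add f g _ _ hf hg =>
    intro m
    obtain ⟨f', hfc, hf'⟩ := hf m
    obtain ⟨g', hgc, hg'⟩ := hg m
    exact ⟨fun x => f' x + g' x, hfc.add hgc, fun x hx => by rw [map_add, hf' x hx, hg' x hx]⟩
  | smul l hl f _ hf =>
    intro m
    obtain ⟨f', hfc, hf'⟩ := hf m
    exact ⟨fun x => l (F.emb m x) • f' x, (hl m).continuousOn.smul hfc,
      fun x hx => by rw [map_smul, hf' x hx]⟩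

theorem IsLinearization.add {U : Set X} {f g : X → Y} {Df Dg : X → X → Y}
    (hf : IsLinearization F G U f Df) (hg : IsLinearization F G U g Dg) :
    IsLinearization F G U (fun x => f x + g x) (fun x h => Df x h + Dg x h) := by
  intro x hx
  obtain ⟨⟨L, hL⟩, h1⟩ := hf x hx
  obtain ⟨⟨K, hK⟩, h2⟩ := hg x hx
  refine ⟨⟨L + K, fun h => by simp [hL, hK]⟩, fun ε hε => ?_⟩
  obtain ⟨d, hd, h1⟩ := h1 (ε / 2) (by positivity)
  obtain ⟨d', hd', h2⟩ := h2 (ε / 2) (by positivity)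
  refine ⟨min d d', lt_min hd hd', fun h hh hU => ?_⟩
  obtain ⟨y, hy, hy'⟩ := h1 h (hh.trans_le (min_le_left _ _)) hU
  obtain ⟨z, hz, hz'⟩ := h2 h (hh.trans_le (min_le_right _ _)) hU
  refine ⟨y + z, by rw [map_add, hy, hz]; module, (norm_add_le _ _).trans ?_⟩
  linarith

/-- The remainder of the product is l(x+h) times the remainder of f plus l(h) Df(x)h, and the latter
is quadratic in ‖h‖₁. -/
theorem IsLinearization.smul {U : Set X} {f : X → Y} {Df : X → X → Y} {l : X →ₗ[ℝ] ℝ}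
    (hl : ∀ m, Continuous fun x => l (F.emb m x)) (hF : F.Nested) (hf0 : IsScZero F G U f)
    (hf : IsLinearization F G U f Df) :
    IsLinearization F G U (fun x => l x • f x) (fun x h => l h • f x + l x • Df x h) := by
  intro x hx
  obtain ⟨⟨L, hL⟩, h1⟩ := hf x hx
  obtain ⟨ι, hι⟩ := hF 0 1 zero_le_one
  obtain ⟨f', -, hf'⟩ := hf0 0
  have hx0 : F.emb 0 (ι x) ∈ U := by rw [hι]; exact hx
  have hfx : G.emb 0 (f' (ι x)) = f (F.emb 1 x) := by rw [hf' _ hx0, hι]; rfl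
  let l0 : F.Lvl 0 →L[ℝ] ℝ := ⟨l ∘ₗ F.emb 0, hl 0⟩
  let l1 : F.Lvl 1 →L[ℝ] ℝ := ⟨l ∘ₗ F.emb 1, hl 1⟩
  have e0 : ∀ h, l0 h = l (F.emb 0 h) := fun h => rfl
  have e1 : ∀ h, l1 h = l (F.emb 1 h) := fun h => rfl
  refine ⟨⟨l0.smulRight (f' (ι x)) + l (F.emb 1 x) • L, fun h => by simp [hL, hfx, e0]⟩,
    fun ε hε => ?_⟩
  set M := |l1 x| + ‖l1‖ + 1 with hM
  have hM0 : 0 < M := by positivity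
  set B := ‖l1‖ * (‖L‖ * ‖ι‖) + 1 with hB
  have hB0 : 0 < B := by positivity
  obtain ⟨d, hd, h1⟩ := h1 (ε / (2 * M)) (by positivity)
  refine ⟨min d (min 1 (ε / (2 * B))), by positivity, fun h hh hU => ?_⟩
  obtain ⟨y, hy, hy'⟩ := h1 h (hh.trans_le (min_le_left _ _)) hU
  have hh1 : ‖h‖ ≤ 1 := (hh.trans_le ((min_le_right _ _).trans (min_le_left _ _))).le
  have hh2 : ‖h‖ ≤ ε / (2 * B) := (hh.trans_le ((min_le_right _ _).trans (min_le_right _ _))).le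
  have hh3 : ‖h‖ * B ≤ ε / 2 := by
    calc ‖h‖ * B ≤ ε / (2 * B) * B := by gcongr
      _ = ε / 2 := by field_simp
  refine ⟨l1 (x + h) • y + l1 h • L (ι h), ?_, ?_⟩
  · rw [map_add, map_smul, map_smul, hy, hL, hι, e1, e1]
    simp only [map_add, id]
    module
  · have a1 : ‖l1 (x + h)‖ ≤ M := by
      rw [map_add]
      refine (norm_add_le _ _).trans ?_
      have := l1.le_of_opNorm_le le_rfl h
      have h4 : ‖l1‖ * ‖h‖ ≤ ‖l1‖ := mul_le_of_le_one_right (norm_nonneg _) hh1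
      rw [Real.norm_eq_abs (l1 x)]
      linarith
    have a2 : ‖l1 h • L (ι h)‖ ≤ ε / 2 * ‖h‖ := by
      calc ‖l1 h • L (ι h)‖ = ‖l1 h‖ * ‖L (ι h)‖ := norm_smul _ _
        _ ≤ (‖l1‖ * ‖h‖) * (‖L‖ * (‖ι‖ * ‖h‖)) := by
          gcongr
          · exact l1.le_opNorm h
          · exact (L.le_opNorm _).trans (by gcongr; exact ι.le_opNorm h)
        _ ≤ (‖h‖ * B) * ‖h‖ := by
          have := norm_nonneg h
          nlinarith [mul_nonneg this this]
        _ ≤ ε / 2 * ‖h‖ := by gcongr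
    have a3 : ‖l1 (x + h) • y‖ ≤ ε / 2 * ‖h‖ := by
      calc ‖l1 (x + h) • y‖ = ‖l1 (x + h)‖ * ‖y‖ := norm_smul _ _
        _ ≤ M * (ε / (2 * M) * ‖h‖) := by gcongr
        _ = ε / 2 * ‖h‖ := by field_simp
    refine (norm_add_le _ _).trans ?_
    linarith

/-- With t = ρ(h) the remainder splits into L_{r+t}Kx - L_rKx - tL'_rKx, which is o(t) for the fixed
vector Kx, and (L_{r+t} - L_r)Kh, which the mean value inequality on the convex set V bounds by
C‖Kh‖|t|. Both use the extra level of x and h in F₁; the linearization itself needs only h in F₀,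
because A (j + 1) is applied to x alone. -/
theorem SmoothFam.isLinearization (hA : SmoothFam E E' V A) (hV : Convex ℝ V)
    (hρ : ∀ m, Continuous fun x => ρ (F.emb m x))
    {j p i : ℕ} {e : X → W} {q : W' → Y} (hij : i + j ≤ p)
    (he : ∀ m n, n ≤ m + p → Bdd F m E n e) (hq : ∀ m n, m + i ≤ n → Bdd E' n G m q) :
    IsLinearization F G {x | ρ x ∈ V} (fun x => q (A j (ρ x) (e x)))
      (fun x h => ρ h • q (A (j + 1) (ρ x) (e x)) + q (A j (ρ x) (e h))) := by
  intro x hx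
  have hx : ρ (F.emb 1 x) ∈ V := hx
  obtain ⟨K, hK⟩ := he 1 (i + j + 1) (by omega)
  obtain ⟨K0, hK0⟩ := he 0 (i + j) (by omega)
  obtain ⟨Q, hQ⟩ := hq 0 i (by omega)
  obtain ⟨L, hL, -, -⟩ := hA.op j i (i + j + 1) (by omega)
  obtain ⟨L0, hL0, -, -⟩ := hA.op j i (i + j) (by omega)
  obtain ⟨L', hL', -, C, hC⟩ := hA.op (j + 1) i (i + j + 1) (by omega)
  have hd := hA.deriv j i (i + j + 1) (by omega) L L' hL hL'
  let ρ0 : F.Lvl 0 →L[ℝ] ℝ := ⟨ρ ∘ₗ F.emb 0, hρ 0⟩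
  let ρ1 : F.Lvl 1 →L[ℝ] ℝ := ⟨ρ ∘ₗ F.emb 1, hρ 1⟩
  have e0 : ∀ h, ρ0 h = ρ (F.emb 0 h) := fun h => rfl
  have e1 : ∀ h, ρ1 h = ρ (F.emb 1 h) := fun h => rfl
  set r := ρ (F.emb 1 x) with hr
  refine ⟨⟨ρ0.smulRight (Q (L' r (K x))) + Q.comp ((L0 r).comp K0), fun h => ?_⟩, fun ε hε => ?_⟩
  · simp [hQ, hL', hL0, hx, hK, hK0, e0, ← hr]
  have hC0 : 0 ≤ C := (norm_nonneg _).trans (hC r hx)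
  set B := ‖Q‖ * ‖ρ1‖ + 1 with hB
  have hB0 : 0 < B := by positivity
  set B' := ‖Q‖ * (C * ‖ρ1‖ * ‖K‖) + 1 with hB'
  have hB0' : 0 < B' := by positivity
  have h1 := (hasDerivWithinAt_iff_isLittleO.1 (hd (K x) r hx)).def (c := ε / (2 * B))
    (by positivity)
  obtain ⟨d, hd0, h1⟩ := Metric.mem_nhdsWithin_iff.1 h1
  refine ⟨min (d / (‖ρ1‖ + 1)) (ε / (2 * B')), by positivity, fun h hh hU => ?_⟩
  have hh1 : ‖h‖ < d / (‖ρ1‖ + 1) := hh.trans_le (min_le_left _ _)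
  have hh2 : ‖h‖ ≤ ε / (2 * B') := (hh.trans_le (min_le_right _ _)).le
  have hU : ρ (F.emb 1 (x + h)) ∈ V := hU
  have hρh : ρ (F.emb 1 (x + h)) = r + ρ1 h := by simp [e1, hr]
  rw [hρh] at hU
  have ht : ‖ρ1 h‖ ≤ ‖ρ1‖ * ‖h‖ := ρ1.le_opNorm h
  have htd : ‖ρ1 h‖ < d := by
    calc ‖ρ1 h‖ ≤ ‖ρ1‖ * ‖h‖ := ht
      _ ≤ (‖ρ1‖ + 1) * ‖h‖ := by gcongr; linarith
      _ < (‖ρ1‖ + 1) * (d / (‖ρ1‖ + 1)) := by gcongr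
      _ = d := by field_simp
  set t := ρ1 h with ht'
  have b1 : ‖L (r + t) (K x) - L r (K x) - t • L' r (K x)‖ ≤ ε / (2 * B) * ‖t‖ := by
    have := h1 ⟨by simpa [dist_eq_norm] using htd, hU⟩
    simpa using this
  have b2 : ‖L (r + t) (K h) - L r (K h)‖ ≤ C * ‖K h‖ * ‖t‖ := by
    have := hV.norm_image_sub_le_of_norm_hasDerivWithin_le (f := fun r => L r (K h))
      (f' := fun r => L' r (K h)) (C := C * ‖K h‖) (fun s hs => hd (K h) s hs)
      (fun s hs => (L' s).le_of_opNorm_le (hC s hs) _) hx hU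
    simpa using this
  refine ⟨Q ((L (r + t) (K x) - L r (K x) - t • L' r (K x)) + (L (r + t) (K h) - L r (K h))), ?_, ?_⟩
  · have c1 : ∀ (s : ℝ) (hs : s ∈ V) (z : F.Lvl 1), G.emb 0 (Q (L s (K z))) = q (A j s (e (F.emb 1 z))) := by
      intro s hs z
      rw [hQ, hL s hs, hK]
    have c2 : G.emb 0 (Q (L' r (K x))) = q (A (j + 1) r (e (F.emb 1 x))) := by
      rw [hQ, hL' r hx, hK]
    beta_reduce
    rw [hρh, ← hr, ← c1 _ hU, ← c1 _ hx, ← c2, ← c1 _ hx, ← e1, ← ht']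
    simp only [map_add, map_sub, map_smul]
    module
  · have k1 : ‖K h‖ ≤ ‖K‖ * ‖h‖ := K.le_opNorm h
    calc _ ≤ ‖Q‖ * (ε / (2 * B) * ‖t‖ + C * ‖K h‖ * ‖t‖) :=
          (Q.le_opNorm _).trans (by gcongr; exact (norm_add_le _ _).trans (add_le_add b1 b2))
      _ ≤ ‖Q‖ * (ε / (2 * B) * (‖ρ1‖ * ‖h‖) + C * (‖K‖ * ‖h‖) * (‖ρ1‖ * ‖h‖)) := by gcongr
      _ = (‖Q‖ * ‖ρ1‖) * (ε / (2 * B)) * ‖h‖ + (‖Q‖ * (C * ‖ρ1‖ * ‖K‖)) * ‖h‖ * ‖h‖ := by ring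
      _ ≤ B * (ε / (2 * B)) * ‖h‖ + B' * (ε / (2 * B')) * ‖h‖ := by
          gcongr
          · linarith
          · linarith
      _ = ε * ‖h‖ := by field_simp; ring

/-- Differentiating an atom in its parameter raises j by one, but A (j + 1) meets the base point,
for which p also rises by one. Differentiating in the vector leaves j and p unchanged. -/
theorem Adm.exists_linearization (hA : SmoothFam E E' V A) (hV : Convex ℝ V) (hF : F.Nested)
    (hρ : ∀ m, Continuous fun x => ρ (F.emb m x)) (hf : Adm A E E' F G ρ f) :
    ∃ Df : X → X → Y, IsLinearization F G {x | ρ x ∈ V} f Df ∧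
      Adm A E E' F.tangent G (ρ ∘ₗ LinearMap.fst ℝ X X) (fun p => Df p.1 p.2) := by
  induction hf with
  | atom j p i e q hij he hq =>
    refine ⟨_, hA.isLinearization hV hρ hij he hq, ?_⟩
    refine Adm.add _ _ (Adm.smul (ρ ∘ₗ LinearMap.snd ℝ X X) (continuous_comp_snd_tangent hρ) _ ?_) ?_
    · exact Adm.atom (ρ := ρ ∘ₗ LinearMap.fst ℝ X X) (j + 1) (p + 1) i (fun x => e x.1) q (by omega)
        (bdd_comp_fst_tangent he) hq
    · exact Adm.atom (ρ := ρ ∘ₗ LinearMap.fst ℝ X X) j p i (fun x => e x.2) q (by omega)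
        (bdd_comp_snd_tangent he) hq
  | add f g _ _ hf hg =>
    obtain ⟨Df, h1, h2⟩ := hf
    obtain ⟨Dg, h3, h4⟩ := hg
    exact ⟨_, h1.add h3, Adm.add _ _ h2 h4⟩
  | smul l hl f hf0 hf =>
    obtain ⟨Df, h1, h2⟩ := hf
    exact ⟨_, h1.smul hl hF (hf0.isScZero hA hρ), Adm.add _ _
      (Adm.smul (l ∘ₗ LinearMap.snd ℝ X X) (continuous_comp_snd_tangent hl) _ hf0.comp_fst)
      (Adm.smul (l ∘ₗ LinearMap.fst ℝ X X) (continuous_comp_fst_tangent hl) _ h2)⟩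

theorem Adm.isScOfOrder (hA : SmoothFam E E' V A) (hV : Convex ℝ V) (k : ℕ) :
    ∀ {X Y : Type u} [AddCommGroup X] [Module ℝ X] [AddCommGroup Y] [Module ℝ Y]
      {F : NormedScale X} {G : NormedScale Y} {ρ : X →ₗ[ℝ] ℝ} {f : X → Y}, F.Nested →
      (∀ m, Continuous fun x => ρ (F.emb m x)) → Adm A E E' F G ρ f →
      IsScOfOrder k F G {x | ρ x ∈ V} f := by
  induction k with
  | zero =>
    intro X Y _ _ _ _ F G ρ f hF hρ hf
    exact hf.isScZero hA hρ
  | succ k ih =>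
    intro X Y _ _ _ _ F G ρ f hF hρ hf
    obtain ⟨Df, h1, h2⟩ := hf.exists_linearization hA hV hF hρ
    refine ⟨hf.isScZero hA hρ, Df, h1, ?_⟩
    refine ih (ρ := ρ ∘ₗ LinearMap.fst ℝ X X) hF.tangent (continuous_comp_fst_tangent hρ) ?_
    -- The tangent map is (f(x), 0) + (0, Df(x)h), a sum of two admissible maps over the tangent
    -- scale.
    have h3 := hf.comp_fst_shift.postcomp (H := G.tangent) (LinearMap.inl ℝ Y Y) fun m => bdd_inl
    have h4 := h2.postcomp (H := G.tangent) (LinearMap.inr ℝ Y Y) fun m => bdd_inr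
    simpa using Adm.add _ _ h3 h4

/-- Needed because a projection π is an arbitrary function on the ambient space, tied to the
constructed family only on the levels of the scale. The same Df serves for both maps. -/
theorem IsScOfOrder.congr (k : ℕ) :
    ∀ {X Y : Type u} [AddCommGroup X] [Module ℝ X] [AddCommGroup Y] [Module ℝ Y]
      {F : NormedScale X} {G : NormedScale Y} {U : Set X} {f f' : X → Y},
      (∀ m x, F.emb m x ∈ U → f (F.emb m x) = f' (F.emb m x)) →
      IsScOfOrder k F G U f → IsScOfOrder k F G U f' := by
  have key : ∀ {X Y : Type u} [AddCommGroup X] [Module ℝ X] [AddCommGroup Y] [Module ℝ Y]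
      {F : NormedScale X} {G : NormedScale Y} {U : Set X} {f f' : X → Y},
      (∀ m x, F.emb m x ∈ U → f (F.emb m x) = f' (F.emb m x)) →
      IsScZero F G U f → IsScZero F G U f' := by
    intro X Y _ _ _ _ F G U f f' h hf m
    obtain ⟨g, hg, hg'⟩ := hf m
    exact ⟨g, hg, fun x hx => (hg' x hx).trans (h m x hx)⟩
  induction k with
  | zero =>
    intro X Y _ _ _ _ F G U f f' h hf
    exact key h hf
  | succ k ih =>
    intro X Y _ _ _ _ F G U f f' h ⟨h0, Df, h1, h2⟩
    refine ⟨key h h0, Df, fun x hx => ⟨(h1 x hx).1, fun ε hε => ?_⟩, ih ?_ h2⟩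
    · obtain ⟨d, hd, h3⟩ := (h1 x hx).2 ε hε
      refine ⟨d, hd, fun y hy hU => ?_⟩
      obtain ⟨z, hz, hz'⟩ := h3 y hy hU
      exact ⟨z, by rw [hz, h 1 _ hU, h 1 _ hx], hz'⟩
    · intro m x hx
      exact Prod.ext (h (m + 1) x.1 hx) rfl

theorem SmoothFam.add {A B : ℕ → ℝ → W → W'} (hA : SmoothFam E E' V A)
    (hB : SmoothFam E E' V B) : SmoothFam E E' V (fun j r x => A j r x + B j r x) := by
  refine ⟨fun j m n h => ?_, fun j m n h L L' hL hL' x r hr => ?_⟩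
  · obtain ⟨L, h1, h2, C, h3⟩ := hA.op j m n h
    obtain ⟨K, h4, h5, C', h6⟩ := hB.op j m n h
    exact ⟨fun r => L r + K r, fun r hr x => by simp [h1 r hr, h4 r hr],
      fun x => (h2 x).add (h5 x), C + C', fun r hr =>
      (norm_add_le _ _).trans (add_le_add (h3 r hr) (h6 r hr))⟩
  · obtain ⟨K, h1, -, -⟩ := hA.op j m n h.le
    obtain ⟨K', h1', -, -⟩ := hA.op (j + 1) m n h
    obtain ⟨M, h2, -, -⟩ := hB.op j m n h.le
    obtain ⟨M', h2', -, -⟩ := hB.op (j + 1) m n h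
    have e1 : ∀ r ∈ V, L r x = K r x + M r x := fun r hr =>
      E'.emb_injective m (by rw [hL r hr, map_add, h1 r hr, h2 r hr])
    have e2 : L' r x = K' r x + M' r x :=
      E'.emb_injective m (by rw [hL' r hr, map_add, h1' r hr, h2' r hr])
    rw [e2]
    exact ((hA.deriv j m n h K K' h1 h1' x r hr).add
      (hB.deriv j m n h M M' h2 h2' x r hr)).congr e1 (e1 r hr)

theorem SmoothFam.comp {W₁ W₂ : Type u} [AddCommGroup W₁] [Module ℝ W₁] [AddCommGroup W₂]
    [Module ℝ W₂] {E₁ : NormedScale W₁} {E₂ : NormedScale W₂} (hA : SmoothFam E E' V A)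
    {e : W₁ → W} {q : W' → W₂} (he : ∀ m, Bdd E₁ m E m e) (hq : ∀ m, Bdd E' m E₂ m q) :
    SmoothFam E₁ E₂ V (fun j r x => q (A j r (e x))) := by
  refine ⟨fun j m n h => ?_, fun j m n h L L' hL hL' x r hr => ?_⟩
  · obtain ⟨L, h1, h2, C, h3⟩ := hA.op j m n h
    obtain ⟨K, hK⟩ := he n
    obtain ⟨Q, hQ⟩ := hq m
    refine ⟨fun r => Q.comp ((L r).comp K), fun r hr x => by simp [hQ, h1 r hr, hK],
      fun x => Q.continuous.comp_continuousOn (h2 (K x)), ‖Q‖ * (C * ‖K‖), fun r hr => ?_⟩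
    refine (Q.opNorm_comp_le _).trans ?_
    gcongr
    refine ((L r).opNorm_comp_le _).trans ?_
    gcongr
    exact h3 r hr
  · obtain ⟨M, h1, -, -⟩ := hA.op j m n h.le
    obtain ⟨M', h1', -, -⟩ := hA.op (j + 1) m n h
    obtain ⟨K, hK⟩ := he n
    obtain ⟨Q, hQ⟩ := hq m
    have e1 : ∀ r ∈ V, L r x = Q (M r (K x)) := fun r hr =>
      E₂.emb_injective m (by rw [hL r hr, hQ, h1 r hr, hK])
    have e2 : L' r x = Q (M' r (K x)) :=
      E₂.emb_injective m (by rw [hL' r hr, hQ, h1' r hr, hK])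
    rw [e2]
    exact (Q.hasFDerivAt.comp_hasDerivWithinAt r
      (hA.deriv j m n h M M' h1 h1' (K x) r hr)).congr e1 (e1 r hr)

end Fam

/-! ### Extension of families of operators from a dense subspace -/

section DenseExtension

variable {M M' : Type*} [NormedAddCommGroup M] [NormedSpace ℝ M] [NormedAddCommGroup M']
  [NormedSpace ℝ M']

theorem exists_clm_of_dense [CompleteSpace M'] (D : Submodule ℝ M) (hD : Dense (D : Set M))
    (g : D →ₗ[ℝ] M') {C : ℝ} (hC : 0 ≤ C) (hg : ∀ x, ‖g x‖ ≤ C * ‖x‖) :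
    ∃ L : M →L[ℝ] M', (∀ x : D, L x = g x) ∧ ‖L‖ ≤ C := by
  have hd : DenseRange D.subtypeL := by simpa [DenseRange] using hD
  have hi : IsUniformInducing D.subtypeL := isUniformEmbedding_subtype_val.isUniformInducing
  have h1 : ∀ x : D, ((g.mkContinuous C hg).extend D.subtypeL) x = g x := fun x =>
    ContinuousLinearMap.extend_eq _ hd hi x
  refine ⟨(g.mkContinuous C hg).extend D.subtypeL, h1, ?_⟩
  refine ContinuousLinearMap.opNorm_le_bound _ hC fun x => ?_
  refine hD.induction (P := fun x => ‖((g.mkContinuous C hg).extend D.subtypeL) x‖ ≤ C * ‖x‖)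
    (fun x hx => ?_) (isClosed_le (by fun_prop) (by fun_prop)) x
  rw [h1 ⟨x, hx⟩]
  exact hg ⟨x, hx⟩

/-- An ε/3 argument; the uniform bound makes the approximation by a vector of S uniform in r. -/
theorem continuousOn_of_dense {V : Set ℝ} {L : ℝ → M →L[ℝ] M'} {C : ℝ} (hC : ∀ r ∈ V, ‖L r‖ ≤ C)
    {S : Set M} (hS : Dense S) (h : ∀ x ∈ S, ContinuousOn (fun r => L r x) V) (x : M) :
    ContinuousOn (fun r => L r x) V := by
  intro r hr
  have hC0 : 0 ≤ C := (norm_nonneg _).trans (hC r hr)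
  refine Metric.tendsto_nhds.2 fun ε hε => ?_
  obtain ⟨y, hyS, hy⟩ := hS.exists_dist_lt x (ε := ε / (3 * (C + 1))) (by positivity)
  have hb : ∀ s ∈ V, dist (L s x) (L s y) ≤ ε / 3 := fun s hs => by
    rw [dist_eq_norm, ← map_sub]
    refine ((L s).le_of_opNorm_le (hC s hs) _).trans ?_
    rw [dist_eq_norm] at hy
    calc C * ‖x - y‖ ≤ (C + 1) * (ε / (3 * (C + 1))) := by gcongr; linarith
      _ = ε / 3 := by field_simp
  filter_upwards [Metric.tendsto_nhds.1 (h y hyS r hr) (ε / 3) (by positivity),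
    self_mem_nhdsWithin] with s hs hsV
  have h1 := hb s hsV
  have h2 := hb r hr
  rw [dist_comm] at h2
  linarith [dist_triangle (L s x) (L s y) (L r x), dist_triangle (L s y) (L r y) (L r x)]

/-- A bound on L' alone makes r ↦ L_r x Lipschitz with constant C‖x‖ for x in S, and this estimate
is closed in x. Difference quotients are thus equibounded, and approximating x by y in S changes
both quotient and derivative by little. -/
theorem hasDerivWithinAt_of_dense {V : Set ℝ} (hV : Convex ℝ V) {L L' : ℝ → M →L[ℝ] M'} {C : ℝ}
    (hC : ∀ r ∈ V, ‖L' r‖ ≤ C) {S : Set M} (hS : Dense S)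
    (h : ∀ x ∈ S, ∀ r ∈ V, HasDerivWithinAt (fun r => L r x) (L' r x) V r) (x : M) {r : ℝ}
    (hr : r ∈ V) : HasDerivWithinAt (fun r => L r x) (L' r x) V r := by
  have hC0 : 0 ≤ C := (norm_nonneg _).trans (hC r hr)
  have hlip : ∀ s ∈ V, ∀ x, ‖L s x - L r x‖ ≤ C * ‖x‖ * ‖s - r‖ := by
    intro s hs x
    refine hS.induction (P := fun x => ‖L s x - L r x‖ ≤ C * ‖x‖ * ‖s - r‖) (fun x hx => ?_)
      (isClosed_le (by fun_prop) (by fun_prop)) x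
    exact hV.norm_image_sub_le_of_norm_hasDerivWithin_le (h x hx)
      (fun t ht => (L' t).le_of_opNorm_le (hC t ht) _) hr hs
  rw [hasDerivWithinAt_iff_isLittleO]
  refine Asymptotics.IsLittleO.of_bound fun ε hε => ?_
  obtain ⟨y, hyS, hy⟩ := hS.exists_dist_lt x (ε := ε / (3 * (C + 1))) (by positivity)
  rw [dist_eq_norm] at hy
  have hb : C * ‖x - y‖ ≤ ε / 3 := by
    calc C * ‖x - y‖ ≤ (C + 1) * (ε / (3 * (C + 1))) := by gcongr; linarith
      _ = ε / 3 := by field_simp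
  have h1 := (hasDerivWithinAt_iff_isLittleO.1 (h y hyS r hr)).def (c := ε / 3) (by positivity)
  filter_upwards [h1, self_mem_nhdsWithin] with s hs hsV
  have h2 : ‖L s (x - y) - L r (x - y)‖ ≤ ε / 3 * ‖s - r‖ :=
    (hlip s hsV _).trans (by gcongr)
  have h3 : ‖(s - r) • L' r (x - y)‖ ≤ ε / 3 * ‖s - r‖ := by
    rw [norm_smul, mul_comm]
    gcongr
    exact ((L' r).le_of_opNorm_le (hC r hr) _).trans hb
  have e : L s x - L r x - (s - r) • L' r x = (L s y - L r y - (s - r) • L' r y) +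
      (L s (x - y) - L r (x - y)) - (s - r) • L' r (x - y) := by
    simp only [map_sub, smul_sub]; module
  rw [e]
  refine (norm_sub_le _ _).trans ((add_le_add (norm_add_le _ _) le_rfl).trans ?_)
  linarith

end DenseExtension

open NormedScale

section

variable {W W' : Type u} [AddCommGroup W] [Module ℝ W] [AddCommGroup W'] [Module ℝ W']

theorem exists_clm_of_dense_scale {E : NormedScale W} {E' : NormedScale W'}
    {D : Submodule ℝ W} {n m : ℕ} [CompleteSpace (E'.Lvl m)]
    (hD : Dense {x : E.Lvl n | E.emb n x ∈ D}) (T : D →ₗ[ℝ] W') {C : ℝ} (hC : 0 ≤ C)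
    (hb : ∀ (d : D) (x : E.Lvl n), E.emb n x = d → ∃ y : E'.Lvl m, E'.emb m y = T d ∧
      ‖y‖ ≤ C * ‖x‖) :
    ∃ L : E.Lvl n →L[ℝ] E'.Lvl m, (∀ (x : E.Lvl n) (h : E.emb n x ∈ D),
      E'.emb m (L x) = T ⟨_, h⟩) ∧ ‖L‖ ≤ C := by
  choose y hy hy' using fun x : D.comap (E.emb n) => hb ⟨_, x.2⟩ x.1 rfl
  let g : D.comap (E.emb n) →ₗ[ℝ] E'.Lvl m :=
    { toFun := y
      map_add' := fun a b => E'.emb_injective m (by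
        rw [map_add, hy, hy, hy, ← map_add]; congr 1; ext1; simp)
      map_smul' := fun c a => E'.emb_injective m (by
        rw [map_smul, hy, hy, ← map_smul]; congr 1; ext1; simp) }
  obtain ⟨L, h1, h2⟩ := exists_clm_of_dense (D.comap (E.emb n)) hD g hC hy'
  exact ⟨L, fun x h => by rw [h1 ⟨x, h⟩]; exact hy ⟨x, h⟩, h2⟩

/-- Only uniform bounds and derivatives on D have to be checked. The extensions for different pairs
of levels are made independently; they are compatible because they agree on D, which is dense in
every level. -/
theorem exists_smoothFam_of_dense {E : NormedScale W} {E' : NormedScale W'} {V : Set ℝ}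
    (hE : E.Nested) (hE' : E'.Nested) (hc : ∀ m, CompleteSpace (E'.Lvl m)) (hV : Convex ℝ V)
    {D : Submodule ℝ W} (hD : ∀ m, Dense {x : E.Lvl m | E.emb m x ∈ D})
    (hD' : ∀ m, ∀ d ∈ D, d ∈ range (E.emb m)) (T : ℕ → ℝ → D →ₗ[ℝ] W')
    (hb : ∀ j m n, m + j ≤ n → ∃ C, 0 ≤ C ∧ ∀ r ∈ V, ∀ (d : D) (x : E.Lvl n), E.emb n x = d →
      ∃ y : E'.Lvl m, E'.emb m y = T j r d ∧ ‖y‖ ≤ C * ‖x‖)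
    (hd : ∀ j m (d : D), ∃ c c' : ℝ → E'.Lvl m, ∀ r ∈ V, E'.emb m (c r) = T j r d ∧
      E'.emb m (c' r) = T (j + 1) r d ∧ HasDerivWithinAt c (c' r) V r) :
    ∃ A : ℕ → ℝ → W → W', SmoothFam E E' V A ∧ ∀ j, ∀ r ∈ V, ∀ d : D, A j r d = T j r d := by
  have hop : ∀ j m n, m + j ≤ n → ∃ L : ℝ → E.Lvl n →L[ℝ] E'.Lvl m,
      (∀ r ∈ V, ∀ (x : E.Lvl n) (h : E.emb n x ∈ D), E'.emb m (L r x) = T j r ⟨_, h⟩) ∧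
      ∃ C, ∀ r ∈ V, ‖L r‖ ≤ C := by
    intro j m n h
    obtain ⟨C, hC, hb⟩ := hb j m n h
    have : ∀ r, ∃ L : E.Lvl n →L[ℝ] E'.Lvl m, r ∈ V → (∀ (x : E.Lvl n) (h : E.emb n x ∈ D),
        E'.emb m (L x) = T j r ⟨_, h⟩) ∧ ‖L‖ ≤ C := fun r => by
      by_cases hr : r ∈ V
      · obtain ⟨L, hL⟩ := exists_clm_of_dense_scale (E' := E') (hD n) (T j r) hC (hb r hr)
        exact ⟨L, fun _ => hL⟩
      · exact ⟨0, fun h => absurd h hr⟩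
    choose L hL using this
    exact ⟨L, fun r hr => (hL r hr).1, C, fun r hr => (hL r hr).2⟩
  choose! L hL hLb using hop
  classical
  -- The pair of levels j → 0 has the largest source on which the j-th operator is required to act,
  -- so it defines A j; the value 0 elsewhere is never used.
  let A : ℕ → ℝ → W → W' := fun j r w =>
    if h : w ∈ range (E.emb j) then E'.emb 0 (L j 0 j r h.choose) else 0
  have hA0 : ∀ j r (x : E.Lvl j), A j r (E.emb j x) = E'.emb 0 (L j 0 j r x) := by
    intro j r x
    have h : E.emb j x ∈ range (E.emb j) := ⟨x, rfl⟩
    simp only [A, dif_pos h]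
    rw [E.emb_injective j h.choose_spec]
  have hA : ∀ j m n, m + j ≤ n → ∀ r ∈ V, ∀ x, E'.emb m (L j m n r x) = A j r (E.emb n x) := by
    intro j m n h r hr x
    obtain ⟨ι, hι⟩ := hE j n (by omega)
    obtain ⟨κ, hκ⟩ := hE' 0 m (by omega)
    have h1 : κ (L j m n r x) = L j 0 j r (ι x) := by
      refine (hD n).induction (P := fun x => κ (L j m n r x) = L j 0 j r (ι x)) (fun x hx => ?_)
        (isClosed_eq (by fun_prop) (by fun_prop)) x
      refine E'.emb_injective 0 ?_
      have hx' : E.emb j (ι x) ∈ D := by rw [hι]; exact hx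
      rw [hκ, id, hL j m n h r hr x hx, hL j 0 j (by omega) r hr _ hx']
      congr 1
      ext1
      exact (hι x).symm
    rw [← id_eq (E.emb n x), ← hι, hA0, ← h1, hκ, id]
  refine ⟨A, ⟨fun j m n h => ⟨L j m n, hA j m n h, ?_, hLb j m n h⟩, ?_⟩, ?_⟩
  · obtain ⟨C, hC⟩ := hLb j m n h
    refine continuousOn_of_dense hC (hD n) fun x hx => ?_
    obtain ⟨c, c', hcc⟩ := hd j m ⟨_, hx⟩
    have e : EqOn (fun r => L j m n r x) c V := fun r hr => E'.emb_injective m (by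
      rw [hL j m n h r hr x hx, (hcc r hr).1])
    exact ContinuousOn.congr (fun r hr => (hcc r hr).2.2.continuousWithinAt) e
  · intro j m n h K K' hK hK' x r hr
    have e : ∀ r ∈ V, K r x = L j m n r x := fun r hr => E'.emb_injective m (by
      rw [hK r hr, hA j m n h.le r hr])
    have e' : K' r x = L (j + 1) m n r x := E'.emb_injective m (by
      rw [hK' r hr, hA (j + 1) m n (by omega) r hr])
    obtain ⟨C, hC⟩ := hLb (j + 1) m n (by omega)
    rw [e']
    refine (hasDerivWithinAt_of_dense (L := L j m n) hV hC (hD n) (fun x hx r hr => ?_) x hr).congr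
      e (e r hr)
    obtain ⟨c, c', hcc⟩ := hd j m ⟨_, hx⟩
    have e : EqOn (fun r => L j m n r x) c V := fun r hr => E'.emb_injective m (by
      rw [hL j m n h.le r hr x hx, (hcc r hr).1])
    have e' : L (j + 1) m n r x = c' r := E'.emb_injective m (by
      rw [hL (j + 1) m n (by omega) r hr x hx, (hcc r hr).2.1])
    rw [e']
    exact (hcc r hr).2.2.congr e (e hr)
  · intro j r hr d
    obtain ⟨x, hx⟩ := hD' j d d.2
    have hx' : E.emb j x ∈ D := by rw [hx]; exact d.2
    rw [← hx, hA0, hL j 0 j (by omega) r hr x hx']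
    congr 1
    ext1
    exact hx

end

/-! ### Weak derivatives and primitives -/

theorem LocallyIntegrable.intervalIntegrable' {G : Type*} [NormedAddCommGroup G]
    {f : ℝ → G} (hf : LocallyIntegrable f) (a b : ℝ) : IntervalIntegrable f volume a b :=
  intervalIntegrable_iff.2 ((hf.integrableOn_isCompact isCompact_uIcc).mono_set uIoc_subset_uIcc)

theorem hasCompactSupport_of_abs_gt {G : Type*} [Zero G] {f : ℝ → G} {M : ℝ}
    (h : ∀ s, M < |s| → f s = 0) : HasCompactSupport f :=
  HasCompactSupport.intro (isCompact_Icc (a := -M) (b := M)) fun s hs => h s (by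
    by_contra hc
    exact hs (abs_le.1 (not_lt.1 hc)))

theorem HasCompactSupport.exists_abs_gt {G : Type*} [Zero G] {f : ℝ → G}
    (h : HasCompactSupport f) : ∃ M, 0 < M ∧ ∀ s, M < |s| → f s = 0 := by
  obtain ⟨M, hM⟩ := h.isCompact.isBounded.subset_closedBall 0
  refine ⟨max M 1, by positivity, fun s hs => image_eq_zero_of_notMem_tsupport fun hc => ?_⟩
  have := hM hc
  rw [mem_closedBall_zero_iff, Real.norm_eq_abs] at this
  exact absurd (this.trans (le_max_left _ _)) (not_le.2 hs)

section Primitive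

variable {G : Type*} [NormedAddCommGroup G] [NormedSpace ℝ G]

theorem intervalIntegral_eq_zero_of_abs_gt {f : ℝ → G} {M : ℝ} (hM : 0 ≤ M)
    (h : ∀ s, M < |s| → f s = 0) (h0 : ∫ s, f s = 0) {s : ℝ} (hs : M < |s|) :
    ∫ t in (-(M + 1))..s, f t = 0 := by
  rcases lt_abs.1 hs with hs | hs
  · rw [intervalIntegral.integral_eq_integral_of_support_subset, h0]
    intro t ht
    have : |t| ≤ M := by
      by_contra hc
      exact ht (h t (not_le.1 hc))
    have := abs_le.1 this
    exact ⟨by linarith [this.1], by linarith [this.2]⟩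
  · rw [intervalIntegral.integral_congr (g := fun _ => 0), intervalIntegral.integral_zero]
    intro t ht
    have : t < -M :=
      ht.2.trans_lt (max_lt (by linarith) (by linarith))
    exact h t (by rw [abs_of_neg (by linarith)]; linarith)

/-- Integrating from -(M+1), left of the support, the primitive vanishes on the left for trivial
reasons and on the right because the mean is zero. -/
theorem exists_primitive [CompleteSpace G] {f : ℝ → G} (hf : ContDiff ℝ ∞ f) {M : ℝ} (hM : 0 ≤ M)
    (h : ∀ s, M < |s| → f s = 0) (h0 : ∫ s, f s = 0) :
    ∃ F : ℝ → G, ContDiff ℝ ∞ F ∧ deriv F = f ∧ ∀ s, M < |s| → F s = 0 := by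
  have hd : ∀ s, HasDerivAt (fun s => ∫ t in (-(M + 1))..s, f t) (f s) s := fun s =>
    intervalIntegral.integral_hasDerivAt_right (hf.continuous.intervalIntegrable _ _)
      (hf.continuous.stronglyMeasurableAtFilter _ _) hf.continuous.continuousAt
  have hd' : deriv (fun s => ∫ t in (-(M + 1))..s, f t) = f := funext fun s => (hd s).deriv
  refine ⟨_, ?_, hd', fun s => intervalIntegral_eq_zero_of_abs_gt hM h h0⟩
  rw [contDiff_infty_iff_deriv, hd']
  exact ⟨fun s => (hd s).differentiableAt, hf⟩

end Primitive

/-- A smooth bump function with integral one. -/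
theorem exists_smooth_integral_eq_one : ∃ η : ℝ → ℝ, ContDiff ℝ ∞ η ∧ (∀ s, 1 < |s| → η s = 0) ∧
    ∫ s, η s = 1 := by
  let b : ContDiffBump (0 : ℝ) := ⟨1 / 2, 1, by norm_num, by norm_num⟩
  refine ⟨b.normed volume, b.contDiff_normed, fun s hs => ?_, b.integral_normed⟩
  have : s ∉ Function.support (b.normed volume) := by
    rw [b.support_normed_eq]
    simpa [b] using hs.le
  simpa using this

section WeakDeriv

variable {N : ℕ} {w v : ℝ → EuclideanSpace ℝ (Fin N)}

theorem IsWeakDeriv.sub {w' v' : ℝ → EuclideanSpace ℝ (Fin N)} (h : IsWeakDeriv w v)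
    (h' : IsWeakDeriv w' v') : IsWeakDeriv (w - w') (v - v') := by
  simpa [sub_eq_add_neg] using h.add (h'.const_smul (-1))

theorem IsWeakDeriv.congr_ae {w' v' : ℝ → EuclideanSpace ℝ (Fin N)} (h : IsWeakDeriv w v)
    (hw : w =ᵐ[volume] w') (hv : v =ᵐ[volume] v') : IsWeakDeriv w' v' := by
  refine ⟨(locallyIntegrable_congr hw).1 h.1, (locallyIntegrable_congr hv).1 h.2.1,
    fun φ hφ hc => ?_⟩
  have e1 : ∫ s, deriv φ s • w' s = ∫ s, deriv φ s • w s :=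
    integral_congr_ae (hw.mono fun s hs => by simp only [hs])
  have e2 : ∫ s, φ s • v' s = ∫ s, φ s • v s :=
    integral_congr_ae (hv.mono fun s hs => by simp only [hs])
  rw [e1, e2]
  exact h.2.2 φ hφ hc

/-- Integration by parts for absolutely continuous functions on an interval beyond the support of φ,
where the boundary terms vanish; by Lebesgue differentiation the primitive has derivative f almost
everywhere. -/
theorem integral_deriv_mul_primitive {f : ℝ → ℝ} (hf : LocallyIntegrable f) {φ : ℝ → ℝ}
    (hφ : ContDiff ℝ ∞ φ) (hc : HasCompactSupport φ) :
    ∫ s, deriv φ s * (∫ t in (0 : ℝ)..s, f t) = -∫ s, φ s * f s := by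
  obtain ⟨M, hM, hM'⟩ := hc.exists_abs_gt
  have hM2 : ∀ s, s ∉ Ioc (-(M + 1)) (M + 1) → M < |s| := fun s hs => by
    by_contra hlt
    have := abs_le.1 (not_lt.1 hlt)
    exact hs ⟨by linarith [this.1], by linarith [this.2]⟩
  have hd0 : ∀ s, M < |s| → deriv φ s = 0 := fun s hs => by
    have : φ =ᶠ[𝓝 s] fun _ => 0 := by
      filter_upwards [continuous_abs.continuousAt.eventually (lt_mem_nhds hs)] with t ht
      exact hM' t ht
    rw [this.deriv_eq, deriv_const]
  have key := AbsolutelyContinuousOnInterval.integral_mul_deriv_eq_deriv_mul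
    (a := -(M + 1)) (b := M + 1) (f := φ) (g := fun s => ∫ t in (0 : ℝ)..s, f t)
    ((hφ.of_le (by norm_cast)).contDiffOn.absolutelyContinuousOnInterval)
    ((LocallyIntegrable.intervalIntegrable' hf _ _).absolutelyContinuousOnInterval_intervalIntegral
      (by rw [uIcc_of_le (by linarith)]; constructor <;> linarith))
  have e1 : φ (M + 1) = 0 := hM' _ (by rw [abs_of_pos (by linarith)]; linarith)
  have e2 : φ (-(M + 1)) = 0 := hM' _ (by rw [abs_neg, abs_of_pos (by linarith)]; linarith)
  have hle : -(M + 1) ≤ M + 1 := by linarith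
  rw [e1, e2, intervalIntegral.integral_of_le hle, intervalIntegral.integral_of_le hle,
    setIntegral_eq_integral_of_forall_compl_eq_zero, setIntegral_eq_integral_of_forall_compl_eq_zero]
    at key
  · have e3 : ∫ s, φ s * deriv (fun s => ∫ t in (0 : ℝ)..s, f t) s = ∫ s, φ s * f s := by
      refine integral_congr_ae ?_
      filter_upwards [LocallyIntegrable.ae_hasDerivAt_integral hf] with s hs
      rw [(hs 0).deriv]
    rw [e3] at key
    linarith
  · intro s hs
    rw [hd0 s (hM2 s hs), zero_mul]
  · intro s hs
    rw [hM' s (hM2 s hs), zero_mul]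

theorem isWeakDeriv_primitive (hv : LocallyIntegrable v) :
    IsWeakDeriv (fun s => ∫ t in (0 : ℝ)..s, v t) v := by
  have hcont : Continuous fun s => ∫ t in (0 : ℝ)..s, v t :=
    intervalIntegral.continuous_primitive (fun a b => LocallyIntegrable.intervalIntegrable' hv a b) 0
  refine ⟨hcont.locallyIntegrable, hv, fun φ hφ hc => ?_⟩
  have hd : Continuous (deriv φ) := hφ.continuous_deriv (by simp)
  ext i
  have hvi : LocallyIntegrable fun s => v s i := by
    intro s
    obtain ⟨U, hU, h⟩ := hv s
    exact ⟨U, hU, (EuclideanSpace.proj (𝕜 := ℝ) i).integrable_comp h⟩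
  have e := integral_deriv_mul_primitive hvi hφ hc
  have i1 := hcont.locallyIntegrable.integrable_smul_left_of_hasCompactSupport (μ := volume) hd hc.deriv
  have i2 := hv.integrable_smul_left_of_hasCompactSupport hφ.continuous hc
  have e1 := (EuclideanSpace.proj (𝕜 := ℝ) i).integral_comp_comm i1
  have e2 := (EuclideanSpace.proj (𝕜 := ℝ) i).integral_comp_comm i2
  have e3 : ∀ s, (∫ t in (0 : ℝ)..s, v t) i = ∫ t in (0 : ℝ)..s, v t i := fun s =>
    ((EuclideanSpace.proj (𝕜 := ℝ) i).intervalIntegral_comp_comm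
      (LocallyIntegrable.intervalIntegrable' hv 0 s)).symm
  simp only [PiLp.proj_apply, PiLp.smul_apply, smul_eq_mul, e3] at e1 e2
  rw [PiLp.neg_apply, ← e1, ← e2, e]

/-- The du Bois-Reymond argument: ψ - (∫ψ)η has mean zero, hence is the derivative of a test
function, and testing gives ∫ψw = (∫ψ)(∫ηw). -/
theorem IsWeakDeriv.ae_const (h : IsWeakDeriv w 0) : ∃ c, w =ᵐ[volume] fun _ => c := by
  obtain ⟨η, hη, hη0, hη1⟩ := exists_smooth_integral_eq_one
  have hηc := hasCompactSupport_of_abs_gt hη0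
  refine ⟨∫ s, η s • w s, ?_⟩
  have key : ∀ᵐ s, w s - ∫ s, η s • w s = 0 := by
    refine ae_eq_zero_of_integral_contDiff_smul_eq_zero (h.1.sub (locallyIntegrable_const _))
      fun ψ hψ hψc => ?_
    obtain ⟨M, hM, hM'⟩ := hψc.exists_abs_gt
    set a := ∫ s, ψ s with ha
    have iψ : Integrable ψ := hψ.continuous.integrable_of_hasCompactSupport hψc
    have iη : Integrable η := hη.continuous.integrable_of_hasCompactSupport hηc
    obtain ⟨F, hF, hF', hF0⟩ := exists_primitive (f := fun s => ψ s - a * η s)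
      (hψ.sub (contDiff_const.mul hη)) (M := max M 1) (by positivity)
      (fun s hs => by
        rw [hM' s ((le_max_left _ _).trans_lt hs), hη0 s ((le_max_right _ _).trans_lt hs)]; simp)
      (by rw [integral_sub iψ (iη.const_mul a), integral_const_mul, hη1, mul_one, ← ha, sub_self])
    have e := h.2.2 F hF (hasCompactSupport_of_abs_gt hF0)
    have iw := h.1.integrable_smul_left_of_hasCompactSupport hψ.continuous hψc
    have iw' := h.1.integrable_smul_left_of_hasCompactSupport hη.continuous hηc
    simp only [hF', Pi.zero_apply, smul_zero, integral_zero, neg_zero, sub_smul, mul_smul] at e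
    have e' := integral_sub iw (iw'.smul a)
    simp only [Pi.smul_apply, integral_smul] at e'
    rw [e'] at e
    simp only [smul_sub]
    rw [integral_sub iw (iψ.smul_const _), integral_smul_const]
    exact e
  exact key.mono fun s hs => sub_eq_zero.1 hs

theorem IsWeakDeriv.ae_eq_primitive (h : IsWeakDeriv w v) :
    ∃ c, w =ᵐ[volume] fun s => c + ∫ t in (0 : ℝ)..s, v t := by
  have h1 := h.sub (isWeakDeriv_primitive h.2.1)
  rw [sub_self] at h1
  obtain ⟨c, hc⟩ := h1.ae_const
  exact ⟨c, hc.mono fun s hs => by simp only [Pi.sub_apply] at hs; rw [← hs]; simp⟩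

theorem continuous_primitive_of_locallyIntegrable (hv : LocallyIntegrable v) (a : ℝ) :
    Continuous fun s => ∫ t in a..s, v t :=
  intervalIntegral.continuous_primitive (fun a b => LocallyIntegrable.intervalIntegrable' hv a b) a

theorem IsWeakDeriv.sub_eq_integral (h : IsWeakDeriv w v) (hw : Continuous w) (a b : ℝ) :
    w b - w a = ∫ t in a..b, v t := by
  obtain ⟨c, hc⟩ := h.ae_eq_primitive
  have e := (hw.ae_eq_iff_eq volume
    (continuous_const.add (continuous_primitive_of_locallyIntegrable h.2.1 0))).1 hc
  have i := fun a b => LocallyIntegrable.intervalIntegrable' h.2.1 a b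
  rw [e]
  simp only [Pi.add_apply]
  rw [add_sub_add_left_eq_sub]
  exact intervalIntegral.integral_interval_sub_left (i 0 b) (i 0 a)

theorem IsWeakDeriv.exists_continuous (h : IsWeakDeriv w v) :
    ∃ w', Continuous w' ∧ w =ᵐ[volume] w' := by
  obtain ⟨c, hc⟩ := h.ae_eq_primitive
  exact ⟨_, continuous_const.add (continuous_primitive_of_locallyIntegrable h.2.1 0), hc⟩

theorem isWeakDeriv_deriv (hw : ContDiff ℝ 1 w) : IsWeakDeriv w (deriv w) := by
  have hd : Continuous (deriv w) := hw.continuous_deriv le_rfl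
  have h := (isWeakDeriv_primitive hd.locallyIntegrable)
  have h0 : IsWeakDeriv (N := N) (fun _ => w 0) 0 :=
    ⟨locallyIntegrable_const _, locallyIntegrable_zero, fun φ hφ hc => by
      have hd : Continuous (deriv φ) := hφ.continuous_deriv (by simp)
      rw [integral_smul_const, integral_eq_zero_of_hasDerivAt_of_integrable (f := φ)
        (fun s => ((hφ.differentiable (by simp)) s).hasDerivAt)
        (hd.integrable_of_hasCompactSupport hc.deriv)
        (hφ.continuous.integrable_of_hasCompactSupport hc)]
      simp⟩
  have e : (fun s => ∫ t in (0 : ℝ)..s, deriv w t) + (fun _ => w 0) = w := by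
    funext s
    rw [Pi.add_apply, intervalIntegral.integral_deriv_eq_sub
      (fun x _ => (hw.differentiable one_ne_zero) x) (hd.intervalIntegrable _ _)]
    simp
  have := h.add h0
  rwa [e, add_zero] at this

theorem IsWeakDeriv.smul {χ : ℝ → ℝ} (hχ : ContDiff ℝ ∞ χ) (h : IsWeakDeriv w v) :
    IsWeakDeriv (fun s => χ s • w s) (fun s => deriv χ s • w s + χ s • v s) := by
  have hd : ContDiff ℝ ∞ (deriv χ) := (contDiff_infty_iff_deriv.1 hχ).2
  have l : ∀ {c : ℝ → ℝ} {u : ℝ → EuclideanSpace ℝ (Fin N)}, Continuous c → LocallyIntegrable u →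
      LocallyIntegrable fun s => c s • u s := fun hc hu => by
    rw [← locallyIntegrableOn_univ] at hu ⊢
    exact hu.continuousOn_smul isOpen_univ.isLocallyClosed hc.continuousOn
  refine ⟨l hχ.continuous h.1, (l hd.continuous h.1).add (l hχ.continuous h.2.1),
    fun φ hφ hc => ?_⟩
  have hφd : Continuous (deriv φ) := hφ.continuous_deriv (by simp)
  have e := h.2.2 (fun s => φ s * χ s) (hφ.mul hχ) hc.mul_right
  have e1 : ∀ s, deriv (fun s => φ s * χ s) s • w s = deriv φ s • χ s • w s +
      φ s • deriv χ s • w s := fun s => by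
    rw [deriv_fun_mul ((hφ.differentiable (by simp)) s) ((hχ.differentiable (by simp)) s)]
    module
  have i1 := (l hχ.continuous h.1).integrable_smul_left_of_hasCompactSupport (μ := volume) hφd hc.deriv
  have i2 := (l hd.continuous h.1).integrable_smul_left_of_hasCompactSupport (μ := volume)
    hφ.continuous hc
  have i3 := (l hχ.continuous h.2.1).integrable_smul_left_of_hasCompactSupport (μ := volume)
    hφ.continuous hc
  simp only [e1, mul_smul] at e
  rw [integral_add i1 i2] at e
  simp only [smul_add]
  rw [integral_add i2 i3, neg_add, ← e]
  abel

end WeakDeriv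

/-! ### The norms of the Sobolev spaces -/

section SobolevNorm

variable {N : ℕ} {k k' : ℕ} {δ δ' : ℝ} {S S' : Submodule ℝ (EuclideanSpace ℝ (Fin N))}

/-- The weighted function `e^{δ|s|} w(s)`. -/
noncomputable def weighted (δ : ℝ) (w : ℝ → EuclideanSpace ℝ (Fin N)) : ℝ → EuclideanSpace ℝ (Fin N) :=
  fun s => Real.exp (δ * |s|) • w s

theorem continuous_weight (δ : ℝ) : Continuous fun s : ℝ => Real.exp (δ * |s|) := by fun_prop

theorem eLpNorm_weighted_mono {w : ℝ → EuclideanSpace ℝ (Fin N)} (h : δ' ≤ δ) :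
    eLpNorm (weighted δ' w) 2 volume ≤ eLpNorm (weighted δ w) 2 volume := by
  refine eLpNorm_mono fun s => ?_
  simp only [weighted, norm_smul, Real.norm_eq_abs, Real.abs_exp]
  gcongr

theorem MemLp.weighted_mono {w : ℝ → EuclideanSpace ℝ (Fin N)} (h : δ' ≤ δ)
    (hw : MemLp (weighted δ w) 2 volume) : MemLp (weighted δ' w) 2 volume := by
  refine ⟨?_, (eLpNorm_weighted_mono h).trans_lt hw.2⟩
  have e : weighted δ' w = fun s => Real.exp ((δ' - δ) * |s|) • weighted δ w s := by
    funext s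
    rw [weighted, weighted, smul_smul, ← Real.exp_add]
    ring_nf
  rw [e]
  exact (continuous_weight _).aestronglyMeasurable.smul hw.1

theorem IsSobolevJet.mono {h : ℝ → EuclideanSpace ℝ (Fin N)}
    {w : ℕ → ℝ → EuclideanSpace ℝ (Fin N)} (hw : IsSobolevJet k δ h w) (hk : k' ≤ k)
    (hδ : δ' ≤ δ) : IsSobolevJet k' δ' h w :=
  ⟨hw.1, fun j hj => hw.2.1 j (by omega), fun j hj =>
    MemLp.weighted_mono hδ (hw.2.2 j (by omega))⟩

theorem norm_sobolev (h : SobolevSpace k δ S) : ‖h‖ = ‖sobolevToLp k δ S h‖ := rfl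

theorem norm_sobolevToLp_apply (h : SobolevSpace k δ S)
    {w : ℕ → ℝ → EuclideanSpace ℝ (Fin N)} (hw : IsSobolevJet k δ (sobolevEmb k δ S h) w)
    (j : Fin (k + 1)) :
    ‖sobolevToLp k δ S h j‖ = (eLpNorm (weighted δ (w j)) 2 volume).toReal := by
  have hj := Nat.le_of_lt_succ j.2
  change ‖((sobolevJet_spec h).2.2 j hj).toLp _‖ = _
  rw [Lp.norm_toLp]
  congr 1
  refine eLpNorm_congr_ae (((sobolevJet_spec h).ae_eq hw j hj).mono fun s hs => ?_)
  simp only [weighted, hs]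

theorem norm_sobolev_le (h : SobolevSpace k δ S)
    {w : ℕ → ℝ → EuclideanSpace ℝ (Fin N)} (hw : IsSobolevJet k δ (sobolevEmb k δ S h) w) {c : ℝ}
    (hc : 0 ≤ c) (hb : ∀ j ≤ k, eLpNorm (weighted δ (w j)) 2 volume ≤ ENNReal.ofReal c) :
    ‖h‖ ≤ (k + 1) * c := by
  rw [norm_sobolev, PiLp.norm_eq_of_L2]
  have h1 : ∀ j : Fin (k + 1), ‖sobolevToLp k δ S h j‖ ^ 2 ≤ c ^ 2 := fun j => by
    rw [norm_sobolevToLp_apply h hw]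
    have := ENNReal.toReal_mono ENNReal.ofReal_ne_top (hb j (Nat.le_of_lt_succ j.2))
    rw [ENNReal.toReal_ofReal hc] at this
    gcongr
  refine Real.sqrt_le_iff.2 ⟨by positivity, (Finset.sum_le_sum fun j _ => h1 j).trans ?_⟩
  rw [Finset.sum_const, Finset.card_univ, Fintype.card_fin, nsmul_eq_mul, mul_pow]
  gcongr
  push_cast
  nlinarith [(Nat.cast_nonneg k : (0 : ℝ) ≤ k)]

theorem eLpNorm_le_norm_sobolev (h : SobolevSpace k δ S)
    {w : ℕ → ℝ → EuclideanSpace ℝ (Fin N)} (hw : IsSobolevJet k δ (sobolevEmb k δ S h) w) {j : ℕ}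
    (hj : j ≤ k) : eLpNorm (weighted δ (w j)) 2 volume ≤ ENNReal.ofReal ‖h‖ := by
  have h1 := norm_sobolevToLp_apply h hw ⟨j, Nat.lt_succ_of_le hj⟩
  have h2 := PiLp.norm_apply_le (sobolevToLp k δ S h) ⟨j, Nat.lt_succ_of_le hj⟩
  rw [h1, ← norm_sobolev] at h2
  exact (ENNReal.le_ofReal_iff_toReal_le (hw.2.2 j hj).2.ne (norm_nonneg _)).2 h2

/-- The inclusion between Sobolev spaces. -/
noncomputable def sobolevIncl (hk : k' ≤ k) (hδ : δ' ≤ δ) (hS : S ≤ S') :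
    SobolevSpace k δ S →L[ℝ] SobolevSpace k' δ' S' :=
  LinearMap.mkContinuous
    { toFun := fun h => ⟨sobolevEmb k δ S h, h.2.1, hS h.2.2.1, sobolevJet h,
        (sobolevJet_spec h).mono hk hδ⟩
      map_add' := fun _ _ => Subtype.ext (map_add _ _ _)
      map_smul' := fun _ _ => Subtype.ext (map_smul _ _ _) }
    (k' + 1) fun h => by
      refine norm_sobolev_le (δ := δ') _ ((sobolevJet_spec h).mono hk hδ) (norm_nonneg _) fun j hj => ?_
      exact (eLpNorm_weighted_mono hδ).trans
        (eLpNorm_le_norm_sobolev h (sobolevJet_spec h) (hj.trans hk))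

theorem sobolevEmb_sobolevIncl (hk : k' ≤ k) (hδ : δ' ≤ δ) (hS : S ≤ S')
    (h : SobolevSpace k δ S) :
    sobolevEmb k' δ' S' (sobolevIncl hk hδ hS h) = sobolevEmb k δ S h := rfl

/-- Dropping the condition at 0 does not alter the topology, so limits found for `⊤` can be pulled
back to S. The factor k + 1 is an artefact of `norm_sobolev_le`. -/
theorem norm_le_norm_sobolevIncl (hS : S ≤ S') (h : SobolevSpace k δ S) :
    ‖h‖ ≤ (k + 1) * ‖sobolevIncl (le_refl k) (le_refl δ) hS h‖ :=
  norm_sobolev_le h (sobolevJet_spec h) (norm_nonneg _) fun _ hj =>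
    eLpNorm_le_norm_sobolev (sobolevIncl (le_refl k) (le_refl δ) hS h) (sobolevJet_spec h) hj

/-! ### Pointwise bounds -/

theorem norm_intervalIntegral_le_sqrt {G : Type*} [NormedAddCommGroup G] [NormedSpace ℝ G]
    {v : ℝ → G} (hv : MemLp v 2 volume) {a b : ℝ} (hab : a ≤ b) :
    ∫ t in a..b, ‖v t‖ ≤ √(b - a) * (eLpNorm v 2 volume).toReal := by
  have h1 := eLpNorm_le_eLpNorm_mul_rpow_measure_univ (p := 1) (q := 2)
    (μ := volume.restrict (Ioc a b)) (by norm_num) hv.1.restrict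
  have h2 : eLpNorm v 2 (volume.restrict (Ioc a b)) ≤ eLpNorm v 2 volume :=
    eLpNorm_mono_measure _ Measure.restrict_le_self
  rw [intervalIntegral.integral_of_le hab, integral_norm_eq_lintegral_enorm hv.1.restrict,
    ← eLpNorm_one_eq_lintegral_enorm]
  have h3 : eLpNorm v 1 (volume.restrict (Ioc a b)) ≤
      eLpNorm v 2 volume * ENNReal.ofReal (√(b - a)) := by
    refine h1.trans (mul_le_mul' h2 (le_of_eq ?_))
    rw [Measure.restrict_apply_univ, Real.volume_Ioc, Real.sqrt_eq_rpow,
      ENNReal.ofReal_rpow_of_nonneg (by linarith) (by norm_num)]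
    norm_num
  have := ENNReal.toReal_mono (ENNReal.mul_ne_top hv.2.ne ENNReal.ofReal_ne_top) h3
  rwa [ENNReal.toReal_mul, ENNReal.toReal_ofReal (Real.sqrt_nonneg _), mul_comm] at this

theorem IsWeakDeriv.norm_sub_le {w v : ℝ → EuclideanSpace ℝ (Fin N)} (h : IsWeakDeriv w v)
    (hw : Continuous w) (hv : MemLp v 2 volume) {a b : ℝ} (hab : a ≤ b) :
    ‖w b - w a‖ ≤ √(b - a) * (eLpNorm v 2 volume).toReal := by
  rw [h.sub_eq_integral hw]
  exact (intervalIntegral.norm_integral_le_integral_norm hab).trans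
    (norm_intervalIntegral_le_sqrt hv hab)

/-- Average ‖w(s)‖ ≤ ‖w(t)‖ + ‖v‖₂ over t in [s, s+1]. -/
theorem IsWeakDeriv.norm_le {w v : ℝ → EuclideanSpace ℝ (Fin N)} (h : IsWeakDeriv w v)
    (hw : Continuous w) (hw2 : MemLp w 2 volume) (hv : MemLp v 2 volume) (s : ℝ) :
    ‖w s‖ ≤ (eLpNorm w 2 volume).toReal + (eLpNorm v 2 volume).toReal := by
  have h1 : ∀ t ∈ Icc s (s + 1), ‖w s‖ ≤ ‖w t‖ + (eLpNorm v 2 volume).toReal := by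
    intro t ht
    have := h.norm_sub_le hw hv ht.1
    have h2 : √(t - s) ≤ 1 := Real.sqrt_le_one.2 (by linarith [ht.2])
    have h3 : √(t - s) * (eLpNorm v 2 volume).toReal ≤ (eLpNorm v 2 volume).toReal :=
      mul_le_of_le_one_left ENNReal.toReal_nonneg h2
    have h4 := norm_sub_norm_le (w s) (w t)
    rw [norm_sub_rev] at h4
    linarith
  have h2 := intervalIntegral.integral_mono_on (μ := volume) (by linarith : s ≤ s + 1)
    intervalIntegrable_const ((show Continuous fun t => ‖w t‖ + (eLpNorm v 2 volume).toReal from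
      hw.norm.add continuous_const).intervalIntegrable s (s + 1)) h1
  rw [intervalIntegral.integral_add (hw.norm.intervalIntegrable _ _) intervalIntegrable_const] at h2
  simp only [intervalIntegral.integral_const, add_sub_cancel_left, one_smul] at h2
  have h3 := norm_intervalIntegral_le_sqrt hw2 (by linarith : s ≤ s + 1)
  simp only [add_sub_cancel_left, Real.sqrt_one, one_mul] at h3
  linarith

theorem weighted_zero (w : ℝ → EuclideanSpace ℝ (Fin N)) : weighted 0 w = w := by
  funext s
  simp [weighted]

theorem norm_sobolevEmb_le (hk : 1 ≤ k) (hδ : 0 ≤ δ) (h : SobolevSpace k δ S) (s : ℝ) :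
    ‖sobolevEmb k δ S h s‖ ≤ 2 * ‖h‖ := by
  have hj := sobolevJet_spec h
  have hj0 := hj.mono le_rfl hδ
  have h1 := (hj.2.1 0 (by omega)).norm_le (by rw [hj.1]; exact h.2.1)
    (by simpa using hj0.2.2 0 (by omega)) (by simpa using hj0.2.2 1 hk) s
  have h2 : ∀ j ≤ k, (eLpNorm (sobolevJet h j) 2 volume).toReal ≤ ‖h‖ := fun j hjk => by
    have h3 := (eLpNorm_weighted_mono hδ).trans (eLpNorm_le_norm_sobolev h hj hjk)
    rw [weighted_zero] at h3
    exact ENNReal.toReal_le_of_le_ofReal (norm_nonneg _) h3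
  rw [hj.1] at h1
  have := h2 0 (by omega)
  rw [hj.1] at this
  linarith [h2 1 hk]

/-! ### Completeness -/

theorem tendsto_integral_smul {ψ : ℝ → ℝ} (hψ : Continuous ψ) (hc : HasCompactSupport ψ)
    {f : ℕ → ℝ → EuclideanSpace ℝ (Fin N)} {g : ℝ → EuclideanSpace ℝ (Fin N)}
    (hf : ∀ n, MemLp (f n) 2 volume) (hg : MemLp g 2 volume)
    (h : Tendsto (fun n => eLpNorm (f n - g) 2 volume) atTop (𝓝 0)) :
    Tendsto (fun n => ∫ s, ψ s • f n s) atTop (𝓝 (∫ s, ψ s • g s)) := by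
  have hψ2 : MemLp ψ 2 volume := hψ.memLp_of_hasCompactSupport hc
  refine tendsto_integral_of_L1' (fun s => ψ s • g s) (hψ2.1.smul hg.1)
    (Eventually.of_forall fun n => memLp_one_iff_integrable.1 ((hf n).smul hψ2)) ?_
  have h1 : Tendsto (fun n => eLpNorm ψ 2 volume * eLpNorm (f n - g) 2 volume) atTop (𝓝 0) := by
    simpa using ENNReal.Tendsto.const_mul h (Or.inr hψ2.2.ne)
  refine tendsto_of_tendsto_of_tendsto_of_le_of_le tendsto_const_nhds h1 (fun _ => zero_le)
    fun n => ?_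
  have e : ((fun s => ψ s • f n s) - fun s => ψ s • g s) = ψ • (f n - g) := by
    funext s
    simp [smul_sub]
  simp only [e]
  exact eLpNorm_smul_le_mul_eLpNorm ((hf n).1.sub hg.1) hψ2.1

theorem weighted_neg_weighted (u : ℝ → EuclideanSpace ℝ (Fin N)) :
    weighted δ (weighted (-δ) u) = u := by
  funext s
  simp [weighted, smul_smul, ← Real.exp_add]

theorem weighted_weighted_neg (u : ℝ → EuclideanSpace ℝ (Fin N)) :
    weighted (-δ) (weighted δ u) = u := by
  funext s
  simp [weighted, smul_smul, ← Real.exp_add]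

theorem locallyIntegrable_weighted {u : ℝ → EuclideanSpace ℝ (Fin N)} (hu : LocallyIntegrable u)
    (δ : ℝ) : LocallyIntegrable (weighted δ u) := by
  rw [← locallyIntegrableOn_univ] at hu ⊢
  exact hu.continuousOn_smul isOpen_univ.isLocallyClosed (continuous_weight δ).continuousOn

/-- The weight is moved onto the test function: ψ(s)e^{-δ|s|} is no longer smooth at 0, but passing
to the limit under the integral requires only continuity and compact support. -/
theorem isWeakDeriv_of_tendsto {w v : ℕ → ℝ → EuclideanSpace ℝ (Fin N)}
    {f g : ℝ → EuclideanSpace ℝ (Fin N)} (h : ∀ n, IsWeakDeriv (w n) (v n))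
    (hw : ∀ n, MemLp (weighted δ (w n)) 2 volume) (hv : ∀ n, MemLp (weighted δ (v n)) 2 volume)
    (hf : MemLp f 2 volume) (hg : MemLp g 2 volume)
    (h1 : Tendsto (fun n => eLpNorm (weighted δ (w n) - f) 2 volume) atTop (𝓝 0))
    (h2 : Tendsto (fun n => eLpNorm (weighted δ (v n) - g) 2 volume) atTop (𝓝 0)) :
    IsWeakDeriv (weighted (-δ) f) (weighted (-δ) g) := by
  refine ⟨locallyIntegrable_weighted (hf.locallyIntegrable (by norm_num)) _,
    locallyIntegrable_weighted (hg.locallyIntegrable (by norm_num)) _, fun φ hφ hc => ?_⟩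
  have hd : Continuous (deriv φ) := hφ.continuous_deriv (by simp)
  have key : ∀ {ψ : ℝ → ℝ} (_ : Continuous ψ) (_ : HasCompactSupport ψ)
      {u : ℕ → ℝ → EuclideanSpace ℝ (Fin N)} {a : ℝ → EuclideanSpace ℝ (Fin N)}
      (_ : ∀ n, MemLp (weighted δ (u n)) 2 volume) (_ : MemLp a 2 volume)
      (_ : Tendsto (fun n => eLpNorm (weighted δ (u n) - a) 2 volume) atTop (𝓝 0)),
      Tendsto (fun n => ∫ s, ψ s • u n s) atTop (𝓝 (∫ s, ψ s • weighted (-δ) a s)) := by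
    intro ψ hψ hψc u a hu ha h
    have := tendsto_integral_smul (ψ := fun s => ψ s * Real.exp (-δ * |s|))
      (hψ.mul (continuous_weight _)) hψc.mul_right hu ha h
    have e : ∀ n s, (ψ s * Real.exp (-δ * |s|)) • weighted δ (u n) s = ψ s • u n s := fun n s => by
      rw [mul_smul]
      congr 1
      exact congrFun (weighted_weighted_neg (u n)) s
    simp only [e] at this
    refine this.congr' EventuallyEq.rfl |>.trans (le_of_eq ?_)
    simp only [weighted, mul_smul]
  have t1 := key hd hc.deriv hw hf h1
  have t2 := key hφ.continuous hc hv hg h2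
  refine tendsto_nhds_unique t1 (t2.neg.congr fun n => ((h n).2.2 φ hφ hc).symm)

theorem sobolevToLp_coeFn (h : SobolevSpace k δ S) {j : ℕ} (hj : j < k + 1) :
    (sobolevToLp k δ S h ⟨j, hj⟩ : ℝ → EuclideanSpace ℝ (Fin N)) =ᵐ[volume]
      weighted δ (sobolevJet h j) :=
  MemLp.coeFn_toLp ((sobolevJet_spec h).2.2 j (Nat.le_of_lt_succ hj))

theorem exists_limit_sobolevToLp
    {u : ℕ → SobolevSpace k δ S} (hu : CauchySeq u) : ∃ f : ℕ → ℝ → EuclideanSpace ℝ (Fin N),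
      (∀ j ≤ k, MemLp (f j) 2 volume) ∧ ∀ j ≤ k,
        Tendsto (fun n => eLpNorm (weighted δ (sobolevJet (u n) j) - f j) 2 volume) atTop (𝓝 0) := by
  have hu' : CauchySeq fun n => sobolevToLp k δ S (u n) := by
    rw [Metric.cauchySeq_iff] at hu ⊢
    intro ε hε
    obtain ⟨M, hM⟩ := hu ε hε
    refine ⟨M, fun m hm n hn => ?_⟩
    rw [dist_eq_norm, ← map_sub, ← norm_sobolev, ← dist_eq_norm]
    exact hM m hm n hn
  obtain ⟨U, hU⟩ := cauchySeq_tendsto_of_complete hu'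
  have hex : ∀ j, ∃ f : ℝ → EuclideanSpace ℝ (Fin N), j ≤ k → MemLp f 2 volume ∧
      Tendsto (fun n => eLpNorm (weighted δ (sobolevJet (u n) j) - f) 2 volume) atTop (𝓝 0) := by
    intro j
    by_cases hj : j ≤ k
    · have hj' := Nat.lt_succ_of_le hj
      refine ⟨U ⟨j, hj'⟩, fun _ => ⟨Lp.memLp _, ?_⟩⟩
      have h1 : Tendsto (fun n => sobolevToLp k δ S (u n) ⟨j, hj'⟩) atTop (𝓝 (U ⟨j, hj'⟩)) :=
        ((PiLp.continuous_apply 2 _ (⟨j, hj'⟩ : Fin (k + 1))).tendsto U).comp hU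
      rw [Lp.tendsto_Lp_iff_tendsto_eLpNorm'] at h1
      exact h1.congr fun n => eLpNorm_congr_ae ((sobolevToLp_coeFn (u n) hj').sub EventuallyEq.rfl)
    · exact ⟨0, fun h => absurd h hj⟩
  choose f hf using hex
  exact ⟨f, fun j hj => (hf j hj).1, fun j hj => (hf j hj).2⟩

theorem completeSpace_sobolev_top (hk : 1 ≤ k) :
    CompleteSpace (SobolevSpace k δ (⊤ : Submodule ℝ (EuclideanSpace ℝ (Fin N)))) := by
  refine Metric.complete_of_cauchySeq_tendsto fun u hu => ?_
  obtain ⟨f, hf, ht⟩ := exists_limit_sobolevToLp hu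
  have hwd : ∀ j < k, IsWeakDeriv (weighted (-δ) (f j)) (weighted (-δ) (f (j + 1))) := fun j hj =>
    isWeakDeriv_of_tendsto (fun n => (sobolevJet_spec (u n)).2.1 j hj)
      (fun n => (sobolevJet_spec (u n)).2.2 j hj.le) (fun n => (sobolevJet_spec (u n)).2.2 (j + 1) hj)
      (hf j hj.le) (hf (j + 1) hj) (ht j hj.le) (ht (j + 1) hj)
  obtain ⟨h, hc, hh⟩ := (hwd 0 hk).exists_continuous
  -- Only the entry of order zero must be a genuine function, the continuous representative; the
  -- others matter up to null sets.
  let w : ℕ → ℝ → EuclideanSpace ℝ (Fin N) := fun j => if j = 0 then h else weighted (-δ) (f j)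
  have hw : ∀ j, weighted (-δ) (f j) =ᵐ[volume] w j := fun j => by
    by_cases hj : j = 0
    · simp only [w, hj, if_true]; exact hh
    · simp only [w, hj, if_false]; rfl
  have hw' : ∀ j, weighted δ (w j) =ᵐ[volume] f j := fun j => by
    filter_upwards [hw j] with s hs
    rw [weighted, ← hs]
    exact congrFun (weighted_neg_weighted (f j)) s
  have hjet : IsSobolevJet k δ h w := ⟨by simp [w], fun j hj => (hwd j hj).congr_ae (hw j) (hw (j + 1)),
    fun j hj => (memLp_congr_ae (hw' j)).2 (hf j hj)⟩
  let a : SobolevSpace k δ (⊤ : Submodule ℝ (EuclideanSpace ℝ (Fin N))) :=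
    ⟨h, hc, Submodule.mem_top, w, hjet⟩
  refine ⟨a, ?_⟩
  have hd : ∀ n, IsSobolevJet k δ (sobolevEmb k δ ⊤ (u n - a)) (sobolevJet (u n) + (-1 : ℝ) • w) := by
    intro n
    have e : sobolevEmb k δ ⊤ (u n - a) = sobolevEmb k δ ⊤ (u n) + (-1 : ℝ) • h := by
      rw [map_sub, neg_one_smul, sub_eq_add_neg]; rfl
    rw [e]
    exact (sobolevJet_spec (u n)).add (hjet.const_smul (-1))
  rw [Metric.tendsto_atTop]
  intro ε hε
  have hev : ∀ᶠ n in atTop, ∀ j ∈ Finset.range (k + 1),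
      eLpNorm (weighted δ (sobolevJet (u n) j) - f j) 2 volume ≤
        ENNReal.ofReal (ε / (2 * (k + 1))) := by
    rw [Filter.eventually_all_finset]
    intro j hj
    exact (ht j (Nat.le_of_lt_succ (Finset.mem_range.1 hj))).eventually_le_const
      (ENNReal.ofReal_pos.2 (by positivity))
  obtain ⟨M, hM⟩ := eventually_atTop.1 hev
  refine ⟨M, fun n hn => ?_⟩
  rw [dist_eq_norm]
  have := norm_sobolev_le (u n - a) (hd n) (c := ε / (2 * (k + 1))) (by positivity) fun j hj => by
    refine le_trans (le_of_eq (eLpNorm_congr_ae ?_)) (hM n hn j (Finset.mem_range.2 (by omega)))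
    filter_upwards [hw' j] with s hs
    simp only [Pi.sub_apply, ← hs]
    simp only [weighted, Pi.add_apply, Pi.smul_apply]
    module
  refine this.trans_lt ?_
  have : ((k : ℝ) + 1) * (ε / (2 * (k + 1))) = ε / 2 := by field_simp
  rw [this]
  linarith

/-- Evaluation at 0 is bounded, and S is closed, so the limit taken without the condition satisfies
it. -/
theorem completeSpace_sobolev (hk : 1 ≤ k) (hδ : 0 ≤ δ) : CompleteSpace (SobolevSpace k δ S) := by
  have := completeSpace_sobolev_top (N := N) (δ := δ) hk
  refine Metric.complete_of_cauchySeq_tendsto fun u hu => ?_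
  let ι : SobolevSpace k δ S →L[ℝ] SobolevSpace k δ ⊤ := sobolevIncl le_rfl le_rfl le_top
  obtain ⟨a, ha⟩ := cauchySeq_tendsto_of_complete (ι.uniformContinuous.comp_cauchySeq hu)
  have ha0 : sobolevEmb k δ ⊤ a 0 ∈ S := by
    refine S.closed_of_finiteDimensional.mem_of_tendsto (f := fun n => sobolevEmb k δ S (u n) 0)
      (b := atTop) ?_ (Eventually.of_forall fun n => (u n).2.2.1)
    rw [tendsto_iff_norm_sub_tendsto_zero] at ha ⊢
    have h2 : Tendsto (fun n => 2 * ‖(ι ∘ u) n - a‖) atTop (𝓝 0) := by simpa using ha.const_mul 2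
    refine squeeze_zero (fun _ => norm_nonneg _) (fun n => ?_) h2
    have := norm_sobolevEmb_le hk hδ ((ι ∘ u) n - a) 0
    rwa [map_sub] at this
  let b : SobolevSpace k δ S := ⟨sobolevEmb k δ ⊤ a, a.2.1, ha0, a.2.2.2⟩
  refine ⟨b, ?_⟩
  rw [tendsto_iff_norm_sub_tendsto_zero] at ha ⊢
  have h2 : Tendsto (fun n => (k + 1) * ‖(ι ∘ u) n - a‖) atTop (𝓝 0) := by
    simpa using ha.const_mul ((k : ℝ) + 1)
  refine squeeze_zero (fun _ => norm_nonneg _) (fun n => ?_) h2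
  have := norm_le_norm_sobolevIncl (le_top (a := S)) (u n - b)
  rwa [map_sub] at this

end SobolevNorm

/-! ### Smooth functions with compact support -/

section Smooth

variable {G : Type*} [NormedAddCommGroup G] [NormedSpace ℝ G]

theorem ContDiff.deriv_infty {f : ℝ → G} (hf : ContDiff ℝ ∞ f) : ContDiff ℝ ∞ (deriv f) :=
  (contDiff_infty_iff_deriv.1 hf).2

theorem ContDiff.iteratedDeriv_infty {f : ℝ → G} (hf : ContDiff ℝ ∞ f) (j : ℕ) :
    ContDiff ℝ ∞ (iteratedDeriv j f) := by
  induction j generalizing f with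
  | zero => simpa using hf
  | succ j ih => rw [iteratedDeriv_succ']; exact ih hf.deriv_infty

theorem deriv_eq_zero_of_isOpen {f : ℝ → G} {U : Set ℝ} (hU : IsOpen U) (h : ∀ s ∈ U, f s = 0) :
    ∀ s ∈ U, deriv f s = 0 := fun s hs => by
  have : f =ᶠ[𝓝 s] fun _ => 0 := by
    filter_upwards [hU.mem_nhds hs] with t ht
    exact h t ht
  rw [this.deriv_eq, deriv_const]

theorem iteratedDeriv_eq_zero_of_isOpen {f : ℝ → G} {U : Set ℝ} (hU : IsOpen U)
    (h : ∀ s ∈ U, f s = 0) (j : ℕ) : ∀ s ∈ U, iteratedDeriv j f s = 0 := by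
  induction j generalizing f with
  | zero => simpa using h
  | succ j ih => rw [iteratedDeriv_succ']; exact ih (deriv_eq_zero_of_isOpen hU h)

theorem isOpen_abs_gt (M : ℝ) : IsOpen {s : ℝ | M < |s|} :=
  isOpen_lt continuous_const continuous_abs

theorem isOpen_abs_lt (M : ℝ) : IsOpen {s : ℝ | |s| < M} :=
  isOpen_lt continuous_abs continuous_const

theorem iteratedDeriv_eq_zero_of_abs_gt {f : ℝ → G} {M : ℝ} (h : ∀ s, M < |s| → f s = 0) (j : ℕ)
    {s : ℝ} (hs : M < |s|) : iteratedDeriv j f s = 0 :=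
  iteratedDeriv_eq_zero_of_isOpen (isOpen_abs_gt M) h j s hs

theorem HasCompactSupport.iteratedDeriv' {f : ℝ → G} (hf : HasCompactSupport f) (j : ℕ) :
    HasCompactSupport (iteratedDeriv j f) := by
  obtain ⟨M, -, hM⟩ := hf.exists_abs_gt
  exact hasCompactSupport_of_abs_gt fun s hs => iteratedDeriv_eq_zero_of_abs_gt hM j hs

/-- Smooth real functions all of whose derivatives are bounded. -/
def BddDerivs (σ : ℝ → ℝ) : Prop :=
  ContDiff ℝ ∞ σ ∧ ∀ l, ∃ C, ∀ s, |iteratedDeriv l σ s| ≤ C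

theorem BddDerivs.of_hasCompactSupport {σ : ℝ → ℝ} (h : ContDiff ℝ ∞ σ) (hc : HasCompactSupport σ) :
    BddDerivs σ :=
  ⟨h, fun l => (hc.iteratedDeriv' l).exists_bound_of_continuous (h.iteratedDeriv_infty l).continuous⟩

theorem BddDerivs.deriv {σ : ℝ → ℝ} (h : BddDerivs σ) : BddDerivs (deriv σ) :=
  ⟨h.1.deriv_infty, fun l => by rw [← iteratedDeriv_succ']; exact h.2 (l + 1)⟩

theorem BddDerivs.of_deriv {σ : ℝ → ℝ} (h : ContDiff ℝ ∞ σ) (hb : ∃ C, ∀ s, |σ s| ≤ C)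
    (hc : HasCompactSupport (_root_.deriv σ)) : BddDerivs σ := by
  refine ⟨h, fun l => ?_⟩
  cases l with
  | zero => simpa using hb
  | succ l =>
    rw [iteratedDeriv_succ']
    exact (BddDerivs.of_hasCompactSupport h.deriv_infty hc).2 l

end Smooth

theorem eLpNorm_le_of_abs_gt {G : Type*} [NormedAddCommGroup G] {f : ℝ → G} {K c : ℝ}
    (hK : 0 ≤ K) (h0 : ∀ᵐ s, K < |s| → f s = 0) (hb : ∀ᵐ s, |s| ≤ K → ‖f s‖ ≤ c) :
    eLpNorm f 2 volume ≤ ENNReal.ofReal (√(2 * K) * c) := by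
  have e : f =ᵐ[volume] (Icc (-K) K).indicator f := by
    filter_upwards [h0] with s hs
    by_cases h : s ∈ Icc (-K) K
    · rw [indicator_of_mem h]
    · rw [indicator_of_notMem h]
      exact hs (not_le.1 fun h' => h (abs_le.1 h'))
  rw [eLpNorm_congr_ae e, eLpNorm_indicator_eq_eLpNorm_restrict measurableSet_Icc]
  refine (eLpNorm_le_of_ae_bound (C := c) ?_).trans (le_of_eq ?_)
  · rw [ae_restrict_iff' measurableSet_Icc]
    filter_upwards [hb] with s hs hsK
    exact hs (abs_le.2 hsK)
  · rw [Measure.restrict_apply_univ, Real.volume_Icc, ENNReal.ofReal_mul (Real.sqrt_nonneg _),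
      Real.sqrt_eq_rpow, ← ENNReal.ofReal_rpow_of_nonneg (by linarith) (by norm_num)]
    rw [sub_neg_eq_add, ← two_mul]
    norm_num

section Density

variable {N : ℕ}

/-! ### Cutting off -/

/-- Approximate f in L² by g with compact support; for large M the factor ψ_M kills g, leaving at
most C‖f - g‖₂. -/
theorem tendsto_eLpNorm_cutoff {f : ℝ → EuclideanSpace ℝ (Fin N)} (hf : MemLp f 2 volume)
    {ψ : ℕ → ℝ → ℝ} {C : ℝ} (hC : ∀ M s, |ψ M s| ≤ C) (h0 : ∀ (M : ℕ) (s : ℝ), |s| < M → ψ M s = 0) :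
    Tendsto (fun M => eLpNorm (fun s => ψ M s • f s) 2 volume) atTop (𝓝 0) := by
  have hC0 : 0 ≤ C := (abs_nonneg _).trans (hC 0 0)
  refine ENNReal.tendsto_nhds_zero.2 fun ε hε => ?_
  rcases eq_or_ne ε ⊤ with rfl | hε'
  · exact Eventually.of_forall fun _ => le_top
  have hε0 : 0 < ε.toReal := ENNReal.toReal_pos hε.ne' hε'
  obtain ⟨g, hg, -, hfg⟩ := hf.exist_eLpNorm_sub_le (by norm_num) (by norm_num)
    (ε := ε.toReal / (C + 1)) (by positivity)
  obtain ⟨K, -, hK⟩ := hg.exists_abs_gt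
  obtain ⟨M₀, hM₀⟩ := exists_nat_gt K
  filter_upwards [eventually_ge_atTop M₀] with M hM
  have hb : ∀ s, ‖ψ M s • f s‖ ≤ C * ‖(f - g) s‖ := fun s => by
    rcases lt_or_ge |s| M with h | h
    · rw [h0 M s h, zero_smul, norm_zero]; positivity
    · have hKs : K < |s| := hM₀.trans_le ((Nat.cast_le.2 hM).trans h)
      rw [Pi.sub_apply, hK s hKs, sub_zero, norm_smul]
      gcongr
      exact hC M s
  refine (eLpNorm_le_mul_eLpNorm_of_ae_le_mul (Eventually.of_forall hb) 2).trans ?_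
  calc ENNReal.ofReal C * eLpNorm (f - g) 2 volume
      ≤ ENNReal.ofReal C * ENNReal.ofReal (ε.toReal / (C + 1)) := by gcongr
    _ = ENNReal.ofReal (C * (ε.toReal / (C + 1))) := (ENNReal.ofReal_mul hC0).symm
    _ ≤ ENNReal.ofReal ε.toReal := by
        refine ENNReal.ofReal_le_ofReal ?_
        rw [mul_div_assoc', div_le_iff₀ (by positivity)]
        nlinarith
    _ = ε := ENNReal.ofReal_toReal hε'

theorem IsSobolevJet.tail {k : ℕ} {δ : ℝ} {w : ℕ → ℝ → EuclideanSpace ℝ (Fin N)}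
    (hw : IsSobolevJet (k + 1) δ (w 0) w) : IsSobolevJet k δ (w 1) (fun j => w (j + 1)) :=
  ⟨rfl, fun j hj => hw.2.1 (j + 1) (by omega), fun j hj => hw.2.2 (j + 1) (by omega)⟩

theorem MemLp.weighted_smul {δ : ℝ} {w : ℝ → EuclideanSpace ℝ (Fin N)}
    (hw : MemLp (weighted δ w) 2 volume) {ψ : ℝ → ℝ} (hψ : Continuous ψ) {C : ℝ}
    (hC : ∀ s, |ψ s| ≤ C) : MemLp (weighted δ fun s => ψ s • w s) 2 volume := by
  have e : weighted δ (fun s => ψ s • w s) = fun s => ψ s • weighted δ w s := by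
    funext s
    simp only [weighted, smul_smul, mul_comm]
  rw [e]
  exact hw.of_le_mul (c := C) (hψ.aestronglyMeasurable.smul hw.1) (Eventually.of_forall fun s => by
    rw [norm_smul]
    gcongr
    exact hC s)

/-- By the Leibniz rule the jet of ψw is ψw followed by the sum of the jets of ψ'w and ψw'. The
induction therefore has to run over all ψ with bounded derivatives, not only over the given
cut-offs. -/
theorem IsSobolevJet.cutoff {k : ℕ} {δ : ℝ} : ∀ {ψ : ℕ → ℝ → ℝ}, (∀ M, ContDiff ℝ ∞ (ψ M)) →
    (∀ (M : ℕ) (s : ℝ), |s| < M → ψ M s = 0) → (∀ l, ∃ C, ∀ M s, |iteratedDeriv l (ψ M) s| ≤ C) →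
    ∀ {w : ℕ → ℝ → EuclideanSpace ℝ (Fin N)}, IsSobolevJet k δ (w 0) w →
    ∃ u : ℕ → ℕ → ℝ → EuclideanSpace ℝ (Fin N),
      (∀ M, IsSobolevJet k δ (fun s => ψ M s • w 0 s) (u M)) ∧
      ∀ j ≤ k, Tendsto (fun M => eLpNorm (weighted δ (u M j)) 2 volume) atTop (𝓝 0) := by
  have base : ∀ {ψ : ℕ → ℝ → ℝ}, (∀ M, ContDiff ℝ ∞ (ψ M)) →
      (∀ (M : ℕ) (s : ℝ), |s| < M → ψ M s = 0) → (∀ l, ∃ C, ∀ M s, |iteratedDeriv l (ψ M) s| ≤ C) →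
      ∀ {f : ℝ → EuclideanSpace ℝ (Fin N)}, MemLp (weighted δ f) 2 volume →
      (∀ M, MemLp (weighted δ fun s => ψ M s • f s) 2 volume) ∧
      Tendsto (fun M => eLpNorm (weighted δ fun s => ψ M s • f s) 2 volume) atTop (𝓝 0) := by
    intro ψ hψ h0 hb f hf
    obtain ⟨C, hC⟩ := hb 0
    simp only [iteratedDeriv_zero] at hC
    refine ⟨fun M => MemLp.weighted_smul hf (hψ M).continuous (hC M), ?_⟩
    have e : ∀ M, weighted δ (fun s => ψ M s • f s) = fun s => ψ M s • weighted δ f s := fun M => by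
      funext s
      simp only [weighted, smul_smul, mul_comm]
    simp only [e]
    exact tendsto_eLpNorm_cutoff hf hC h0
  induction k with
  | zero =>
    intro ψ hψ h0 hb w hw
    obtain ⟨h1, h2⟩ := base hψ h0 hb (hw.2.2 0 le_rfl)
    exact ⟨fun M _ s => ψ M s • w 0 s, fun M => ⟨rfl, fun j hj => absurd hj (by omega),
      fun j _ => h1 M⟩, fun j _ => h2⟩
  | succ k ih =>
    intro ψ hψ h0 hb w hw
    obtain ⟨h1, h2⟩ := base hψ h0 hb (hw.2.2 0 (by omega))
    obtain ⟨a, ha, ha'⟩ := ih (ψ := fun M => deriv (ψ M)) (fun M => (hψ M).deriv_infty)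
      (fun M => deriv_eq_zero_of_isOpen (isOpen_abs_lt M) (h0 M))
      (fun l => by simpa only [← iteratedDeriv_succ'] using hb (l + 1)) (hw.mono (by omega) le_rfl)
    obtain ⟨b, hb, hb'⟩ := ih hψ h0 hb (w := fun j => w (j + 1)) hw.tail
    refine ⟨fun M j => Nat.casesOn j (fun s => ψ M s • w 0 s) fun j => a M j + b M j,
      fun M => ⟨rfl, fun j hj => ?_, fun j hj => ?_⟩, fun j hj => ?_⟩
    · cases j with
      | zero =>
        have := (hw.2.1 0 (by omega)).smul (hψ M)
        change IsWeakDeriv _ (a M 0 + b M 0)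
        rw [(ha M).1, (hb M).1]
        exact this
      | succ j => exact ((ha M).2.1 j (by omega)).add ((hb M).2.1 j (by omega))
    · cases j with
      | zero => exact h1 M
      | succ j => exact (((ha M).add (hb M)).2.2 j (by omega))
    · cases j with
      | zero => exact h2
      | succ j =>
        have h3 := (ha' j (by omega)).add (hb' j (by omega))
        rw [add_zero] at h3
        refine tendsto_of_tendsto_of_tendsto_of_le_of_le tendsto_const_nhds h3 (fun _ => zero_le)
          fun M => ?_
        have e : weighted δ (a M j + b M j) = weighted δ (a M j) + weighted δ (b M j) := by
          funext s
          simp [weighted]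
        change eLpNorm (weighted δ (a M j + b M j)) 2 volume ≤ _
        rw [e]
        exact eLpNorm_add_le ((ha M).2.2 j (by omega)).1 ((hb M).2.2 j (by omega)).1 (by norm_num)

/-- Smooth functions which vanish on `[-M, M]` and are one outside `[-2(M+1), 2(M+1)]`, with
uniformly bounded derivatives. -/
theorem exists_cutoff : ∃ ψ : ℕ → ℝ → ℝ, (∀ M, ContDiff ℝ ∞ (ψ M)) ∧
    (∀ (M : ℕ) (s : ℝ), |s| < M → ψ M s = 0) ∧ (∀ (M : ℕ) s, 2 * ((M : ℝ) + 1) < |s| → ψ M s = 1) ∧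
    ∀ l, ∃ C, ∀ M s, |iteratedDeriv l (ψ M) s| ≤ C := by
  let b : ContDiffBump (0 : ℝ) := ⟨1, 2, by norm_num, by norm_num⟩
  let g : ℝ → ℝ := fun s => 1 - b s
  have hg : ContDiff ℝ ∞ g := contDiff_const.sub b.contDiff
  have hb0 : ∀ s, 2 < |s| → b s = 0 := fun s hs =>
    b.zero_of_le_dist (by simpa [b] using hs.le)
  have hb1 : ∀ s, |s| ≤ 1 → b s = 1 := fun s hs =>
    b.one_of_mem_closedBall (by simpa [b] using hs)
  have hgB : BddDerivs g := by
    refine BddDerivs.of_deriv hg ⟨1, fun s => ?_⟩ ?_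
    · rw [abs_le]
      constructor <;> linarith [b.nonneg (x := s), b.le_one (x := s)]
    · have e : deriv g = fun s => -deriv b s := by
        funext s
        simp [g]
      rw [e]
      exact (b.hasCompactSupport.deriv).neg
  have hpos : ∀ M : ℕ, (0 : ℝ) < (M : ℝ) + 1 := fun M => by positivity
  refine ⟨fun M s => g (((M : ℝ) + 1)⁻¹ * s), fun M => hg.comp (contDiff_const.mul contDiff_id),
    fun M s hs => ?_, fun M s hs => ?_, fun l => ?_⟩
  · have : |((M : ℝ) + 1)⁻¹ * s| ≤ 1 := by
      rw [abs_mul, abs_of_pos (inv_pos.2 (hpos M)), inv_mul_le_iff₀ (hpos M)]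
      linarith
    simp [g, hb1 _ this]
  · have : 2 < |((M : ℝ) + 1)⁻¹ * s| := by
      rw [abs_mul, abs_of_pos (inv_pos.2 (hpos M)), lt_inv_mul_iff₀ (hpos M)]
      linarith
    simp [g, hb0 _ this]
  · obtain ⟨C, hC⟩ := hgB.2 l
    refine ⟨C, fun M s => ?_⟩
    rw [iteratedDeriv_comp_const_mul (hg.of_le (by exact_mod_cast le_top)), abs_mul]
    refine (mul_le_of_le_one_left (abs_nonneg _) ?_).trans (hC _)
    rw [abs_pow, abs_of_pos (inv_pos.2 (hpos M))]
    refine pow_le_one₀ (inv_pos.2 (hpos M)).le (inv_le_one_of_one_le₀ ?_)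
    have : (0 : ℝ) ≤ M := Nat.cast_nonneg M
    linarith

/-! ### Smooth approximation of functions with compact support -/

theorem IsWeakDeriv.ae_zero_of_isOpen {w v : ℝ → EuclideanSpace ℝ (Fin N)} (h : IsWeakDeriv w v)
    {U : Set ℝ} (hU : IsOpen U) (hw : ∀ᵐ s, s ∈ U → w s = 0) : ∀ᵐ s, s ∈ U → v s = 0 := by
  refine hU.ae_eq_zero_of_integral_contDiff_smul_eq_zero (h.2.1.locallyIntegrableOn U)
    fun g hg hgc hgU => ?_
  have e := h.2.2 g hg hgc
  have e0 : ∫ s, deriv g s • w s = 0 := by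
    rw [← integral_zero ℝ (EuclideanSpace ℝ (Fin N)) (μ := volume)]
    refine integral_congr_ae ?_
    filter_upwards [hw] with s hs
    by_cases hsU : s ∈ tsupport g
    · rw [hs (hgU hsU), smul_zero]
    · have : deriv g s = 0 := by
        by_contra hc
        exact hsU (support_deriv_subset hc)
      rw [this, zero_smul]
  rw [e0] at e
  exact neg_eq_zero.1 e.symm

/-- The bound comes from integrating v from -(K+1), where the continuous representative vanishes. -/
theorem IsWeakDeriv.exists_continuous_abs_gt {w v : ℝ → EuclideanSpace ℝ (Fin N)}
    (h : IsWeakDeriv w v) {K : ℝ} (hK : 0 ≤ K) (hw : ∀ᵐ s, K < |s| → w s = 0)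
    (hv : MemLp v 2 volume) : ∃ u, Continuous u ∧ w =ᵐ[volume] u ∧ (∀ s, K < |s| → u s = 0) ∧
      ∀ s, |s| ≤ K → ‖u s‖ ≤ √(2 * (K + 1)) * (eLpNorm v 2 volume).toReal := by
  obtain ⟨u, hu, hwu⟩ := h.exists_continuous
  have h0 : ∀ s, K < |s| → u s = 0 := by
    have h1 : ∀ᵐ s ∂(volume.restrict {s : ℝ | K < |s|}), u s = (fun _ => 0) s := by
      rw [ae_restrict_iff' (isOpen_abs_gt K).measurableSet]
      filter_upwards [hw, hwu] with s h1 h2 h3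
      rw [← h2, h1 h3]
    have := Measure.eqOn_open_of_ae_eq (μ := volume) h1 (isOpen_abs_gt K) hu.continuousOn
      continuousOn_const
    exact fun s hs => this hs
  refine ⟨u, hu, hwu, h0, fun s hs => ?_⟩
  have h1 := (h.congr_ae hwu EventuallyEq.rfl).norm_sub_le hu hv
    (a := -(K + 1)) (b := s) (by linarith [(abs_le.1 hs).1])
  rw [h0 (-(K + 1)) (by rw [abs_neg, abs_of_nonneg (by linarith)]; linarith), sub_zero] at h1
  refine h1.trans ?_
  gcongr
  linarith [(abs_le.1 hs).2]

/-- A Poincaré inequality for functions supported in [-K, K]. -/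
theorem eLpNorm_le_of_isWeakDeriv {w v : ℝ → EuclideanSpace ℝ (Fin N)}
    (h : IsWeakDeriv w v) {K : ℝ} (hK : 0 ≤ K) (hw : ∀ᵐ s, K < |s| → w s = 0)
    (hv : MemLp v 2 volume) :
    eLpNorm w 2 volume ≤ ENNReal.ofReal (2 * (K + 1)) * eLpNorm v 2 volume := by
  obtain ⟨u, hu, hwu, h0, hb⟩ := h.exists_continuous_abs_gt hK hw hv
  rw [eLpNorm_congr_ae hwu]
  refine (eLpNorm_le_of_abs_gt hK (Eventually.of_forall h0)
    (Eventually.of_forall hb)).trans ?_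
  rw [← ENNReal.ofReal_toReal hv.2.ne, ← ENNReal.ofReal_mul (by positivity), ENNReal.toReal_ofReal
    ENNReal.toReal_nonneg]
  refine ENNReal.ofReal_le_ofReal ?_
  rw [← mul_assoc]
  refine mul_le_mul_of_nonneg_right ?_ ENNReal.toReal_nonneg
  calc √(2 * K) * √(2 * (K + 1)) ≤ √(2 * (K + 1)) * √(2 * (K + 1)) := by
        gcongr
        linarith
    _ = 2 * (K + 1) := Real.mul_self_sqrt (by linarith)

theorem integral_eq_zero_of_isWeakDeriv {w v : ℝ → EuclideanSpace ℝ (Fin N)}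
    (h : IsWeakDeriv w v) {K : ℝ} (hK : 0 ≤ K) (hw : ∀ᵐ s, K < |s| → w s = 0)
    (hv : MemLp v 2 volume) : ∫ s in (-(K + 1))..(K + 1), v s = 0 := by
  obtain ⟨u, hu, hwu, h0, -⟩ := h.exists_continuous_abs_gt hK hw hv
  rw [← (h.congr_ae hwu EventuallyEq.rfl).sub_eq_integral hu, h0, h0, sub_zero]
  · rw [abs_neg, abs_of_nonneg (by linarith)]; linarith
  · rw [abs_of_nonneg (by linarith)]; linarith

/-- Multiplication by a bump that equals one on [-K, K] fixes f and, being at most one, does not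
increase the distance to f. -/
theorem exists_smooth_approx_zero {f : ℝ → EuclideanSpace ℝ (Fin N)} (hf : MemLp f 2 volume)
    {K : ℝ} (hK : 0 ≤ K) (h0 : ∀ᵐ s, K < |s| → f s = 0) :
    ∃ d : ℕ → ℝ → EuclideanSpace ℝ (Fin N), (∀ n, ContDiff ℝ ∞ (d n)) ∧
      (∀ n s, K + 1 < |s| → d n s = 0) ∧
      Tendsto (fun n => eLpNorm (d n - f) 2 volume) atTop (𝓝 0) := by
  let b : ContDiffBump (0 : ℝ) := ⟨K + 1 / 2, K + 1, by linarith, by linarith⟩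
  have hg : ∀ n : ℕ, ∃ g : ℝ → EuclideanSpace ℝ (Fin N), ContDiff ℝ ∞ g ∧
      eLpNorm (f - g) 2 volume ≤ ENNReal.ofReal (1 / ((n : ℝ) + 1)) := fun n => by
    obtain ⟨g, -, h1, h2⟩ := hf.exist_eLpNorm_sub_le (by norm_num) (by norm_num)
      (ε := 1 / ((n : ℝ) + 1)) (by positivity)
    exact ⟨g, h1, h2⟩
  choose g hg hg' using hg
  refine ⟨fun n s => b s • g n s, fun n => b.contDiff.smul (hg n), fun n s hs => ?_, ?_⟩
  · beta_reduce
    rw [b.zero_of_le_dist (by simpa [b] using hs.le), zero_smul]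
  · have ht : Tendsto (fun n : ℕ => ENNReal.ofReal (1 / ((n : ℝ) + 1))) atTop (𝓝 0) := by
      simpa using ENNReal.tendsto_ofReal tendsto_one_div_add_atTop_nhds_zero_nat
    refine tendsto_of_tendsto_of_tendsto_of_le_of_le tendsto_const_nhds ht (fun _ => zero_le)
      fun n => le_trans (eLpNorm_mono_ae ?_) (hg' n)
    filter_upwards [h0] with s hs
    have e : b s • f s = f s := by
      rcases le_or_gt |s| K with h | h
      · rw [b.one_of_mem_closedBall (by simp only [b, mem_closedBall_zero_iff, Real.norm_eq_abs]; linarith), one_smul]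
      · rw [hs h, smul_zero]
    simp only [Pi.sub_apply]
    rw [norm_sub_rev (f s)]
    nth_rewrite 1 [← e]
    rw [← smul_sub, norm_smul, Real.norm_eq_abs, abs_of_nonneg b.nonneg]
    exact mul_le_of_le_one_left (norm_nonneg _) b.le_one

theorem iteratedDeriv_sub_smul_const {g : ℝ → EuclideanSpace ℝ (Fin N)} (hg : ContDiff ℝ ∞ g)
    {η : ℝ → ℝ} (hη : ContDiff ℝ ∞ η) (a : EuclideanSpace ℝ (Fin N)) (j : ℕ) :
    iteratedDeriv j (fun s => g s - η s • a) = fun s => iteratedDeriv j g s - iteratedDeriv j η s • a := by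
  funext s
  have h1 : ContDiffAt ℝ j g s := (hg.of_le (by exact_mod_cast le_top)).contDiffAt
  have h2 : ContDiffAt ℝ j η s := (hη.of_le (by exact_mod_cast le_top)).contDiffAt
  rw [iteratedDeriv_fun_sub (f := g) (g := fun s => η s • a) h1 (h2.smul contDiffAt_const),
    iteratedDeriv_smul_const h2]

/-- Induction from the top derivative down: approximate w 1 with its derivatives by g_n, remove the
mean by subtracting (∫g_n)η, and integrate. Since w 1 has mean zero, ∫g_n → 0 and the correction is
harmless; the function itself converges by the Poincaré inequality. -/
theorem exists_smooth_approx {k : ℕ} {K : ℝ} (hK : 0 ≤ K) :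
    ∀ {w : ℕ → ℝ → EuclideanSpace ℝ (Fin N)}, IsSobolevJet k 0 (w 0) w →
      (∀ᵐ s, K < |s| → w 0 s = 0) →
      ∃ d : ℕ → ℝ → EuclideanSpace ℝ (Fin N), (∀ n, ContDiff ℝ ∞ (d n)) ∧
        (∀ n s, K + 1 < |s| → d n s = 0) ∧
        ∀ j ≤ k, Tendsto (fun n => eLpNorm (iteratedDeriv j (d n) - w j) 2 volume) atTop (𝓝 0) := by
  induction k with
  | zero =>
    intro w hw h0
    have hm : MemLp (w 0) 2 volume := by simpa using hw.2.2 0 le_rfl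
    obtain ⟨d, h1, h2, h3⟩ := exists_smooth_approx_zero hm hK h0
    exact ⟨d, h1, h2, fun j hj => by simpa [Nat.le_zero.1 hj] using h3⟩
  | succ k ih =>
    intro w hw h0
    have hm : ∀ j ≤ k + 1, MemLp (w j) 2 volume := fun j hj => by simpa using hw.2.2 j hj
    have hwd := hw.2.1 0 (by omega)
    obtain ⟨g, hg, hg0, hgt⟩ := ih (w := fun j => w (j + 1)) hw.tail
      (hwd.ae_zero_of_isOpen (isOpen_abs_gt K) h0)
    obtain ⟨η, hη, hη0, hη1⟩ := exists_smooth_integral_eq_one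
    have hηc := hasCompactSupport_of_abs_gt hη0
    let a : ℕ → EuclideanSpace ℝ (Fin N) := fun n => ∫ s, g n s
    have hgc : ∀ n, HasCompactSupport (g n) := fun n => hasCompactSupport_of_abs_gt (hg0 n)
    have hgm : ∀ n j, MemLp (iteratedDeriv j (g n)) 2 volume := fun n j =>
      ((hg n).iteratedDeriv_infty j).continuous.memLp_of_hasCompactSupport ((hgc n).iteratedDeriv' j)
    have hηm : ∀ j, MemLp (iteratedDeriv j η) 2 volume := fun j =>
      (hη.iteratedDeriv_infty j).continuous.memLp_of_hasCompactSupport (hηc.iteratedDeriv' j)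
    have hgt0 := hgt 0 (by omega)
    simp only [iteratedDeriv_zero] at hgt0
    have hgm0 : ∀ n, MemLp (g n) 2 volume := fun n => by simpa using hgm n 0
    have ha : Tendsto a atTop (𝓝 0) := by
      have h1 : ∀ n, ‖a n‖ ≤ √((K + 1) + 1 - -((K + 1) + 1)) * (eLpNorm (g n - w 1) 2 volume).toReal := by
        intro n
        have e1 : a n = ∫ s in (-((K + 1) + 1))..((K + 1) + 1), g n s := by
          rw [intervalIntegral.integral_eq_integral_of_support_subset]
          intro s hs
          have : |s| ≤ K + 1 := by
            by_contra hc
            exact hs (hg0 n s (not_le.1 hc))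
          have := abs_le.1 this
          exact ⟨by linarith [this.1], by linarith [this.2]⟩
        have e2 := integral_eq_zero_of_isWeakDeriv hwd (by linarith : 0 ≤ K + 1)
          (h0.mono fun s hs h => hs (by linarith)) (hm 1 (by omega))
        have i1 := (hg n).continuous.intervalIntegrable (μ := volume) (-((K + 1) + 1)) ((K + 1) + 1)
        have i2 := LocallyIntegrable.intervalIntegrable' hwd.2.1 (-((K + 1) + 1)) ((K + 1) + 1)
        have e3 : a n = ∫ s in (-((K + 1) + 1))..((K + 1) + 1), (g n - w 1) s := by
          simp only [Pi.sub_apply]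
          rw [intervalIntegral.integral_sub i1 i2]
          simp only [zero_add] at e2 ⊢
          rw [e2, sub_zero, e1]
        rw [e3]
        exact (intervalIntegral.norm_integral_le_integral_norm (by linarith)).trans
          (norm_intervalIntegral_le_sqrt ((hgm0 n).sub (hm 1 (by omega))) (by linarith))
      refine squeeze_zero_norm h1 ?_
      have h2 := (ENNReal.tendsto_toReal ENNReal.zero_ne_top).comp hgt0
      simpa using h2.const_mul (√((K + 1) + 1 - -((K + 1) + 1)))
    have hpr := fun n => exists_primitive (f := fun s => g n s - η s • a n)
      ((hg n).sub (hη.smul contDiff_const)) (M := K + 1) (by linarith)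
      (fun s hs => by rw [hg0 n s hs, hη0 s (by linarith), zero_smul, sub_zero])
      (by
        rw [integral_sub ((hg n).continuous.integrable_of_hasCompactSupport (hgc n))
          ((hη.continuous.integrable_of_hasCompactSupport hηc).smul_const _), integral_smul_const, hη1,
          one_smul, sub_self])
    choose d hd hd' hd0 using hpr
    have hds : ∀ n j, iteratedDeriv (j + 1) (d n) = fun s => iteratedDeriv j (g n) s - iteratedDeriv j η s • a n := by
      intro n j
      rw [iteratedDeriv_succ', hd' n, iteratedDeriv_sub_smul_const (hg n) hη]
    have hsucc : ∀ j ≤ k, Tendsto (fun n => eLpNorm (iteratedDeriv (j + 1) (d n) - w (j + 1)) 2 volume)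
        atTop (𝓝 0) := by
      intro j hj
      have h1 : Tendsto (fun n => ‖a n‖ₑ * eLpNorm (iteratedDeriv j η) 2 volume) atTop (𝓝 0) := by
        have h2 : Tendsto (fun n => ‖a n‖ₑ) atTop (𝓝 0) := by simpa using ha.enorm
        simpa using ENNReal.Tendsto.mul_const h2 (Or.inr (hηm j).2.ne)
      have h2 := (hgt j hj).add h1
      rw [add_zero] at h2
      refine tendsto_of_tendsto_of_tendsto_of_le_of_le tendsto_const_nhds h2 (fun _ => zero_le)
        fun n => ?_
      have e : iteratedDeriv (j + 1) (d n) - w (j + 1) =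
          (iteratedDeriv j (g n) - w (j + 1)) - fun s => iteratedDeriv j η s • a n := by
        rw [hds]
        funext s
        simp only [Pi.sub_apply]
        abel
      simp only [e]
      refine (eLpNorm_sub_le ((hgm n j).sub (hm (j + 1) (by omega))).1
        ((hηm j).1.smul_const (a n)) (by norm_num)).trans ?_
      gcongr
      refine (eLpNorm_le_mul_eLpNorm_of_ae_le_mul (c := ‖a n‖) (g := iteratedDeriv j η)
        (Eventually.of_forall fun s => by rw [norm_smul, mul_comm]) 2).trans ?_
      rw [ofReal_norm]
    refine ⟨d, hd, hd0, fun j hj => ?_⟩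
    cases j with
    | succ j => exact hsucc j (by omega)
    | zero =>
      have h1 := hsucc 0 (by omega)
      have h2 : Tendsto (fun n => ENNReal.ofReal (2 * ((K + 1) + 1)) *
          eLpNorm (iteratedDeriv (0 + 1) (d n) - w (0 + 1)) 2 volume) atTop (𝓝 0) := by
        have h3 := ENNReal.Tendsto.const_mul (a := ENNReal.ofReal (2 * ((K + 1) + 1))) h1
          (Or.inr ENNReal.ofReal_ne_top)
        rwa [mul_zero] at h3
      refine tendsto_of_tendsto_of_tendsto_of_le_of_le tendsto_const_nhds h2 (fun _ => zero_le)
        fun n => ?_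
      have hw' : IsWeakDeriv (iteratedDeriv 0 (d n) - w 0) (iteratedDeriv (0 + 1) (d n) - w (0 + 1)) := by
        rw [iteratedDeriv_zero, zero_add, iteratedDeriv_one]
        exact (isWeakDeriv_deriv ((hd n).of_le (by norm_cast))).sub hwd
      refine eLpNorm_le_of_isWeakDeriv hw' (by linarith) ?_ ?_
      · filter_upwards [h0] with s hs hsK
        rw [iteratedDeriv_zero, Pi.sub_apply, hd0 n s hsK, hs (by linarith), sub_zero]
      · refine MemLp.sub ?_ (hm 1 (by omega))
        exact ((hd n).iteratedDeriv_infty _).continuous.memLp_of_hasCompactSupport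
          ((hasCompactSupport_of_abs_gt (hd0 n)).iteratedDeriv' _)

end Density

/-! ### Density of test functions and compactness of the inclusions. -/

section TestFunctions

variable {N : ℕ} {k k' : ℕ} {δ δ' : ℝ} {S S' : Submodule ℝ (EuclideanSpace ℝ (Fin N))}

theorem weighted_add (δ : ℝ) (f g : ℝ → EuclideanSpace ℝ (Fin N)) :
    weighted δ (f + g) = weighted δ f + weighted δ g := by
  funext s
  simp [weighted]

/-- The smooth functions with compact support and value at zero in `S`. -/
def testSubmodule (S : Submodule ℝ (EuclideanSpace ℝ (Fin N))) :
    Submodule ℝ (ℝ → EuclideanSpace ℝ (Fin N)) where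
  carrier := {f | ContDiff ℝ ∞ f ∧ HasCompactSupport f ∧ f 0 ∈ S}
  zero_mem' := ⟨contDiff_const, HasCompactSupport.zero, S.zero_mem⟩
  add_mem' := fun hf hg => ⟨hf.1.add hg.1, hf.2.1.add hg.2.1, S.add_mem hf.2.2 hg.2.2⟩
  smul_mem' := fun c _ hf => ⟨contDiff_const.smul hf.1, hf.2.1.smul_left, S.smul_mem c hf.2.2⟩

theorem isSobolevJet_iteratedDeriv {f : ℝ → EuclideanSpace ℝ (Fin N)} (hf : ContDiff ℝ ∞ f)
    (hc : HasCompactSupport f) : IsSobolevJet k δ f (fun j => iteratedDeriv j f) := by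
  refine ⟨iteratedDeriv_zero, fun j _ => ?_, fun j _ => ?_⟩
  · beta_reduce
    rw [iteratedDeriv_succ]
    exact isWeakDeriv_deriv ((hf.iteratedDeriv_infty j).of_le (by norm_cast))
  · exact ((continuous_weight δ).smul (hf.iteratedDeriv_infty j).continuous).memLp_of_hasCompactSupport
      (hc.iteratedDeriv' j).smul_left

/-- A test function as an element of a Sobolev space. -/
noncomputable def testElt (k : ℕ) (δ : ℝ) : testSubmodule S →ₗ[ℝ] SobolevSpace k δ S where
  toFun f := ⟨f.1, f.2.1.continuous, f.2.2.2, _, isSobolevJet_iteratedDeriv f.2.1 f.2.2.1⟩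
  map_add' _ _ := rfl
  map_smul' _ _ := rfl

theorem sobolevEmb_testElt (f : testSubmodule S) : sobolevEmb k δ S (testElt k δ f) = f := rfl

theorem IsSobolevJet.ae_zero {w : ℕ → ℝ → EuclideanSpace ℝ (Fin N)}
    (hw : IsSobolevJet k δ (w 0) w) {U : Set ℝ} (hU : IsOpen U) (h0 : ∀ s ∈ U, w 0 s = 0) :
    ∀ j ≤ k, ∀ᵐ s, s ∈ U → w j s = 0 := by
  intro j
  induction j with
  | zero => exact fun _ => Eventually.of_forall h0
  | succ j ih => exact fun hj => (hw.2.1 j hj).ae_zero_of_isOpen hU (ih (by omega))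

theorem eLpNorm_weighted_le {f : ℝ → EuclideanSpace ℝ (Fin N)} (hδ : 0 ≤ δ) {K : ℝ}
    (h0 : ∀ᵐ s, K < |s| → f s = 0) :
    eLpNorm (weighted δ f) 2 volume ≤ ENNReal.ofReal (Real.exp (δ * K)) * eLpNorm f 2 volume := by
  refine eLpNorm_le_mul_eLpNorm_of_ae_le_mul ?_ 2
  filter_upwards [h0] with s hs
  rcases le_or_gt |s| K with h | h
  · rw [weighted, norm_smul, Real.norm_eq_abs, Real.abs_exp]
    gcongr
  · rw [weighted, hs h, smul_zero, norm_zero, mul_zero]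

/-- Cutting off leaves a jet supported in [-K, K]; there the weight costs only the constant
e^{δ(K+1)}, so unweighted approximation suffices. -/
theorem exists_test_jet (hδ : 0 ≤ δ) {w : ℕ → ℝ → EuclideanSpace ℝ (Fin N)}
    (hw : IsSobolevJet k δ (w 0) w) {ε : ℝ} (hε : 0 < ε) :
    ∃ d : ℝ → EuclideanSpace ℝ (Fin N), ContDiff ℝ ∞ d ∧ HasCompactSupport d ∧
      ∀ j ≤ k, eLpNorm (weighted δ (w j + (-1 : ℝ) • iteratedDeriv j d)) 2 volume ≤
        ENNReal.ofReal ε := by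
  obtain ⟨ψ, h1, h2, h3, h4⟩ := exists_cutoff
  obtain ⟨u, hu, hut⟩ := IsSobolevJet.cutoff h1 h2 h4 hw
  have hev : ∀ᶠ M in atTop, ∀ j ∈ Finset.range (k + 1),
      eLpNorm (weighted δ (u M j)) 2 volume ≤ ENNReal.ofReal (ε / 2) := by
    rw [Filter.eventually_all_finset]
    intro j hj
    exact (hut j (Nat.le_of_lt_succ (Finset.mem_range.1 hj))).eventually_le_const
      (ENNReal.ofReal_pos.2 (by positivity))
  obtain ⟨M, hM⟩ := hev.exists
  set K : ℝ := 2 * ((M : ℝ) + 1) with hK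
  have hK0 : 0 ≤ K := by positivity
  let w' : ℕ → ℝ → EuclideanSpace ℝ (Fin N) := w + (-1 : ℝ) • u M
  have e0 : w' 0 = w 0 + (-1 : ℝ) • (fun s => ψ M s • w 0 s) := by
    simp only [w', Pi.add_apply, Pi.smul_apply, (hu M).1]
  have hw' : IsSobolevJet k δ (w' 0) w' := by
    rw [e0]
    exact hw.add ((hu M).const_smul (-1))
  have hz : ∀ s, K < |s| → w' 0 s = 0 := fun s hs => by
    rw [e0]
    simp [h3 M s hs]
  obtain ⟨d, hd, hd0, hdt⟩ := exists_smooth_approx hK0 (hw'.mono le_rfl hδ) (Eventually.of_forall hz)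
  have hev : ∀ᶠ n in atTop, ∀ j ∈ Finset.range (k + 1),
      eLpNorm (iteratedDeriv j (d n) - w' j) 2 volume ≤
        ENNReal.ofReal (ε / 2 / Real.exp (δ * (K + 1))) := by
    rw [Filter.eventually_all_finset]
    intro j hj
    exact (hdt j (Nat.le_of_lt_succ (Finset.mem_range.1 hj))).eventually_le_const
      (ENNReal.ofReal_pos.2 (by positivity))
  obtain ⟨n, hn⟩ := hev.exists
  have hdc : HasCompactSupport (d n) := hasCompactSupport_of_abs_gt (hd0 n)
  refine ⟨d n, hd n, hdc, fun j hj => ?_⟩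
  have hj' : j ∈ Finset.range (k + 1) := Finset.mem_range.2 (by omega)
  have e : w j + (-1 : ℝ) • iteratedDeriv j (d n) =
      (-1 : ℝ) • (iteratedDeriv j (d n) - w' j) + u M j := by
    simp only [w', Pi.add_apply, Pi.smul_apply]
    module
  have hdj : IsSobolevJet k δ (d n) (fun j => iteratedDeriv j (d n)) :=
    isSobolevJet_iteratedDeriv (hd n) hdc
  have hz' : ∀ᵐ s, K + 1 < |s| → ((-1 : ℝ) • (iteratedDeriv j (d n) - w' j)) s = 0 := by
    filter_upwards [hw'.ae_zero (isOpen_abs_gt K) hz j hj] with s hs hsK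
    have := hs (show K < |s| by linarith)
    simp [this, iteratedDeriv_eq_zero_of_abs_gt (hd0 n) j hsK]
  have hm1 : MemLp (weighted δ ((-1 : ℝ) • (iteratedDeriv j (d n) - w' j))) 2 volume := by
    have := ((hdj.add (hw'.const_smul (-1))).const_smul (-1)).2.2 j hj
    have e : (-1 : ℝ) • (iteratedDeriv j (d n) - w' j) =
      ((-1 : ℝ) • ((fun j => iteratedDeriv j (d n)) + (-1 : ℝ) • w')) j := by
      simp [sub_eq_add_neg]
    rw [e]
    exact this
  rw [e, weighted_add]
  refine (eLpNorm_add_le hm1.1 ((hu M).2.2 j hj).1 (by norm_num)).trans ?_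
  have hfirst : eLpNorm (weighted δ ((-1 : ℝ) • (iteratedDeriv j (d n) - w' j))) 2 volume ≤
      ENNReal.ofReal (ε / 2) := by
    refine (eLpNorm_weighted_le hδ hz').trans ?_
    have e1 : eLpNorm ((-1 : ℝ) • (iteratedDeriv j (d n) - w' j)) 2 volume =
        eLpNorm (iteratedDeriv j (d n) - w' j) 2 volume := by
      rw [neg_one_smul, eLpNorm_neg]
    rw [e1]
    calc _ ≤ ENNReal.ofReal (Real.exp (δ * (K + 1))) *
          ENNReal.ofReal (ε / 2 / Real.exp (δ * (K + 1))) := by gcongr; exact hn j hj'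
      _ = ENNReal.ofReal (ε / 2) := by
        rw [← ENNReal.ofReal_mul (Real.exp_pos _).le]
        congr 1
        field_simp
  calc _ ≤ ENNReal.ofReal (ε / 2) + ENNReal.ofReal (ε / 2) := add_le_add hfirst (hM j hj')
    _ = ENNReal.ofReal ε := by rw [← ENNReal.ofReal_add (by positivity) (by positivity), add_halves]

/-- The test function `η • c`. -/
def bumpTest {η : ℝ → ℝ} (hη : ContDiff ℝ ∞ η) (hηc : HasCompactSupport η) :
    EuclideanSpace ℝ (Fin N) →ₗ[ℝ]
      testSubmodule (⊤ : Submodule ℝ (EuclideanSpace ℝ (Fin N))) where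
  toFun c := ⟨fun s => η s • c, hη.smul contDiff_const, hηc.smul_right, Submodule.mem_top⟩
  map_add' a b := by ext1; funext s; exact smul_add _ _ _
  map_smul' a b := by ext1; funext s; exact smul_comm _ _ _

theorem dense_test (hk : 1 ≤ k) (hδ : 0 ≤ δ) :
    Dense {x : SobolevSpace k δ S | sobolevEmb k δ S x ∈ testSubmodule S} := by
  let b : ContDiffBump (0 : ℝ) := ⟨1, 2, by norm_num, by norm_num⟩
  have hb1 : b 0 = 1 := b.one_of_mem_closedBall (by simp [b])
  let L₀ : EuclideanSpace ℝ (Fin N) →ₗ[ℝ] SobolevSpace k δ (⊤ : Submodule ℝ (EuclideanSpace ℝ (Fin N))) :=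
    (testElt k δ).comp (bumpTest (N := N) (η := b) b.contDiff b.hasCompactSupport)
  let L : EuclideanSpace ℝ (Fin N) →L[ℝ] SobolevSpace k δ (⊤ : Submodule ℝ (EuclideanSpace ℝ (Fin N))) :=
    ⟨L₀, L₀.continuous_of_finiteDimensional⟩
  have hL : ∀ c, sobolevEmb k δ ⊤ (L c) = fun s => b s • c := fun c => rfl
  intro h
  rw [Metric.mem_closure_iff]
  intro ε hε
  -- Inside the bracket, k + 1 bounds the error of d and ‖L‖·2(k+1) the correction at 0; the outer k
  -- + 1 is the price of returning from `⊤` to S.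
  set B : ℝ := (k + 1) * ((k + 1) + ‖L‖ * (2 * (k + 1))) with hB
  have hB0 : 0 < B := by positivity
  set ε' := ε / (2 * B) with hε'
  have hε0 : 0 < ε' := by positivity
  have hj := sobolevJet_spec h
  obtain ⟨d, hd, hdc, hdb⟩ := exists_test_jet hδ (w := sobolevJet h) (by rw [hj.1]; exact hj) hε0
  let ι : SobolevSpace k δ S →L[ℝ] SobolevSpace k δ ⊤ := sobolevIncl le_rfl le_rfl le_top
  have hι : ∀ x, sobolevEmb k δ ⊤ (ι x) = sobolevEmb k δ S x := fun x => rfl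
  let d' : testSubmodule (⊤ : Submodule ℝ (EuclideanSpace ℝ (Fin N))) := ⟨d, hd, hdc, Submodule.mem_top⟩
  let e₁ := ι h - testElt k δ d'
  have he₁ : sobolevEmb k δ ⊤ e₁ = sobolevEmb k δ S h + (-1 : ℝ) • d := by
    rw [map_sub, hι, sobolevEmb_testElt, neg_one_smul, sub_eq_add_neg]
  have hn₁ : ‖e₁‖ ≤ (k + 1) * ε' := by
    refine norm_sobolev_le e₁ (w := sobolevJet h + (-1 : ℝ) • fun j => iteratedDeriv j d) ?_ hε0.le hdb
    rw [he₁]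
    exact hj.add ((isSobolevJet_iteratedDeriv hd hdc).const_smul (-1))
  -- Subtracting the bump times c restores the exact value h(0) at the origin; c is small because
  -- evaluation at 0 is bounded.
  set c := d 0 - sobolevEmb k δ S h 0 with hc
  have hcn : ‖c‖ ≤ 2 * ((k + 1) * ε') := by
    have := norm_sobolevEmb_le hk hδ e₁ 0
    rw [he₁] at this
    have e : (sobolevEmb k δ S h + (-1 : ℝ) • d) 0 = -c := by simp [hc, sub_eq_add_neg]
    rw [e, norm_neg] at this
    linarith
  have hx0 : (fun s => d s - b s • c) ∈ testSubmodule S := by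
    refine ⟨hd.sub (b.contDiff.smul contDiff_const), hdc.sub b.hasCompactSupport.smul_right, ?_⟩
    simp only [hb1, one_smul, hc, sub_sub_cancel]
    exact h.2.2.1
  refine ⟨testElt k δ ⟨_, hx0⟩, hx0, ?_⟩
  rw [dist_eq_norm]
  have e2 : ι (h - testElt k δ ⟨_, hx0⟩) = e₁ + L c := by
    refine sobolevEmb_injective k δ ⊤ ?_
    rw [map_add, hι, map_sub, he₁, hL, sobolevEmb_testElt]
    funext s
    simp only [Pi.sub_apply, Pi.add_apply, Pi.smul_apply]
    module
  have h1 := norm_le_norm_sobolevIncl (le_top (a := S)) (h - testElt k δ ⟨_, hx0⟩)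
  change _ ≤ (_ : ℝ) * ‖ι _‖ at h1
  rw [e2] at h1
  have h2 : ‖e₁ + L c‖ ≤ (k + 1) * ε' + ‖L‖ * (2 * ((k + 1) * ε')) :=
    (norm_add_le _ _).trans (add_le_add hn₁ ((L.le_opNorm c).trans (by gcongr)))
  calc _ ≤ _ := h1
    _ ≤ (k + 1) * ((k + 1) * ε' + ‖L‖ * (2 * ((k + 1) * ε'))) := by gcongr
    _ = B * ε' := by rw [hB]; ring
    _ = ε / 2 := by rw [hε']; field_simp
    _ < ε := by linarith

/-! ### Compactness of the inclusions -/

/-- Up to ε‖x‖ the operator is controlled by a bounded map into a finite-dimensional space, where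
bounded sets are totally bounded. A net there pulls back to a net for the image of the ball. Working
on D allows P to use classical derivatives of test functions. -/
theorem isCompactOperator_of_ehrling {M M' G : Type*} [NormedAddCommGroup M] [NormedSpace ℝ M]
    [NormedAddCommGroup M'] [NormedSpace ℝ M'] [CompleteSpace M'] [NormedAddCommGroup G]
    [NormedSpace ℝ G] [FiniteDimensional ℝ G] (T : M →L[ℝ] M') (D : Submodule ℝ M)
    (hD : Dense (D : Set M))
    (h : ∀ ε > 0, ∃ (n : ℕ) (P : D →ₗ[ℝ] (Fin n → G)) (C : ℝ), (∀ x, ‖P x‖ ≤ C * ‖x‖) ∧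
      ∀ x : D, ‖T x‖ ≤ ε * ‖x‖ + C * ‖P x‖) : IsCompactOperator T := by
  refine (isCompactOperator_iff_isCompact_closure_image_ball (T : M →ₗ[ℝ] M') one_pos).2 ?_
  have hb : Metric.ball (0 : M) 1 ⊆ closure (Metric.ball 0 1 ∩ D) :=
    hD.open_subset_closure_inter Metric.isOpen_ball
  have htb : TotallyBounded (T '' (Metric.ball 0 1 ∩ D)) := by
    rw [Metric.totallyBounded_iff]
    intro ε hε
    obtain ⟨n, P, C, hPC, hP⟩ := h (ε / 4) (by positivity)
    let B : Set D := {x | ‖x‖ < 1}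
    have hPB : TotallyBounded (P '' B) := by
      have : Bornology.IsBounded (P '' B) := by
        refine (Metric.isBounded_closedBall (x := (0 : Fin n → G)) (r := |C|)).subset ?_
        rintro _ ⟨x, hx, rfl⟩
        rw [mem_closedBall_zero_iff]
        refine (hPC x).trans ?_
        have hx : ‖x‖ < 1 := hx
        calc C * ‖x‖ ≤ |C| * ‖x‖ := by gcongr; exact le_abs_self C
          _ ≤ |C| := mul_le_of_le_one_right (abs_nonneg _) hx.le
      exact this.isCompact_closure.totallyBounded.subset subset_closure
    -- Two points of the ball differ by at most 2, so a net of this radius gives total error at most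
    -- (ε/4)·2 + ε/4 < ε.
    obtain ⟨t, htB, htf, ht⟩ := Metric.finite_approx_of_totallyBounded hPB (ε / (4 * (|C| + 1)))
      (by positivity)
    have htB' : ∀ y, ∃ x : D, y ∈ t → x ∈ B ∧ P x = y := fun y => by
      by_cases hy : y ∈ t
      · obtain ⟨x, hx, e⟩ := htB hy
        exact ⟨x, fun _ => ⟨hx, e⟩⟩
      · exact ⟨0, fun h => absurd h hy⟩
    choose g hg' using htB'
    have hgB : ∀ {y}, y ∈ t → g y ∈ B := fun h => (hg' _ h).1
    have hg : ∀ {y}, y ∈ t → P (g y) = y := fun h => (hg' _ h).2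
    refine ⟨(fun y => T (g y)) '' t, htf.image _, ?_⟩
    rintro _ ⟨x, ⟨hx1, hxD⟩, rfl⟩
    have hx1 : ‖x‖ < 1 := by simpa using hx1
    obtain ⟨y, hyt, hy⟩ := mem_iUnion₂.1 (ht ⟨⟨x, hxD⟩, hx1, rfl⟩)
    refine mem_iUnion₂.2 ⟨_, mem_image_of_mem _ hyt, ?_⟩
    have hgy : ‖g y‖ < 1 := hgB hyt
    rw [mem_ball_iff_norm] at hy ⊢
    have h1 := hP (⟨x, hxD⟩ - g y)
    rw [map_sub, hg hyt] at h1
    have h2 : ‖(⟨x, hxD⟩ : D) - g y‖ ≤ 2 := by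
      refine (norm_sub_le _ _).trans ?_
      have : ‖(⟨x, hxD⟩ : D)‖ < 1 := hx1
      linarith
    rw [← map_sub]
    have h3 : C * ‖P ⟨x, hxD⟩ - y‖ ≤ ε / 4 := by
      calc C * ‖P ⟨x, hxD⟩ - y‖ ≤ (|C| + 1) * (ε / (4 * (|C| + 1))) := by
            gcongr
            linarith [le_abs_self C]
        _ = ε / 4 := by field_simp
    calc ‖T (x - g y)‖ ≤ ε / 4 * ‖(⟨x, hxD⟩ : D) - g y‖ + C * ‖P ⟨x, hxD⟩ - y‖ := h1
      _ ≤ ε / 4 * 2 + ε / 4 := by gcongr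
      _ < ε := by linarith
  have hsub : T '' Metric.ball 0 1 ⊆ closure (T '' (Metric.ball 0 1 ∩ D)) :=
    (image_mono hb).trans (image_closure_subset_closure_image T.continuous)
  exact (htb.closure.subset hsub).closure.isCompact_of_isClosed isClosed_closure

/-- The values of the derivatives of order at most `k` at the points `-M + l / K`. -/
noncomputable def pointValues (k k' : ℕ) (δ : ℝ) (S : Submodule ℝ (EuclideanSpace ℝ (Fin N))) (M K : ℕ) :
    (testSubmodule S).comap (sobolevEmb k δ S) →ₗ[ℝ]
      (Fin ((k' + 1) * (2 * M * K + 1)) → EuclideanSpace ℝ (Fin N)) where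
  toFun x i := iteratedDeriv (finProdFinEquiv.symm i).1 (sobolevEmb k δ S x)
    (-M + (finProdFinEquiv.symm i).2 / K)
  map_add' x y := by
    funext i
    have hx : ContDiff ℝ ∞ (sobolevEmb k δ S x) := x.2.1
    have hy : ContDiff ℝ ∞ (sobolevEmb k δ S y) := y.2.1
    simp only [Submodule.coe_add, map_add, Pi.add_apply]
    exact iteratedDeriv_add (hx.of_le (by exact_mod_cast le_top)).contDiffAt
      (hy.of_le (by exact_mod_cast le_top)).contDiffAt
  map_smul' c x := by
    funext i
    simp only [Submodule.coe_smul, map_smul, Pi.smul_apply, RingHom.id_apply]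
    exact iteratedDeriv_const_smul_field _ _

theorem norm_iteratedDeriv_le (hδ : 0 ≤ δ) {x : SobolevSpace k δ S}
    (hx : sobolevEmb k δ S x ∈ testSubmodule S) {j : ℕ} (hj : j < k) (s : ℝ) :
    ‖iteratedDeriv j (sobolevEmb k δ S x) s‖ ≤ 2 * ‖x‖ := by
  have hjet := isSobolevJet_iteratedDeriv (k := k) (δ := δ) hx.1 hx.2.1
  have hjet0 := hjet.mono le_rfl hδ
  have h1 := (hjet.2.1 j hj).norm_le (hx.1.iteratedDeriv_infty j).continuous
    (by simpa using hjet0.2.2 j hj.le) (by simpa using hjet0.2.2 (j + 1) hj) s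
  have h2 : ∀ i ≤ k, (eLpNorm (iteratedDeriv i (sobolevEmb k δ S x)) 2 volume).toReal ≤ ‖x‖ :=
    fun i hi => by
      have h3 := (eLpNorm_weighted_mono hδ).trans (eLpNorm_le_norm_sobolev x hjet hi)
      rw [weighted_zero] at h3
      exact ENNReal.toReal_le_of_le_ofReal (norm_nonneg _) h3
  linarith [h2 j hj.le, h2 (j + 1) hj]

/-- Compare s with the nearest grid point to its left, at distance at most 1/K. The derivative of
order j is Hölder-1/2 with the L² norm of the next derivative as constant, which is available
because j ≤ k' < k. -/
theorem norm_iteratedDeriv_le_pointValues (hδ : 0 ≤ δ)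
    (x : (testSubmodule S).comap (sobolevEmb k δ S)) {j M K : ℕ} (hK : 0 < K) (hj : j ≤ k')
    (hk : k' < k) {s : ℝ} (hs : |s| ≤ M) :
    ‖iteratedDeriv j (sobolevEmb k δ S x) s‖ ≤
      ‖pointValues k k' δ S M K x‖ + √(1 / K) * ‖(x : SobolevSpace k δ S)‖ := by
  have hx : sobolevEmb k δ S x ∈ testSubmodule S := x.2
  have hjet := isSobolevJet_iteratedDeriv (k := k) (δ := δ) hx.1 hx.2.1
  have hjet0 := hjet.mono le_rfl hδ
  have hs' := abs_le.1 hs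
  have hK' : (0 : ℝ) < K := Nat.cast_pos.2 hK
  set l := ⌊(s + M) * K⌋₊ with hl
  have hp : 0 ≤ (s + M) * K := mul_nonneg (by linarith) hK'.le
  have h1 : (l : ℝ) ≤ (s + M) * K := Nat.floor_le hp
  have h2 : (s + M) * K < l + 1 := Nat.lt_floor_add_one _
  have hlt : l < 2 * M * K + 1 := by
    rw [Nat.lt_succ_iff, ← Nat.cast_le (α := ℝ)]
    push_cast
    refine h1.trans ?_
    gcongr
    linarith
  have h3 : -(M : ℝ) + l / K ≤ s := by
    have : (l : ℝ) / K ≤ s + M := by rwa [div_le_iff₀ hK']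
    linarith
  have h4 : s - (-(M : ℝ) + l / K) ≤ 1 / K := by
    have : s + M ≤ (l + 1) / K := by rw [le_div_iff₀ hK']; exact h2.le
    rw [add_div] at this
    linarith
  have h5 := (hjet.2.1 j (by omega)).norm_sub_le (hx.1.iteratedDeriv_infty j).continuous
    (by simpa using hjet0.2.2 (j + 1) (by omega)) h3
  have h6 : (eLpNorm (iteratedDeriv (j + 1) (sobolevEmb k δ S x)) 2 volume).toReal ≤
      ‖(x : SobolevSpace k δ S)‖ := by
    have h3 := (eLpNorm_weighted_mono hδ).trans
      (eLpNorm_le_norm_sobolev (x : SobolevSpace k δ S) hjet (j := j + 1) (by omega))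
    rw [weighted_zero] at h3
    exact ENNReal.toReal_le_of_le_ofReal (norm_nonneg _) h3
  have h7 : ‖iteratedDeriv j (sobolevEmb k δ S x) (-M + l / K)‖ ≤ ‖pointValues k k' δ S M K x‖ := by
    have := norm_le_pi_norm (pointValues k k' δ S M K x)
      (finProdFinEquiv (⟨j, by omega⟩, ⟨l, hlt⟩))
    simp only [pointValues, LinearMap.coe_mk, AddHom.coe_mk] at this ⊢
    rwa [Equiv.symm_apply_apply] at this
  have h8 := norm_sub_norm_le (iteratedDeriv j (sobolevEmb k δ S x) s)
    (iteratedDeriv j (sobolevEmb k δ S x) (-M + l / K))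
  have h9 : √(s - (-(M : ℝ) + l / K)) *
      (eLpNorm (iteratedDeriv (j + 1) (sobolevEmb k δ S x)) 2 volume).toReal ≤
      √(1 / K) * ‖(x : SobolevSpace k δ S)‖ := by gcongr
  linarith

/-- Split at |s| = M: outside, the difference of the weights yields e^{-(δ-δ')M}; inside, the
uniform bound by grid values is integrated over an interval of length 2M. -/
theorem eLpNorm_weighted_le_pointValues (hδ' : 0 ≤ δ') (hδ : δ' ≤ δ)
    (x : (testSubmodule S).comap (sobolevEmb k δ S)) {j M K : ℕ} (hK : 0 < K) (hj : j ≤ k')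
    (hk : k' < k) :
    eLpNorm (weighted δ' (iteratedDeriv j (sobolevEmb k δ S x))) 2 volume ≤
      ENNReal.ofReal (Real.exp (-(δ - δ') * M) * ‖(x : SobolevSpace k δ S)‖ +
        √(2 * M) * (Real.exp (δ' * M) * (‖pointValues k k' δ S M K x‖ +
          √(1 / K) * ‖(x : SobolevSpace k δ S)‖))) := by
  have hx : sobolevEmb k δ S x ∈ testSubmodule S := x.2
  have hjet := isSobolevJet_iteratedDeriv (k := k) (δ := δ) hx.1 hx.2.1
  set f := iteratedDeriv j (sobolevEmb k δ S x) with hf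
  have hms : MeasurableSet {s : ℝ | (M : ℝ) < |s|} := (isOpen_abs_gt _).measurableSet
  have hm : MemLp (weighted δ' f) 2 volume := (hjet.mono le_rfl hδ).2.2 j (by omega)
  have e : weighted δ' f = {s : ℝ | (M : ℝ) < |s|}.indicator (weighted δ' f) +
      {s : ℝ | (M : ℝ) < |s|}ᶜ.indicator (weighted δ' f) :=
    (indicator_self_add_compl _ _).symm
  rw [e]
  refine (eLpNorm_add_le (hm.1.indicator hms) (hm.1.indicator hms.compl) (by norm_num)).trans ?_
  rw [ENNReal.ofReal_add (by positivity) (by positivity)]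
  refine add_le_add ?_ ?_
  · rw [ENNReal.ofReal_mul (Real.exp_pos _).le]
    refine le_trans (eLpNorm_le_mul_eLpNorm_of_ae_le_mul (g := weighted δ f)
      (c := Real.exp (-(δ - δ') * M)) (Eventually.of_forall fun s => ?_) 2)
      (mul_le_mul_right (eLpNorm_le_norm_sobolev (x : SobolevSpace k δ S) hjet (by omega)) _)
    by_cases hs : s ∈ {s : ℝ | (M : ℝ) < |s|}
    · rw [indicator_of_mem hs, weighted, weighted, norm_smul, norm_smul, Real.norm_eq_abs,
        Real.norm_eq_abs, Real.abs_exp, Real.abs_exp, ← mul_assoc, ← Real.exp_add]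
      gcongr
      have hs : (M : ℝ) < |s| := hs
      nlinarith
    · rw [indicator_of_notMem hs, norm_zero]
      positivity
  · refine eLpNorm_le_of_abs_gt (Nat.cast_nonneg M) (Eventually.of_forall fun s hs => ?_)
      (Eventually.of_forall fun s hs => ?_)
    · exact indicator_of_notMem (not_not_intro hs) _
    · rw [indicator_of_mem (by simpa using hs), weighted, norm_smul, Real.norm_eq_abs, Real.abs_exp]
      gcongr
      exact norm_iteratedDeriv_le_pointValues (hδ'.trans hδ) x hK hj hk hs

theorem isCompactOperator_sobolevIncl (hk' : 1 ≤ k') (hk : k' < k) (hδ' : 0 ≤ δ') (hδ : δ' < δ) :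
    IsCompactOperator (sobolevIncl hk.le hδ.le (le_refl S)) := by
  have := completeSpace_sobolev (S := S) hk' hδ'
  refine isCompactOperator_of_ehrling (G := EuclideanSpace ℝ (Fin N)) _
    ((testSubmodule S).comap (sobolevEmb k δ S)) (dense_test (by omega) (hδ'.trans hδ.le))
    fun ε hε => ?_
  -- There are two small terms, the tail and the grid error, and `norm_sobolev_le` contributes the
  -- factor k' + 1. First M is chosen for the tail, then K depending on M.
  set ε₁ := ε / (2 * (k' + 1)) with hε₁
  have hε₁0 : 0 < ε₁ := by positivity
  obtain ⟨M, hM⟩ : ∃ M : ℕ, Real.exp (-(δ - δ') * M) ≤ ε₁ := by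
    have h1 : Tendsto (fun M : ℕ => Real.exp (-(δ - δ') * M)) atTop (𝓝 0) := by
      refine Real.tendsto_exp_atBot.comp ?_
      exact tendsto_natCast_atTop_atTop.const_mul_atTop_of_neg (by linarith)
    exact (h1.eventually_le_const hε₁0).exists
  obtain ⟨K, hK0, hK⟩ : ∃ K : ℕ, 0 < K ∧ √(2 * M) * (Real.exp (δ' * M) * √(1 / K)) ≤ ε₁ := by
    have h1 : Tendsto (fun K : ℕ => √(2 * M) * (Real.exp (δ' * M) * √(1 / (K : ℝ)))) atTop (𝓝 0) := by
      have h2 : Tendsto (fun K : ℕ => √(1 / (K : ℝ))) atTop (𝓝 0) := by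
        have h3 := (Real.continuous_sqrt.tendsto 0).comp tendsto_one_div_atTop_nhds_zero_nat
        rwa [Real.sqrt_zero] at h3
      simpa using (h2.const_mul (Real.exp (δ' * M))).const_mul (√(2 * M))
    obtain ⟨K, h1, h2⟩ := ((eventually_gt_atTop 0).and (h1.eventually_le_const hε₁0)).exists
    exact ⟨K, h1, h2⟩
  refine ⟨_, pointValues k k' δ S M K,
    max 2 ((k' + 1) * (√(2 * M) * Real.exp (δ' * M))), fun x => ?_, fun x => ?_⟩
  · refine (pi_norm_le_iff_of_nonneg (by positivity)).2 fun i => ?_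
    refine (norm_iteratedDeriv_le (hδ'.trans hδ.le) x.2 ?_ _).trans ?_
    · have := (finProdFinEquiv.symm i).1.2
      omega
    · gcongr
      · exact le_max_left _ _
      · rfl
  · have hx : sobolevEmb k δ S x ∈ testSubmodule S := x.2
    have h1 := norm_sobolev_le (sobolevIncl hk.le hδ.le (le_refl S) x)
      (isSobolevJet_iteratedDeriv hx.1 hx.2.1) (by positivity)
      fun j hj => eLpNorm_weighted_le_pointValues hδ' hδ.le x (M := M) hK0 hj hk
    refine h1.trans ?_
    have hX := norm_nonneg (x : SobolevSpace k δ S)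
    have hP := norm_nonneg (pointValues k k' δ S M K x)
    have e1 : Real.exp (-(δ - δ') * M) * ‖(x : SobolevSpace k δ S)‖ ≤ ε₁ * ‖(x : SobolevSpace k δ S)‖ := by
      gcongr
    have e2 : √(2 * M) * (Real.exp (δ' * M) * √(1 / K)) * ‖(x : SobolevSpace k δ S)‖ ≤
        ε₁ * ‖(x : SobolevSpace k δ S)‖ := by gcongr
    calc _ = ((k' : ℝ) + 1) * (Real.exp (-(δ - δ') * M) * ‖(x : SobolevSpace k δ S)‖ +
          √(2 * M) * (Real.exp (δ' * M) * √(1 / K)) * ‖(x : SobolevSpace k δ S)‖) +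
          (k' + 1) * (√(2 * M) * Real.exp (δ' * M)) * ‖pointValues k k' δ S M K x‖ := by ring
      _ ≤ (k' + 1) * (ε₁ * ‖(x : SobolevSpace k δ S)‖ + ε₁ * ‖(x : SobolevSpace k δ S)‖) +
          max 2 ((k' + 1) * (√(2 * M) * Real.exp (δ' * M))) * ‖pointValues k k' δ S M K x‖ := by
        gcongr
        exact le_max_right _ _
      _ = _ := by
        rw [hε₁]
        congr 1
        field_simp
        simp only [Submodule.coe_norm]
        ring

end TestFunctions

/-! ### The scales of vector fields -/

open NormedScale

section Scales

variable {N : ℕ} {δ : ℕ → ℝ} {S S' : Submodule ℝ (EuclideanSpace ℝ (Fin N))}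

theorem isScStructure_pathScale (hδ₀ : δ 0 = 0) (hδ : StrictMono δ) :
    (pathScale δ S).IsScStructure := by
  have h0 : ∀ m, 0 ≤ δ m := fun m => hδ₀ ▸ hδ.monotone (Nat.zero_le m)
  refine ⟨fun m => completeSpace_sobolev (by omega) (h0 m), fun m n hmn => ?_, fun m => ?_⟩
  · exact ⟨sobolevIncl (by omega) (hδ hmn).le le_rfl, fun x => rfl,
      isCompactOperator_sobolevIncl (by omega) (by omega) (h0 m) (hδ hmn)⟩
  · refine (dense_test (S := S) (by omega : 1 ≤ m + 2) (h0 m)).mono fun x hx n => ?_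
    exact ⟨testElt (n + 2) (δ n) ⟨_, hx⟩, rfl⟩

theorem NormedScale.IsScStructure.prod {X Y : Type u} [AddCommGroup X] [Module ℝ X] [AddCommGroup Y]
    [Module ℝ Y] {E : NormedScale X} {F : NormedScale Y} (hE : E.IsScStructure)
    (hF : F.IsScStructure) : (E.prod F).IsScStructure := by
  refine ⟨fun m => ?_, fun m n hmn => ?_, fun m => ?_⟩
  · have := hE.complete m
    have := hF.complete m
    exact inferInstanceAs (CompleteSpace (E.Lvl m × F.Lvl m))
  · obtain ⟨ι, h1, h2⟩ := hE.compact m n hmn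
    obtain ⟨κ, h3, h4⟩ := hF.compact m n hmn
    refine ⟨(ι.prodMap κ : E.Lvl n × F.Lvl n →L[ℝ] E.Lvl m × F.Lvl m),
      fun x => Prod.ext (h1 x.1) (h3 x.2), ?_⟩
    have h5 := (h2.comp_clm (ContinuousLinearMap.fst ℝ (E.Lvl n) (F.Lvl n))).clm_comp
      (ContinuousLinearMap.inl ℝ (E.Lvl m) (F.Lvl m))
    have h6 := (h4.comp_clm (ContinuousLinearMap.snd ℝ (E.Lvl n) (F.Lvl n))).clm_comp
      (ContinuousLinearMap.inr ℝ (E.Lvl m) (F.Lvl m))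
    have h7 := h5.add h6
    exact cast (congrArg IsCompactOperator (funext fun x =>
      Prod.ext (add_zero (ι x.1)) (zero_add (κ x.2)))) h7
  · refine ((hE.dense m).prod (hF.dense m)).mono ?_
    rintro ⟨x, y⟩ ⟨hx, hy⟩ n
    obtain ⟨a, ha⟩ := hx n
    obtain ⟨b, hb⟩ := hy n
    exact ⟨(a, b), Prod.ext ha hb⟩

theorem isScStructure_pathPairScale (hδ₀ : δ 0 = 0) (hδ : StrictMono δ) :
    (pathPairScale δ S S').IsScStructure :=
  (isScStructure_pathScale hδ₀ hδ).prod (isScStructure_pathScale hδ₀ hδ)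

end Scales

/-! ### Products of a moving cut-off function with a translated vector field -/

section ShiftMul

variable {N : ℕ} {k : ℕ} {δ : ℝ} {S : Submodule ℝ (EuclideanSpace ℝ (Fin N))}

/-- The function `s ↦ σ (s - θ R) f (s - η R)`. -/
noncomputable def shiftMul (σ : ℝ → ℝ) (f : ℝ → EuclideanSpace ℝ (Fin N)) (θ η R : ℝ) :
    ℝ → EuclideanSpace ℝ (Fin N) :=
  fun s => σ (s - θ * R) • f (s - η * R)

variable {σ : ℝ → ℝ} {f : ℝ → EuclideanSpace ℝ (Fin N)} {θ η R : ℝ}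

theorem contDiff_shiftMul (hσ : ContDiff ℝ ∞ σ) (hf : ContDiff ℝ ∞ f) :
    ContDiff ℝ ∞ (shiftMul σ f θ η R) :=
  (hσ.comp (contDiff_id.sub contDiff_const)).smul (hf.comp (contDiff_id.sub contDiff_const))

theorem shiftMul_eq_zero {M : ℝ} (hf : ∀ s, M < |s| → f s = 0) {s : ℝ} (hs : M + |η * R| < |s|) :
    shiftMul σ f θ η R s = 0 := by
  rw [shiftMul, hf _ (by linarith [abs_sub_abs_le_abs_sub s (η * R)]), smul_zero]

theorem hasCompactSupport_shiftMul (hf : HasCompactSupport f) :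
    HasCompactSupport (shiftMul σ f θ η R) := by
  obtain ⟨M, -, hM⟩ := hf.exists_abs_gt
  exact hasCompactSupport_of_abs_gt fun s hs => shiftMul_eq_zero hM hs

theorem hasDerivAt_shiftMul (hσ : ContDiff ℝ ∞ σ) (hf : ContDiff ℝ ∞ f) (s : ℝ) :
    HasDerivAt (shiftMul σ f θ η R)
      (shiftMul (deriv σ) f θ η R s + shiftMul σ (deriv f) θ η R s) s := by
  have h1 := ((hσ.differentiable (by simp)) (s - θ * R)).hasDerivAt.comp_sub_const s (θ * R)
  have h2 := ((hf.differentiable (by simp)) (s - η * R)).hasDerivAt.comp_sub_const s (η * R)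
  rw [add_comm]
  exact h1.smul h2

theorem deriv_shiftMul (hσ : ContDiff ℝ ∞ σ) (hf : ContDiff ℝ ∞ f) :
    deriv (shiftMul σ f θ η R) = shiftMul (deriv σ) f θ η R + shiftMul σ (deriv f) θ η R :=
  funext fun s => (hasDerivAt_shiftMul hσ hf s).deriv

theorem iteratedDeriv_succ_shiftMul (hσ : ContDiff ℝ ∞ σ) (hf : ContDiff ℝ ∞ f) (j : ℕ) :
    iteratedDeriv (j + 1) (shiftMul σ f θ η R) =
      iteratedDeriv j (shiftMul (deriv σ) f θ η R) + iteratedDeriv j (shiftMul σ (deriv f) θ η R) := by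
  rw [iteratedDeriv_succ', deriv_shiftMul hσ hf]
  funext s
  exact iteratedDeriv_add
    ((contDiff_shiftMul hσ.deriv_infty hf).of_le (by exact_mod_cast le_top)).contDiffAt
    ((contDiff_shiftMul hσ hf.deriv_infty).of_le (by exact_mod_cast le_top)).contDiffAt

theorem hasDerivAt_shiftMul_param (hσ : ContDiff ℝ ∞ σ) (hf : ContDiff ℝ ∞ f) (s R : ℝ) :
    HasDerivAt (fun R => shiftMul σ f θ η R s)
      (-θ • shiftMul (deriv σ) f θ η R s + -η • shiftMul σ (deriv f) θ η R s) R := by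
  have e : ∀ c : ℝ, HasDerivAt (fun R => s - c * R) (-c) R := fun c => by
    simpa using ((hasDerivAt_id R).const_mul c).const_sub s
  have h1 := HasDerivAt.comp R ((hσ.differentiable (by simp)) (s - θ * R)).hasDerivAt (e θ)
  have h2 := HasDerivAt.scomp R ((hf.differentiable (by simp)) (s - η * R)).hasDerivAt (e η)
  refine (h1.smul h2).congr_deriv ?_
  simp only [shiftMul, Function.comp]
  module

/-- Weighted bounds for the derivatives of `σ (s - θ R) f (s - η R)`. -/
theorem exists_eLpNorm_shiftMul_le (j : ℕ) : ∀ {σ : ℝ → ℝ}, BddDerivs σ → ∀ {Q : Set ℝ},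
    IsClosed Q → (∀ s ∉ Q, σ s = 0) → ∃ C, 0 ≤ C ∧
      ∀ (δ δ' θ η R K B : ℝ) (f : ℝ → EuclideanSpace ℝ (Fin N)), ContDiff ℝ ∞ f → 0 ≤ K → 0 ≤ B →
        (∀ s, s - θ * R ∈ Q → Real.exp (δ * |s|) ≤ K * Real.exp (δ' * |s - η * R|)) →
        (∀ i ≤ j, eLpNorm (weighted δ' (iteratedDeriv i f)) 2 volume ≤ ENNReal.ofReal B) →
        eLpNorm (weighted δ (iteratedDeriv j (shiftMul σ f θ η R))) 2 volume ≤
          ENNReal.ofReal (C * K * B) := by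
  induction j with
  | zero =>
    intro σ hσ Q hQ h0
    obtain ⟨C, hC⟩ := hσ.2 0
    simp only [iteratedDeriv_zero] at hC
    have hC0 : 0 ≤ C := (abs_nonneg _).trans (hC 0)
    refine ⟨C, hC0, fun δ δ' θ η R K B f hf hK hB hQK hfB => ?_⟩
    have h1 : eLpNorm (weighted δ (shiftMul σ f θ η R)) 2 volume ≤
        ENNReal.ofReal (C * K) * eLpNorm (fun s => weighted δ' f (s - η * R)) 2 volume := by
      refine eLpNorm_le_mul_eLpNorm_of_ae_le_mul (Eventually.of_forall fun s => ?_) 2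
      simp only [weighted, shiftMul, norm_smul, Real.norm_eq_abs, Real.abs_exp]
      by_cases hs : s - θ * R ∈ Q
      · calc Real.exp (δ * |s|) * (|σ (s - θ * R)| * ‖f (s - η * R)‖)
            ≤ K * Real.exp (δ' * |s - η * R|) * (C * ‖f (s - η * R)‖) := by
              gcongr
              · exact hQK s hs
              · exact hC _
          _ = _ := by ring
      · rw [h0 _ hs]
        simp only [abs_zero, zero_mul, mul_zero]
        positivity
    have h2 : eLpNorm (fun s => weighted δ' f (s - η * R)) 2 volume =
        eLpNorm (weighted δ' f) 2 volume :=
      eLpNorm_comp_measurePreserving (((continuous_weight δ').smul hf.continuous).aestronglyMeasurable)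
        (measurePreserving_sub_right volume (η * R))
    rw [iteratedDeriv_zero, ENNReal.ofReal_mul (by positivity)]
    refine h1.trans ?_
    rw [h2]
    gcongr
    simpa using hfB 0 le_rfl
  | succ j ih =>
    intro σ hσ Q hQ h0
    have h0' : ∀ s ∉ Q, deriv σ s = 0 := fun s hs =>
      deriv_eq_zero_of_isOpen hQ.isOpen_compl (fun s hs => h0 s hs) _ hs
    obtain ⟨C₁, hC₁, h₁⟩ := ih hσ.deriv hQ h0'
    obtain ⟨C₂, hC₂, h₂⟩ := ih hσ hQ h0
    refine ⟨C₁ + C₂, by positivity, fun δ δ' θ η R K B f hf hK hB hQK hfB => ?_⟩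
    rw [iteratedDeriv_succ_shiftMul hσ.1 hf, weighted_add]
    have hm : ∀ {σ : ℝ → ℝ} {f : ℝ → EuclideanSpace ℝ (Fin N)}, ContDiff ℝ ∞ σ → ContDiff ℝ ∞ f →
        AEStronglyMeasurable (weighted δ (iteratedDeriv j (shiftMul σ f θ η R))) volume :=
      fun h h' => ((continuous_weight δ).smul
        ((contDiff_shiftMul h h').iteratedDeriv_infty j).continuous).aestronglyMeasurable
    refine (eLpNorm_add_le (hm hσ.1.deriv_infty hf) (hm hσ.1 hf.deriv_infty) (by norm_num)).trans ?_
    rw [add_mul, add_mul, ENNReal.ofReal_add (by positivity) (by positivity)]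
    refine add_le_add (h₁ _ _ _ _ _ _ _ f hf hK hB hQK fun i hi => hfB i (by omega))
      (h₂ _ _ _ _ _ _ _ _ hf.deriv_infty hK hB hQK fun i hi => ?_)
    rw [← iteratedDeriv_succ']
    exact hfB (i + 1) (by omega)

theorem exists_norm_shiftMul_le (hσ : BddDerivs σ) (hf : ContDiff ℝ ∞ f) (hfc : HasCompactSupport f) :
    ∃ C, 0 ≤ C ∧ ∀ R s, ‖shiftMul σ f θ η R s‖ ≤ C := by
  obtain ⟨C₁, h₁⟩ := hσ.2 0
  obtain ⟨C₂, h₂⟩ := hfc.exists_bound_of_continuous hf.continuous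
  simp only [iteratedDeriv_zero] at h₁
  have h0 : 0 ≤ C₁ := (abs_nonneg _).trans (h₁ 0)
  have h0' : 0 ≤ C₂ := (norm_nonneg _).trans (h₂ 0)
  refine ⟨C₁ * C₂, by positivity, fun R s => ?_⟩
  rw [shiftMul, norm_smul, Real.norm_eq_abs]
  gcongr
  · exact h₁ _
  · exact h₂ _

theorem exists_norm_shiftMul_sub_le (hσ : BddDerivs σ) (hf : ContDiff ℝ ∞ f)
    (hfc : HasCompactSupport f) :
    ∃ C, 0 ≤ C ∧ ∀ R R' s, ‖shiftMul σ f θ η R' s - shiftMul σ f θ η R s‖ ≤ C * |R' - R| := by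
  obtain ⟨C₁, h1, h₁⟩ := exists_norm_shiftMul_le (θ := θ) (η := η) hσ.deriv hf hfc
  obtain ⟨C₂, h2, h₂⟩ := exists_norm_shiftMul_le (θ := θ) (η := η) hσ hf.deriv_infty hfc.deriv
  refine ⟨|θ| * C₁ + |η| * C₂, by positivity, fun R R' s => ?_⟩
  refine convex_univ.norm_image_sub_le_of_norm_hasDerivWithin_le
    (fun x _ => (hasDerivAt_shiftMul_param hσ.1 hf s x).hasDerivWithinAt) (fun x _ => ?_)
    (mem_univ R) (mem_univ R')
  refine (norm_add_le _ _).trans ?_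
  rw [norm_smul, norm_smul, norm_neg, norm_neg, Real.norm_eq_abs, Real.norm_eq_abs]
  gcongr
  · exact h₁ _ _
  · exact h₂ _ _

/-- The remainder of the first order expansion of `shiftMul σ f θ η` at `R`. -/
noncomputable def shiftMulRem (σ : ℝ → ℝ) (f : ℝ → EuclideanSpace ℝ (Fin N)) (θ η R R' : ℝ) :
    ℝ → EuclideanSpace ℝ (Fin N) :=
  shiftMul σ f θ η R' + (-1 : ℝ) • shiftMul σ f θ η R +
    (-(R' - R)) • (-θ • shiftMul (deriv σ) f θ η R + -η • shiftMul σ (deriv f) θ η R)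

/-- The mean value inequality for x ↦ shiftMul(x) - (x - R)D(R), whose derivative D(x) - D(R) is
Lipschitz in x uniformly in s. -/
theorem exists_norm_shiftMulRem_le (hσ : BddDerivs σ) (hf : ContDiff ℝ ∞ f)
    (hfc : HasCompactSupport f) :
    ∃ C, 0 ≤ C ∧ ∀ R R' s, ‖shiftMulRem σ f θ η R R' s‖ ≤ C * |R' - R| ^ 2 := by
  obtain ⟨C₁, h1, h₁⟩ := exists_norm_shiftMul_sub_le (θ := θ) (η := η) hσ.deriv hf hfc
  obtain ⟨C₂, h2, h₂⟩ := exists_norm_shiftMul_sub_le (θ := θ) (η := η) hσ hf.deriv_infty hfc.deriv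
  refine ⟨|θ| * C₁ + |η| * C₂, by positivity, fun R R' s => ?_⟩
  set D := fun R => -θ • shiftMul (deriv σ) f θ η R s + -η • shiftMul σ (deriv f) θ η R s with hD
  have hd : ∀ x ∈ Metric.closedBall R |R' - R|, HasDerivWithinAt
      (fun x => shiftMul σ f θ η x s - (x - R) • D R) (D x - D R) (Metric.closedBall R |R' - R|) x :=
    fun x _ => by
      have h3 := ((hasDerivAt_id x).sub_const R).smul_const (D R)
      rw [one_smul] at h3
      exact ((hasDerivAt_shiftMul_param hσ.1 hf s x).sub h3).hasDerivWithinAt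
  have h := (convex_closedBall R |R' - R|).norm_image_sub_le_of_norm_hasDerivWithin_le
    (C := (|θ| * C₁ + |η| * C₂) * |R' - R|) hd (fun x hx => ?_)
    (Metric.mem_closedBall_self (abs_nonneg _)) (y := R') (by simp [Real.dist_eq])
  · rw [Real.norm_eq_abs, mul_assoc, ← sq] at h
    refine le_trans (le_of_eq ?_) h
    congr 1
    simp only [shiftMulRem, Pi.add_apply, Pi.smul_apply, hD]
    module
  · have hx : |x - R| ≤ |R' - R| := by simpa [Real.dist_eq] using hx
    have e : D x - D R = -θ • (shiftMul (deriv σ) f θ η x s - shiftMul (deriv σ) f θ η R s) +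
        -η • (shiftMul σ (deriv f) θ η x s - shiftMul σ (deriv f) θ η R s) := by
      simp only [hD]
      module
    rw [e]
    refine (norm_add_le _ _).trans ?_
    rw [norm_smul, norm_smul, norm_neg, norm_neg, Real.norm_eq_abs, Real.norm_eq_abs, add_mul,
      mul_assoc, mul_assoc]
    gcongr
    · exact (h₁ _ _ _).trans (by gcongr)
    · exact (h₂ _ _ _).trans (by gcongr)

theorem contDiff_shiftMulRem (hσ : ContDiff ℝ ∞ σ) (hf : ContDiff ℝ ∞ f) (R R' : ℝ) :
    ContDiff ℝ ∞ (shiftMulRem σ f θ η R R') :=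
  ((contDiff_shiftMul hσ hf).add (contDiff_const.smul (contDiff_shiftMul hσ hf))).add
    (contDiff_const.smul ((contDiff_const.smul (contDiff_shiftMul hσ.deriv_infty hf)).add
      (contDiff_const.smul (contDiff_shiftMul hσ hf.deriv_infty))))

/-- For |R' - R| ≤ 1 all remainders live in one bounded set, which turns uniform bounds into
weighted L² bounds. -/
theorem shiftMulRem_eq_zero {M : ℝ} (hf : ∀ s, M < |s| → f s = 0) (hf' : ∀ s, M < |s| → deriv f s = 0)
    {R' s : ℝ} (hR : |R' - R| ≤ 1) (hs : M + |η| * (|R| + 1) < |s|) :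
    shiftMulRem σ f θ η R R' s = 0 := by
  have hR' : |R'| ≤ |R| + 1 := by linarith [abs_sub_abs_le_abs_sub R' R]
  have h1 : M + |η * R| < |s| := by
    rw [abs_mul]
    nlinarith [abs_nonneg η]
  have h2 : M + |η * R'| < |s| := by
    rw [abs_mul]
    nlinarith [abs_nonneg η]
  simp [shiftMulRem, shiftMul_eq_zero hf h1, shiftMul_eq_zero hf h2, shiftMul_eq_zero hf' h1]

theorem deriv_shiftMulRem (hσ : ContDiff ℝ ∞ σ) (hf : ContDiff ℝ ∞ f) (R R' : ℝ) :
    deriv (shiftMulRem σ f θ η R R') =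
      shiftMulRem (deriv σ) f θ η R R' + shiftMulRem σ (deriv f) θ η R R' := by
  funext s
  have h1 := hasDerivAt_shiftMul (θ := θ) (η := η) (R := R') hσ hf s
  have h2 := hasDerivAt_shiftMul (θ := θ) (η := η) (R := R) hσ hf s
  have h3 := hasDerivAt_shiftMul (θ := θ) (η := η) (R := R) hσ.deriv_infty hf s
  have h4 := hasDerivAt_shiftMul (θ := θ) (η := η) (R := R) hσ hf.deriv_infty s
  have h := ((h1.add (h2.const_smul (-1 : ℝ))).add
    (((h3.const_smul (-θ)).add (h4.const_smul (-η))).const_smul (-(R' - R)))).deriv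
  refine h.trans ?_
  simp only [shiftMulRem, Pi.add_apply, Pi.smul_apply]
  module

theorem exists_eLpNorm_shiftMulRem_le (δ R : ℝ) (j : ℕ) : ∀ {σ : ℝ → ℝ}
    {f : ℝ → EuclideanSpace ℝ (Fin N)}, BddDerivs σ → ContDiff ℝ ∞ f → HasCompactSupport f →
    ∃ C, 0 ≤ C ∧ ∀ R', |R' - R| ≤ 1 →
      eLpNorm (weighted δ (iteratedDeriv j (shiftMulRem σ f θ η R R'))) 2 volume ≤
        ENNReal.ofReal (C * |R' - R| ^ 2) := by
  induction j with
  | zero =>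
    intro σ f hσ hf hfc
    obtain ⟨C, hC0, hC⟩ := exists_norm_shiftMulRem_le (θ := θ) (η := η) hσ hf hfc
    obtain ⟨M, hM0, hM⟩ := hfc.exists_abs_gt
    have hM' : ∀ s, M < |s| → deriv f s = 0 := fun s hs =>
      deriv_eq_zero_of_isOpen (isOpen_abs_gt M) hM _ hs
    set L := M + |η| * (|R| + 1) with hL
    have hL0 : 0 ≤ L := by positivity
    refine ⟨√(2 * L) * (Real.exp (|δ| * L) * C), by positivity, fun R' hR => ?_⟩
    have h1 := eLpNorm_le_of_abs_gt (f := weighted δ (shiftMulRem σ f θ η R R')) hL0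
      (c := Real.exp (|δ| * L) * (C * |R' - R| ^ 2)) (Eventually.of_forall fun s hs => by
        rw [weighted, shiftMulRem_eq_zero hM hM' hR hs, smul_zero])
      (Eventually.of_forall fun s hs => by
        rw [weighted, norm_smul, Real.norm_eq_abs, Real.abs_exp]
        gcongr
        · exact le_abs_self δ
        · exact hC _ _ _)
    rw [iteratedDeriv_zero]
    refine h1.trans (ENNReal.ofReal_le_ofReal (le_of_eq ?_))
    ring
  | succ j ih =>
    intro σ f hσ hf hfc
    obtain ⟨C₁, hC₁, h₁⟩ := ih hσ.deriv hf hfc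
    obtain ⟨C₂, hC₂, h₂⟩ := ih hσ hf.deriv_infty hfc.deriv
    refine ⟨C₁ + C₂, by positivity, fun R' hR => ?_⟩
    have e : iteratedDeriv (j + 1) (shiftMulRem σ f θ η R R') =
        iteratedDeriv j (shiftMulRem (deriv σ) f θ η R R') +
          iteratedDeriv j (shiftMulRem σ (deriv f) θ η R R') := by
      rw [iteratedDeriv_succ', deriv_shiftMulRem hσ.1 hf]
      funext s
      exact iteratedDeriv_add
        ((contDiff_shiftMulRem hσ.1.deriv_infty hf R R').of_le (by exact_mod_cast le_top)).contDiffAt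
        ((contDiff_shiftMulRem hσ.1 hf.deriv_infty R R').of_le (by exact_mod_cast le_top)).contDiffAt
    have hm : ∀ {σ : ℝ → ℝ} {f : ℝ → EuclideanSpace ℝ (Fin N)}, ContDiff ℝ ∞ σ → ContDiff ℝ ∞ f →
        AEStronglyMeasurable (weighted δ (iteratedDeriv j (shiftMulRem σ f θ η R R'))) volume :=
      fun h h' => ((continuous_weight δ).smul
        ((contDiff_shiftMulRem h h' R R').iteratedDeriv_infty j).continuous).aestronglyMeasurable
    rw [e, weighted_add]
    refine (eLpNorm_add_le (hm hσ.1.deriv_infty hf) (hm hσ.1 hf.deriv_infty) (by norm_num)).trans ?_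
    rw [add_mul, ENNReal.ofReal_add (by positivity) (by positivity)]
    exact add_le_add (h₁ R' hR) (h₂ R' hR)

/-- Derivatives in s of a remainder are sums of remainders of the same kind, so every order is O(|R'
- R|²) in weighted L², and hence so is the Sobolev norm. -/
theorem hasDerivAt_of_sobolevEmb_eq_shiftMul (hσ : BddDerivs σ) (hf : ContDiff ℝ ∞ f)
    (hfc : HasCompactSupport f) {c : ℝ → SobolevSpace k δ S} {c' : SobolevSpace k δ S}
    (hc : ∀ R, sobolevEmb k δ S (c R) = shiftMul σ f θ η R)
    (hc' : sobolevEmb k δ S c' =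
      -θ • shiftMul (deriv σ) f θ η R + -η • shiftMul σ (deriv f) θ η R) :
    HasDerivAt c c' R := by
  have h1 : ∀ j, ∃ C, 0 ≤ C ∧ ∀ R', |R' - R| ≤ 1 →
      eLpNorm (weighted δ (iteratedDeriv j (shiftMulRem σ f θ η R R'))) 2 volume ≤
        ENNReal.ofReal (C * |R' - R| ^ 2) := fun j => exists_eLpNorm_shiftMulRem_le δ R j hσ hf hfc
  choose C hC0 hC using h1
  set B := ∑ j ∈ Finset.range (k + 1), C j with hB
  have hB0 : 0 ≤ B := Finset.sum_nonneg fun j _ => hC0 j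
  have h2 : ∀ R', |R' - R| ≤ 1 → ‖c R' - c R - (R' - R) • c'‖ ≤ (k + 1) * (B * |R' - R| ^ 2) := by
    intro R' hR
    have e : sobolevEmb k δ S (c R' - c R - (R' - R) • c') = shiftMulRem σ f θ η R R' := by
      rw [map_sub, map_sub, map_smul, hc, hc, hc', shiftMulRem]
      module
    have hcs : HasCompactSupport (shiftMulRem σ f θ η R R') :=
      ((hasCompactSupport_shiftMul hfc).add (hasCompactSupport_shiftMul hfc).smul_left).add
        ((HasCompactSupport.add (hasCompactSupport_shiftMul hfc).smul_left
          (hasCompactSupport_shiftMul hfc.deriv).smul_left).smul_left)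
    refine norm_sobolev_le _ (w := fun j => iteratedDeriv j (shiftMulRem σ f θ η R R')) ?_
      (by positivity) fun j hj => (hC j R' hR).trans ?_
    · rw [e]
      exact isSobolevJet_iteratedDeriv (contDiff_shiftMulRem hσ.1 hf R R') hcs
    · gcongr
      exact Finset.single_le_sum (f := C) (fun j _ => hC0 j) (Finset.mem_range.2 (by omega))
  rw [hasDerivAt_iff_isLittleO]
  have h3 : (fun R' => c R' - c R - (R' - R) • c') =O[𝓝 R] fun R' => (R' - R) ^ 2 := by
    refine Asymptotics.IsBigO.of_bound ((k + 1) * B) ?_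
    filter_upwards [Metric.closedBall_mem_nhds R one_pos] with R' hR
    refine (h2 R' (by simpa [Real.dist_eq] using hR)).trans (le_of_eq ?_)
    rw [norm_pow, Real.norm_eq_abs, mul_assoc]
  refine h3.trans_isLittleO ?_
  have h4 := Asymptotics.isLittleO_pow_id (𝕜 := ℝ) one_lt_two
  have h5 := h4.comp_tendsto (k := fun R' => R' - R) (l' := 𝓝 R) (by
    simpa using (by fun_prop : Continuous fun R' : ℝ => R' - R).tendsto R)
  exact h5

end ShiftMul

/-! ### The gluing profile -/

section Profile

/-- The finite values of the gluing profile. -/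
noncomputable def profile (r : ℝ) : ℝ := Real.exp r⁻¹ - Real.exp 1

theorem hasDerivAt_profile {r : ℝ} (hr : r ≠ 0) :
    HasDerivAt profile (-(r⁻¹ ^ 2 * Real.exp r⁻¹)) r := by
  refine ((hasDerivAt_inv hr).exp.sub_const (Real.exp 1)).congr_deriv ?_
  rw [inv_pow]
  ring

theorem profile_pos {r : ℝ} (h0 : 0 < r) (h1 : r < 1) : 0 < profile r :=
  sub_pos.2 (Real.exp_lt_exp.2 ((one_lt_inv₀ h0).2 h1))

theorem exists_lt_profile (K : ℝ) : ∃ ε > 0, ∀ r, 0 < r → r < ε → K < profile r := by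
  have h1 : Tendsto profile (𝓝[>] 0) atTop :=
    tendsto_atTop_add_const_right _ _ (Real.tendsto_exp_atTop.comp tendsto_inv_nhdsGT_zero)
  obtain ⟨ε, hε, h⟩ := mem_nhdsGT_iff_exists_Ioo_subset.1 (h1.eventually_gt_atTop K)
  exact ⟨ε, hε, fun r h0 h1 => h ⟨h0, h1⟩⟩

/-- The function `r ↦ r^{-a} e^{b/r}`. -/
noncomputable def profileCoeff (a b : ℕ) (r : ℝ) : ℝ := r⁻¹ ^ a * Real.exp (b * r⁻¹)

theorem hasDerivAt_profileCoeff (a b : ℕ) {r : ℝ} (hr : r ≠ 0) :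
    HasDerivAt (profileCoeff a b)
      (-a * profileCoeff (a + 1) b r + -b * profileCoeff (a + 2) b r) r := by
  have h1 := (hasDerivAt_inv hr).pow a
  have h2 := ((hasDerivAt_inv hr).const_mul (b : ℝ)).exp
  refine (h1.mul h2).congr_deriv ?_
  simp only [profileCoeff, ← inv_pow]
  cases a with
  | zero => simp; ring
  | succ a => simp; ring

/-- As φ'(r) = -r^{-2}e^{1/r}, the chain rule stays within the functions r^{-a}e^{b/r}. -/
theorem profileCoeff_mul_exp (a b : ℕ) (r : ℝ) :
    profileCoeff a b r * (r⁻¹ ^ 2 * Real.exp r⁻¹) = profileCoeff (a + 2) (b + 1) r := by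
  simp only [profileCoeff, pow_add, Nat.cast_add, Nat.cast_one, add_mul, one_mul, Real.exp_add]
  ring

/-- With x = 1/r, the coefficient is at most e^{(a+b)x} and κφ(r) ≥ κx²/2 - κe; the quadratic (a+b)x
- κx²/2 is at most (a+b)²/(2κ). Without any decay, κ = 0, only the trivial coefficient is allowed.
-/
theorem exists_profileCoeff_mul_exp_le {a b : ℕ} {κ : ℝ} (hκ : 0 ≤ κ)
    (h : 0 < κ ∨ a = 0 ∧ b = 0) :
    ∃ C, 0 ≤ C ∧ ∀ r, 0 < r → r < 1 → profileCoeff a b r * Real.exp (-(κ * profile r)) ≤ C := by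
  rcases h with hκ | ⟨rfl, rfl⟩
  · refine ⟨Real.exp ((a + b) ^ 2 / (2 * κ) + κ * Real.exp 1), (Real.exp_pos _).le,
      fun r h0 h1 => ?_⟩
    have hx : 0 ≤ r⁻¹ := (inv_pos.2 h0).le
    have e1 : r⁻¹ ^ a ≤ Real.exp (a * r⁻¹) := by
      rw [Real.exp_nat_mul]
      gcongr
      linarith [Real.add_one_le_exp r⁻¹]
    calc profileCoeff a b r * Real.exp (-(κ * profile r))
        ≤ Real.exp (a * r⁻¹) * Real.exp (b * r⁻¹) * Real.exp (-(κ * profile r)) := by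
          rw [profileCoeff]; gcongr
      _ = Real.exp ((a + b) * r⁻¹ - κ * Real.exp r⁻¹ + κ * Real.exp 1) := by
          rw [← Real.exp_add, ← Real.exp_add, profile]
          congr 1
          ring
      _ ≤ _ := by
          rw [Real.exp_le_exp]
          have e2 := Real.quadratic_le_exp_of_nonneg hx
          have e3 : κ * (r⁻¹ ^ 2 / 2) ≤ κ * Real.exp r⁻¹ := by gcongr; linarith
          have e4 : ((a : ℝ) + b) * r⁻¹ - κ * (r⁻¹ ^ 2 / 2) ≤ (a + b) ^ 2 / (2 * κ) := by
            rw [le_div_iff₀ (by positivity)]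
            nlinarith [sq_nonneg (κ * r⁻¹ - (a + b))]
          linarith
  · refine ⟨1, zero_le_one, fun r h0 h1 => ?_⟩
    simp only [profileCoeff, pow_zero, CharP.cast_eq_zero, zero_mul, Real.exp_zero, one_mul]
    rw [Real.exp_le_one_iff]
    nlinarith [profile_pos h0 h1]

end Profile

/-! ### The smooth families entering the splicing -/

section Moving

variable {N : ℕ} {k k' : ℕ} {δ δ' : ℝ} {S S' : Submodule ℝ (EuclideanSpace ℝ (Fin N))}

/-- The map `f ↦ r^{-a} e^{b/r} σ(s - θ φ(r)) D^i f(s - η φ(r))`, vanishing for `r = 0`. -/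
noncomputable def movingTerm (S : Submodule ℝ (EuclideanSpace ℝ (Fin N))) (a b i : ℕ) (σ : ℝ → ℝ)
    (θ η r : ℝ) : testSubmodule S →ₗ[ℝ] (ℝ → EuclideanSpace ℝ (Fin N)) where
  toFun f := if r = 0 then 0 else
    profileCoeff a b r • shiftMul σ (iteratedDeriv i f) θ η (profile r)
  map_add' f g := by
    split_ifs
    · rw [add_zero]
    · funext s
      have h := iteratedDeriv_add (n := i) (x := s - η * profile r)
        (f.2.1.of_le (by exact_mod_cast le_top)).contDiffAt
        (g.2.1.of_le (by exact_mod_cast le_top)).contDiffAt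
      simp only [Pi.smul_apply, Pi.add_apply, shiftMul, Submodule.coe_add, h]
      module
  map_smul' c f := by
    split_ifs
    · rw [smul_zero]
    · funext s
      have h : iteratedDeriv i (c • (f : ℝ → EuclideanSpace ℝ (Fin N))) (s - η * profile r) =
        c • iteratedDeriv i f (s - η * profile r) := iteratedDeriv_const_smul_field _ _
      simp only [Pi.smul_apply, shiftMul, Submodule.coe_smul, h, RingHom.id_apply]
      module

variable {a b i j : ℕ} {σ : ℝ → ℝ} {θ η r : ℝ}

theorem movingTerm_zero (f : testSubmodule S) : movingTerm S a b i σ θ η 0 f = 0 := if_pos rfl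

theorem movingTerm_of_ne (hr : r ≠ 0) (f : testSubmodule S) : movingTerm S a b i σ θ η r f =
    profileCoeff a b r • shiftMul σ (iteratedDeriv i f) θ η (profile r) := if_neg hr

/-- Sums of moving terms which lose at most `j` levels. -/
inductive MovingFam (S S' : Submodule ℝ (EuclideanSpace ℝ (Fin N))) :
    ℕ → (ℝ → testSubmodule S →ₗ[ℝ] (ℝ → EuclideanSpace ℝ (Fin N))) → Prop
  -- The conditions |θ| = |θ - η| = 1/2 put both |s| and |s - ηR| within 1 of R/2 on the support of
  -- the cut-off, for R ≥ 0. A singular prefactor is permitted only when at least one level is lost.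
  | term (j a b i : ℕ) (σ : ℝ → ℝ) (θ η : ℝ) (hσ : BddDerivs σ) (h0 : ∀ s ∉ Icc (-1 : ℝ) 1, σ s = 0)
      (hθ : |θ| = 1 / 2) (hη : |θ - η| = 1 / 2) (hi : i ≤ j) (hj : j = 0 → a = 0 ∧ b = 0) :
      MovingFam S S' j (movingTerm S a b i σ θ η)
  -- Here f is not translated and σ need not be localized, only σ'. The condition on θ * s says that
  -- σ vanishes on the side towards which the argument s - θR escapes as R → ∞.
  | diag (σ : ℝ → ℝ) (θ : ℝ) (hσ : BddDerivs σ) (h0 : ∀ s ∉ Icc (-1 : ℝ) 1, deriv σ s = 0)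
      (hθ : |θ| = 1 / 2) (h1 : ∀ s, θ * s < -(1 / 2) → σ s = 0) (hS : S ≤ S') :
      MovingFam S S' 0 (movingTerm S 0 0 0 σ θ 0)
  | add (j : ℕ) (T T' : ℝ → testSubmodule S →ₗ[ℝ] (ℝ → EuclideanSpace ℝ (Fin N))) :
      MovingFam S S' j T → MovingFam S S' j T' → MovingFam S S' j (fun r => T r + T' r)
  | smul (j : ℕ) (c : ℝ) (T : ℝ → testSubmodule S →ₗ[ℝ] (ℝ → EuclideanSpace ℝ (Fin N))) :
      MovingFam S S' j T → MovingFam S S' j (fun r => c • T r)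

theorem shiftMul_mem_testSubmodule {R : ℝ} (hσ : ContDiff ℝ ∞ σ) (f : testSubmodule S)
    (h : shiftMul σ (iteratedDeriv i f) θ η R 0 ∈ S') :
    shiftMul σ (iteratedDeriv i f) θ η R ∈ testSubmodule S' :=
  ⟨contDiff_shiftMul hσ (f.2.1.iteratedDeriv_infty i),
    hasCompactSupport_shiftMul (f.2.2.1.iteratedDeriv' i), h⟩

/-- At s = 0 the argument of the cut-off has modulus R/2, which exceeds 1 when R > 2; this is the
origin of the restriction φ(r) > 2. -/
theorem shiftMul_zero_mem (h0 : ∀ s ∉ Icc (-1 : ℝ) 1, σ s = 0) (hθ : |θ| = 1 / 2) {R : ℝ}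
    (hS : S' = ⊤ ∨ 2 < R) (f : ℝ → EuclideanSpace ℝ (Fin N)) : shiftMul σ f θ η R 0 ∈ S' := by
  rcases hS with rfl | hS
  · trivial
  · rw [shiftMul, h0, zero_smul]
    · exact S'.zero_mem
    · rw [mem_Icc, ← abs_le, not_le, zero_sub, abs_neg, abs_mul, hθ, abs_of_pos (by linarith)]
      linarith

theorem MovingFam.mem {T : ℝ → testSubmodule S →ₗ[ℝ] (ℝ → EuclideanSpace ℝ (Fin N))}
    (hT : MovingFam S S' j T) (hr : r ≠ 0 → S' = ⊤ ∨ 2 < profile r) (f : testSubmodule S) :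
    T r f ∈ testSubmodule S' := by
  induction hT with
  | term j a b i σ θ η hσ h0 hθ hη hi hj =>
    by_cases h : r = 0
    · rw [h, movingTerm_zero]
      exact zero_mem _
    · rw [movingTerm_of_ne h]
      exact Submodule.smul_mem _ _
        (shiftMul_mem_testSubmodule hσ.1 f (shiftMul_zero_mem h0 hθ (hr h) _))
  | diag σ θ hσ h0 hθ h1 hS =>
    by_cases h : r = 0
    · rw [h, movingTerm_zero]
      exact zero_mem _
    · rw [movingTerm_of_ne h]
      refine Submodule.smul_mem _ _ (shiftMul_mem_testSubmodule hσ.1 f ?_)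
      simp only [shiftMul, iteratedDeriv_zero, zero_mul, sub_zero]
      exact S'.smul_mem _ (hS f.2.2.2)
  | add j T T' _ _ h h' => exact add_mem h h'
  | smul j c T _ h => exact Submodule.smul_mem _ _ h

/-! #### Bounds -/

theorem exists_norm_le_of_emb_eq_shiftMul (hσ : BddDerivs σ) {Q : Set ℝ} (hQ : IsClosed Q)
    (h0 : ∀ s ∉ Q, σ s = 0) (hk : k + i ≤ k') : ∃ C, 0 ≤ C ∧ ∀ (δ δ' θ η R K : ℝ), 0 ≤ K →
      (∀ s, s - θ * R ∈ Q → Real.exp (δ * |s|) ≤ K * Real.exp (δ' * |s - η * R|)) →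
      ∀ x : SobolevSpace k' δ' S, sobolevEmb k' δ' S x ∈ testSubmodule S →
      ∀ y : SobolevSpace k δ S',
        sobolevEmb k δ S' y = shiftMul σ (iteratedDeriv i (sobolevEmb k' δ' S x)) θ η R →
        ‖y‖ ≤ C * K * ‖x‖ := by
  choose C hC0 hC using fun j => exists_eLpNorm_shiftMul_le (N := N) j hσ hQ h0
  have hB0 : 0 ≤ ∑ j ∈ Finset.range (k + 1), C j := Finset.sum_nonneg fun j _ => hC0 j
  refine ⟨(k + 1) * ∑ j ∈ Finset.range (k + 1), C j, by positivity,
    fun δ δ' θ η R K hK hQK x hx y hy => ?_⟩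
  have hf := hx.1.iteratedDeriv_infty i
  have hjet := isSobolevJet_iteratedDeriv (k := k) (δ := δ) (contDiff_shiftMul hσ.1 hf (θ := θ)
    (η := η) (R := R)) (hasCompactSupport_shiftMul (hx.2.1.iteratedDeriv' i))
  rw [← hy] at hjet
  have h1 := norm_sobolev_le y hjet (c := (∑ j ∈ Finset.range (k + 1), C j) * K * ‖x‖) (by positivity)
    fun j hj => by
      rw [hy]
      refine (hC j δ δ' θ η R K ‖x‖ _ hf hK (norm_nonneg _) hQK fun l hl => ?_).trans ?_
      · have h2 := eLpNorm_le_norm_sobolev x (isSobolevJet_iteratedDeriv hx.1 hx.2.1)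
          (j := l + i) (by omega)
        have e : iteratedDeriv l (iteratedDeriv i (sobolevEmb k' δ' S x)) =
            iteratedDeriv (l + i) (sobolevEmb k' δ' S x) := by
          simp only [iteratedDeriv_eq_iterate, Function.iterate_add_apply]
        rwa [e]
      · gcongr
        exact Finset.single_le_sum (f := C) (fun j _ => hC0 j) (Finset.mem_range.2 (by omega))
  refine h1.trans (le_of_eq ?_)
  ring

/-- For localized terms the gap between the weights yields e^{-(δ'-δ)R/2}, which absorbs the
singular prefactor. When j = 0 there is no prefactor and equal weights suffice; this also covers the
unshifted terms. -/
theorem MovingFam.bound {T : ℝ → testSubmodule S →ₗ[ℝ] (ℝ → EuclideanSpace ℝ (Fin N))} {V : Set ℝ}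
    (hT : MovingFam S S' j T) (hV : V ⊆ Ico 0 1)
    (hS : ∀ r ∈ V, r ≠ 0 → S' = ⊤ ∨ 2 < profile r) (hk : k + j ≤ k')
    (hδ0 : 0 ≤ δ) (hδ : δ ≤ δ') (hδj : j ≠ 0 → δ < δ') :
    ∃ C, 0 ≤ C ∧ ∀ r ∈ V, ∀ (f : testSubmodule S) (x : SobolevSpace k' δ' S),
      sobolevEmb k' δ' S x = f → ∃ y : SobolevSpace k δ S', sobolevEmb k δ S' y = T r f ∧
        ‖y‖ ≤ C * ‖x‖ := by
  induction hT with
  | term j a b i σ θ η hσ h0 hθ hη hi hj =>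
    obtain ⟨C, hC0, hC⟩ := exists_norm_le_of_emb_eq_shiftMul (S := S) (S' := S') hσ isClosed_Icc h0
      (by omega : k + i ≤ k')
    obtain ⟨B, hB0, hB⟩ := exists_profileCoeff_mul_exp_le (a := a) (b := b) (κ := (δ' - δ) / 2)
      (by linarith) (by
        by_cases h : j = 0
        · exact Or.inr (hj h)
        · exact Or.inl (by linarith [hδj h]))
    refine ⟨C * Real.exp (δ + δ') * B, by positivity, fun r hr f x hx => ?_⟩
    by_cases h : r = 0
    · refine ⟨0, ?_, by simp; positivity⟩
      rw [h, movingTerm_zero, map_zero]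
    have hr0 : 0 < r := lt_of_le_of_ne (hV hr).1 (Ne.symm h)
    have hR := profile_pos hr0 (hV hr).2
    set R := profile r with hRdef
    let y : SobolevSpace k δ S' := testElt k δ
      ⟨_, shiftMul_mem_testSubmodule (θ := θ) (η := η) (i := i) (R := R) hσ.1 f
        (shiftMul_zero_mem h0 hθ (hS r hr h) _)⟩
    -- On the support |s| ≤ 1 + R/2 and |s - ηR| ≥ R/2 - 1, so δ|s| - δ'|s - ηR| ≤ δ + δ' - (δ' -
    -- δ)R/2.
    have hy := hC δ δ' θ η R (Real.exp (δ + δ' - (δ' - δ) / 2 * R)) (Real.exp_pos _).le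
      (fun s hs => by
        rw [← Real.exp_add, Real.exp_le_exp]
        rw [mem_Icc, ← abs_le] at hs
        have e1 : |s| ≤ 1 + R / 2 := by
          have := abs_sub_abs_le_abs_sub s (θ * R)
          rw [abs_mul, hθ, abs_of_pos hR] at this
          linarith
        have e2 : R / 2 - 1 ≤ |s - η * R| := by
          have := abs_sub_abs_le_abs_sub ((θ - η) * R) (-(s - θ * R))
          rw [abs_mul, hη, abs_of_pos hR, abs_neg] at this
          have e : (θ - η) * R - -(s - θ * R) = s - η * R := by ring
          rw [e] at this
          linarith
        have e3 : δ * |s| ≤ δ * (1 + R / 2) := by gcongr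
        have e4 : δ' * (R / 2 - 1) ≤ δ' * |s - η * R| :=
          mul_le_mul_of_nonneg_left e2 (hδ0.trans hδ)
        linarith) x (hx ▸ f.2) y (by rw [hx]; rfl)
    refine ⟨profileCoeff a b r • y, ?_, ?_⟩
    · rw [map_smul, movingTerm_of_ne h]
      rfl
    · have hc : 0 ≤ profileCoeff a b r := by
        rw [profileCoeff]
        positivity
      rw [norm_smul, Real.norm_eq_abs, abs_of_nonneg hc]
      calc profileCoeff a b r * ‖y‖
          ≤ profileCoeff a b r * (C * Real.exp (δ + δ' - (δ' - δ) / 2 * R) * ‖x‖) := by gcongr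
        _ = C * Real.exp (δ + δ') * (profileCoeff a b r * Real.exp (-((δ' - δ) / 2 * R))) * ‖x‖ := by
            rw [sub_eq_add_neg, Real.exp_add]
            ring
        _ ≤ _ := by
            gcongr
            exact hB r hr0 (hV hr).2
  | diag σ θ hσ h0 hθ h1 hSS =>
    obtain ⟨C, hC0, hC⟩ := exists_norm_le_of_emb_eq_shiftMul (S := S) (S' := S') hσ isClosed_univ
      (fun s hs => absurd (mem_univ s) hs) (by omega : k + 0 ≤ k')
    refine ⟨C, hC0, fun r hr f x hx => ?_⟩
    by_cases h : r = 0
    · refine ⟨0, ?_, by simp; positivity⟩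
      rw [h, movingTerm_zero, map_zero]
    refine ⟨testElt k δ ⟨_, (MovingFam.diag σ θ hσ h0 hθ h1 hSS).mem (hS r hr) f⟩, rfl, ?_⟩
    have hy := hC δ δ' θ 0 (profile r) 1 zero_le_one (fun s _ => by
      rw [one_mul, zero_mul, sub_zero]
      gcongr) x (hx ▸ f.2)
      (testElt k δ ⟨_, (MovingFam.diag σ θ hσ h0 hθ h1 hSS).mem (hS r hr) f⟩) (by
        rw [sobolevEmb_testElt]
        change movingTerm S 0 0 0 σ θ 0 r f = _
        rw [movingTerm_of_ne h, hx]
        simp [profileCoeff])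
    rwa [mul_one] at hy
  | add j T T' _ _ h h' =>
    obtain ⟨C, hC0, hC⟩ := h hk hδj
    obtain ⟨C', hC0', hC'⟩ := h' hk hδj
    refine ⟨C + C', by positivity, fun r hr f x hx => ?_⟩
    obtain ⟨y, hy, h1⟩ := hC r hr f x hx
    obtain ⟨y', hy', h1'⟩ := hC' r hr f x hx
    refine ⟨y + y', by rw [map_add, hy, hy']; rfl, (norm_add_le _ _).trans ?_⟩
    rw [add_mul]
    exact add_le_add h1 h1'
  | smul j c T _ h =>
    obtain ⟨C, hC0, hC⟩ := h hk hδj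
    refine ⟨|c| * C, by positivity, fun r hr f x hx => ?_⟩
    obtain ⟨y, hy, h1⟩ := hC r hr f x hx
    refine ⟨c • y, by rw [map_smul, hy]; rfl, ?_⟩
    rw [norm_smul, Real.norm_eq_abs, mul_assoc]
    gcongr

/-! #### Derivatives -/

/-- For r ≠ 0 this is the chain rule. At r = 0 the hypothesis `h0` makes the curve vanish
identically near 0, since φ(r) → ∞; no estimate on the singular coefficients is needed. -/
theorem exists_hasDerivWithinAt_movingTerm (k : ℕ) (δ : ℝ) (hσ : BddDerivs σ) (f : testSubmodule S)
    (h0 : ∃ K, ∀ R, K < R → shiftMul σ (iteratedDeriv i (f : ℝ → EuclideanSpace ℝ (Fin N))) θ η R = 0) :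
    ∃ c c' : ℝ → SobolevSpace k δ ⊤, ∀ r ∈ Ico (0 : ℝ) 1,
      sobolevEmb k δ ⊤ (c r) = movingTerm S a b i σ θ η r f ∧
      sobolevEmb k δ ⊤ (c' r) = (-(a : ℝ)) • movingTerm S (a + 1) b i σ θ η r f +
        (-(b : ℝ)) • movingTerm S (a + 2) b i σ θ η r f +
        θ • movingTerm S (a + 2) (b + 1) i (deriv σ) θ η r f +
        η • movingTerm S (a + 2) (b + 1) (i + 1) σ θ η r f ∧
      HasDerivWithinAt c (c' r) (Ico 0 1) r := by
  have hf := f.2.1.iteratedDeriv_infty i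
  have hfc := f.2.2.1.iteratedDeriv' i
  let U (σ : ℝ → ℝ) (hσ : BddDerivs σ) (i : ℕ) (R : ℝ) : SobolevSpace k δ
      (⊤ : Submodule ℝ (EuclideanSpace ℝ (Fin N))) :=
    testElt k δ ⟨_, shiftMul_mem_testSubmodule (θ := θ) (η := η) (i := i) (R := R) hσ.1 f trivial⟩
  let U' (R : ℝ) := -θ • U (deriv σ) hσ.deriv i R + -η • U σ hσ (i + 1) R
  have hU : ∀ R, HasDerivAt (U σ hσ i) (U' R) R := fun R =>
    hasDerivAt_of_sobolevEmb_eq_shiftMul hσ hf hfc (fun R => rfl) (by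
      rw [map_add, map_smul, map_smul, ← iteratedDeriv_succ]
      rfl)
  let c (r : ℝ) := if r = 0 then 0 else profileCoeff a b r • U σ hσ i (profile r)
  let c' (r : ℝ) := if r = 0 then 0 else
    profileCoeff a b r • (-(r⁻¹ ^ 2 * Real.exp r⁻¹)) • U' (profile r) +
      (-a * profileCoeff (a + 1) b r + -b * profileCoeff (a + 2) b r) • U σ hσ i (profile r)
  refine ⟨c, c', fun r hr => ?_⟩
  by_cases h : r = 0
  · subst h
    refine ⟨?_, ?_, ?_⟩
    · simp only [c, if_pos, map_zero, movingTerm_zero]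
    · simp only [c', if_pos, map_zero, movingTerm_zero, smul_zero, add_zero]
    · obtain ⟨K, hK⟩ := h0
      obtain ⟨ε, hε, hεK⟩ := exists_lt_profile K
      have hc0 : c =ᶠ[𝓝[Ico 0 1] 0] fun _ => 0 := by
        filter_upwards [self_mem_nhdsWithin, mem_nhdsWithin_of_mem_nhds (Iio_mem_nhds hε)] with r hr hrε
        by_cases h : r = 0
        · simp only [c, if_pos h]
        · have hr0 : 0 < r := lt_of_le_of_ne hr.1 (Ne.symm h)
          simp only [c, if_neg h]
          have e : U σ hσ i (profile r) = 0 := by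
            refine sobolevEmb_injective k δ ⊤ ?_
            rw [map_zero]
            exact hK _ (hεK r hr0 hrε)
          rw [e, smul_zero]
      simp only [c', if_pos]
      exact (hasDerivWithinAt_const _ _ _).congr_of_eventuallyEq hc0 (by simp only [c, if_pos])
  · refine ⟨?_, ?_, ?_⟩
    · simp only [c, if_neg h, map_smul, movingTerm_of_ne h]
      rfl
    · simp only [c', if_neg h, map_smul, map_add, movingTerm_of_ne h, U', ← profileCoeff_mul_exp]
      change _ • _ • (_ • shiftMul _ _ _ _ _ + _ • shiftMul _ _ _ _ _) +
        _ • shiftMul _ _ _ _ _ = _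
      module
    · have h1 := (hasDerivAt_profileCoeff a b h).smul
        (HasDerivAt.scomp r (hU (profile r)) (hasDerivAt_profile h))
      simp only [c', if_neg h]
      refine (h1.congr_of_eventuallyEq ?_).hasDerivWithinAt
      filter_upwards [isOpen_ne.mem_nhds h] with r hr
      simp only [c, if_neg hr]
      rfl

/-- The r-derivative falls on the coefficient, on σ or on f, and raises i by at most one, so the sum
again has the required form with j + 1. For an unshifted term only σ is hit, and σ' is localized,
with η = 0 and |θ - η| = 1/2. -/
theorem MovingFam.exists_deriv {T : ℝ → testSubmodule S →ₗ[ℝ] (ℝ → EuclideanSpace ℝ (Fin N))}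
    (hT : MovingFam S S' j T) : ∃ T', MovingFam S S' (j + 1) T' ∧ ∀ (k : ℕ) (δ : ℝ)
      (f : testSubmodule S), ∃ c c' : ℝ → SobolevSpace k δ ⊤, ∀ r ∈ Ico (0 : ℝ) 1,
        sobolevEmb k δ ⊤ (c r) = T r f ∧ sobolevEmb k δ ⊤ (c' r) = T' r f ∧
        HasDerivWithinAt c (c' r) (Ico 0 1) r := by
  induction hT with
  | term j a b i σ θ η hσ h0 hθ hη hi hj =>
    have h0' : ∀ s ∉ Icc (-1 : ℝ) 1, deriv σ s = 0 := fun s hs =>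
      deriv_eq_zero_of_isOpen isClosed_Icc.isOpen_compl (fun s hs => h0 s hs) _ hs
    refine ⟨_, .add _ _ _ (.add _ _ _ (.add _ _ _
      (.smul _ (-(a : ℝ)) _ (.term _ (a + 1) b i σ θ η hσ h0 hθ hη (by omega) (by omega)))
      (.smul _ (-(b : ℝ)) _ (.term _ (a + 2) b i σ θ η hσ h0 hθ hη (by omega) (by omega))))
      (.smul _ θ _ (.term _ (a + 2) (b + 1) i (deriv σ) θ η hσ.deriv h0' hθ hη (by omega) (by omega))))
      (.smul _ η _ (.term _ (a + 2) (b + 1) (i + 1) σ θ η hσ h0 hθ hη (by omega) (by omega))),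
      fun k δ f => exists_hasDerivWithinAt_movingTerm k δ hσ f ?_⟩
    obtain ⟨M, -, hM⟩ := (f.2.2.1.iteratedDeriv' i).exists_abs_gt
    -- On the support of the cut-off |s - ηR| ≥ R/2 - 1 > M, beyond the support of f.
    refine ⟨2 * M + 2, fun R hR => funext fun s => ?_⟩
    by_cases hs : s - θ * R ∈ Icc (-1 : ℝ) 1
    · rw [shiftMul, hM, smul_zero, Pi.zero_apply]
      rw [mem_Icc, ← abs_le] at hs
      have := abs_sub_abs_le_abs_sub ((θ - η) * R) (-(s - θ * R))
      rw [abs_mul, hη, abs_neg] at this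
      have e : (θ - η) * R - -(s - θ * R) = s - η * R := by ring
      rw [e] at this
      linarith [le_abs_self R]
    · rw [shiftMul, h0 _ hs, zero_smul, Pi.zero_apply]
  | diag σ θ hσ h0 hθ h1 hS =>
    refine ⟨_, .smul _ θ _ (.term _ 2 1 0 (deriv σ) θ 0 hσ.deriv h0 hθ (by rwa [sub_zero])
      (by omega) (by omega)), fun k δ f => ?_⟩
    obtain ⟨c, c', h⟩ := exists_hasDerivWithinAt_movingTerm (a := 0) (b := 0) (i := 0) (θ := θ)
      (η := 0) k δ hσ f (by
        obtain ⟨M, -, hM⟩ := f.2.2.1.exists_abs_gt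
        -- For |s| ≤ M one has θ(s - θR) ≤ M/2 - R/4 < -1/2, where σ vanishes.
        refine ⟨2 * M + 2, fun R hR => funext fun s => ?_⟩
        simp only [shiftMul, zero_mul, sub_zero, iteratedDeriv_zero, Pi.zero_apply]
        by_cases hs : M < |s|
        · rw [hM s hs, smul_zero]
        · rw [h1, zero_smul]
          have e1 : θ * s ≤ 1 / 2 * M := by
            refine (le_abs_self _).trans ?_
            rw [abs_mul, hθ]
            linarith
          have e2 : θ * θ = 1 / 4 := by
            rw [← abs_mul_abs_self, hθ]
            norm_num
          rw [mul_sub, ← mul_assoc, e2]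
          linarith)
    refine ⟨c, c', fun r hr => ⟨(h r hr).1, (h r hr).2.1.trans ?_, (h r hr).2.2⟩⟩
    simp
  | add j T T' _ _ h h' =>
    obtain ⟨T₁, hT₁, h⟩ := h
    obtain ⟨T₂, hT₂, h'⟩ := h'
    refine ⟨_, .add _ _ _ hT₁ hT₂, fun k δ f => ?_⟩
    obtain ⟨c₁, c₁', hc₁⟩ := h k δ f
    obtain ⟨c₂, c₂', hc₂⟩ := h' k δ f
    refine ⟨fun r => c₁ r + c₂ r, fun r => c₁' r + c₂' r, fun r hr => ⟨?_, ?_, ?_⟩⟩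
    · rw [map_add, (hc₁ r hr).1, (hc₂ r hr).1]; rfl
    · rw [map_add, (hc₁ r hr).2.1, (hc₂ r hr).2.1]; rfl
    · exact (hc₁ r hr).2.2.add (hc₂ r hr).2.2
  | smul j a T _ h =>
    obtain ⟨T₁, hT₁, h⟩ := h
    refine ⟨_, .smul _ a _ hT₁, fun k δ f => ?_⟩
    obtain ⟨c₁, c₁', hc₁⟩ := h k δ f
    refine ⟨fun r => a • c₁ r, fun r => a • c₁' r, fun r hr => ⟨?_, ?_, ?_⟩⟩
    · rw [map_smul, (hc₁ r hr).1]; rfl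
    · rw [map_smul, (hc₁ r hr).2.1]; rfl
    · exact (hc₁ r hr).2.2.const_smul a

/-- Derivatives are computed without the condition at 0, where individual summands need not satisfy
it for small R. The inclusion into the space for `⊤` is bounded below, so differentiability
descends. -/
theorem exists_hasDerivWithinAt_of_top {V : Set ℝ} {F F' : ℝ → ℝ → EuclideanSpace ℝ (Fin N)}
    (hF : ∀ r ∈ V, F r ∈ testSubmodule S) (hF' : ∀ r ∈ V, F' r ∈ testSubmodule S)
    {c c' : ℝ → SobolevSpace k δ ⊤}
    (h : ∀ r ∈ V, sobolevEmb k δ ⊤ (c r) = F r ∧ sobolevEmb k δ ⊤ (c' r) = F' r ∧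
      HasDerivWithinAt c (c' r) V r) :
    ∃ c c' : ℝ → SobolevSpace k δ S, ∀ r ∈ V, sobolevEmb k δ S (c r) = F r ∧
      sobolevEmb k δ S (c' r) = F' r ∧ HasDerivWithinAt c (c' r) V r := by
  classical
  let C (F : ℝ → ℝ → EuclideanSpace ℝ (Fin N)) (r : ℝ) : SobolevSpace k δ S :=
    if h : F r ∈ testSubmodule S then testElt k δ ⟨F r, h⟩ else 0
  have hC : ∀ {F : ℝ → ℝ → EuclideanSpace ℝ (Fin N)} {r : ℝ}, F r ∈ testSubmodule S →
      sobolevEmb k δ S (C F r) = F r := fun h => by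
    simp only [C, dif_pos h]
    rfl
  set ι := sobolevIncl (k := k) (δ := δ) le_rfl le_rfl (le_top (a := S)) with hιdef
  have hι : ∀ x, sobolevEmb k δ ⊤ (ι x) = sobolevEmb k δ S x := sobolevEmb_sobolevIncl _ _ _
  have hιc : ∀ r ∈ V, ι (C F r) = c r := fun r hr => by
    refine sobolevEmb_injective k δ ⊤ ?_
    rw [hι, hC (hF r hr), (h r hr).1]
  have hιc' : ∀ r ∈ V, ι (C F' r) = c' r := fun r hr => by
    refine sobolevEmb_injective k δ ⊤ ?_
    rw [hι, hC (hF' r hr), (h r hr).2.1]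
  refine ⟨C F, C F', fun r hr => ⟨hC (hF r hr), hC (hF' r hr), ?_⟩⟩
  have h1 := (h r hr).2.2
  rw [hasDerivWithinAt_iff_isLittleO] at h1 ⊢
  refine Asymptotics.IsBigO.trans_isLittleO (Asymptotics.IsBigO.of_bound (k + 1) ?_) h1
  filter_upwards [self_mem_nhdsWithin] with x hx
  refine (norm_le_norm_sobolevIncl (le_top (a := S)) _).trans (le_of_eq ?_)
  change _ * ‖ι _‖ = _
  rw [map_sub, map_sub, map_smul, hιc x hx, hιc r hr, hιc' r hr]

/-! #### The smooth families -/

variable {δ : ℕ → ℝ} {V : Set ℝ}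

theorem exists_smoothFam_of_movingFam (hδ₀ : δ 0 = 0) (hδ : StrictMono δ) (hV : V ⊆ Ico 0 1)
    (hVc : Convex ℝ V) (hS : ∀ r ∈ V, r ≠ 0 → S' = ⊤ ∨ 2 < profile r)
    {T : ℝ → testSubmodule S →ₗ[ℝ] (ℝ → EuclideanSpace ℝ (Fin N))} (hT : MovingFam S S' 0 T) :
    ∃ A, SmoothFam (pathScale δ S) (pathScale δ S') V A ∧
      ∀ r ∈ V, ∀ f : testSubmodule S, A 0 r f = T r f := by
  have hδ0 : ∀ m, 0 ≤ δ m := fun m => hδ₀ ▸ hδ.monotone (Nat.zero_le m)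
  let next (j : ℕ) (T : {T // MovingFam S S' j T}) : {T // MovingFam S S' (j + 1) T} :=
    ⟨T.2.exists_deriv.choose, T.2.exists_deriv.choose_spec.1⟩
  -- The recursion carries the proof of membership, since the next family is chosen from it.
  let Ts (j : ℕ) : {T // MovingFam S S' j T} := Nat.rec ⟨T, hT⟩ next j
  have hE := isScStructure_pathScale (S := S) hδ₀ hδ
  have hE' := isScStructure_pathScale (S := S') hδ₀ hδ
  obtain ⟨A, hA, h⟩ := exists_smoothFam_of_dense (V := V) (D := testSubmodule S) hE.nested hE'.nested
    hE'.complete hVc (fun m => dense_test (by omega) (hδ0 m))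
    (fun m d hd => ⟨testElt (m + 2) (δ m) ⟨d, hd⟩, rfl⟩) (fun j => (Ts j).1)
    (fun j m n hmn => (Ts j).2.bound hV hS (by omega) (hδ0 m) (hδ.monotone (by omega))
      fun hj => hδ (by omega))
    (fun j m f => by
      obtain ⟨c, c', hc⟩ := (Ts j).2.exists_deriv.choose_spec.2 (m + 2) (δ m) f
      exact exists_hasDerivWithinAt_of_top (fun r hr => (Ts j).2.mem (hS r hr) f)
        (fun r hr => (Ts (j + 1)).2.mem (hS r hr) f)
        fun r hr => ⟨(hc r (hV hr)).1, (hc r (hV hr)).2.1, (hc r (hV hr)).2.2.mono hV⟩)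
  exact ⟨A, hA, fun r hr f => h 0 r hr f⟩

theorem continuous_eval (k : ℕ) (hk : 1 ≤ k) {δ : ℝ} (hδ : 0 ≤ δ) (s : ℝ) :
    Continuous fun x : SobolevSpace k δ S => sobolevEmb k δ S x s :=
  (AddMonoidHomClass.continuous_of_bound ((LinearMap.proj s).comp (sobolevEmb k δ S)) 2
    fun x => norm_sobolevEmb_le hk hδ x s)

/-- The explicit formula holds on test functions; both sides are continuous in the vector when
evaluated at a point s, so it holds on all of E₀. -/
theorem exists_smoothFam_of_movingFam_term (hδ₀ : δ 0 = 0) (hδ : StrictMono δ) (hV : V ⊆ Ico 0 1)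
    (hVc : Convex ℝ V) (hS : ∀ r ∈ V, r ≠ 0 → S' = ⊤ ∨ 2 < profile r)
    (hT : MovingFam S S' 0 (movingTerm S 0 0 0 σ θ η)) :
    ∃ A, SmoothFam (pathScale δ S) (pathScale δ S') V A ∧ ∀ r ∈ V, ∀ x : (pathScale δ S).Lvl 0,
      A 0 r ((pathScale δ S).emb 0 x) =
        if r = 0 then 0 else shiftMul σ ((pathScale δ S).emb 0 x) θ η (profile r) := by
  obtain ⟨A, hA, h⟩ := exists_smoothFam_of_movingFam hδ₀ hδ hV hVc hS hT
  refine ⟨A, hA, fun r hr x => ?_⟩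
  obtain ⟨L, hL, -⟩ := hA.op 0 0 0 le_rfl
  rw [← hL r hr]
  funext s
  have hd : Dense {x : (pathScale δ S).Lvl 0 | (pathScale δ S).emb 0 x ∈ testSubmodule S} :=
    dense_test (by omega) hδ₀.ge
  have h1 : Continuous fun x => (pathScale δ S').emb 0 (L r x) s :=
    (continuous_eval 2 (by omega) hδ₀.ge s).comp (L r).continuous
  have h2 : Continuous fun x => (if r = 0 then (0 : ℝ → EuclideanSpace ℝ (Fin N)) else
      shiftMul σ ((pathScale δ S).emb 0 x) θ η (profile r)) s := by
    by_cases h : r = 0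
    · simp only [if_pos h]
      exact continuous_const
    · simp only [if_neg h]
      exact (continuous_eval (S := S) 2 (by omega) hδ₀.ge (s - η * profile r)).const_smul
        (σ (s - θ * profile r))
  refine congrFun (h1.ext_on hd h2 fun x hx => ?_) x
  beta_reduce
  rw [hL r hr, h r hr ⟨_, hx⟩]
  by_cases h : r = 0
  · subst h
    rw [movingTerm_zero, if_pos rfl]
  · simp only [if_neg h, movingTerm_of_ne h]
    simp [profileCoeff]

end Moving

open NormedScale

theorem smoothFam_id {W : Type u} [AddCommGroup W] [Module ℝ W] {E : NormedScale W} (hE : E.Nested)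
    (V : Set ℝ) : SmoothFam E E V (fun j _ x => if j = 0 then x else 0) := by
  refine ⟨fun j m n hmn => ?_, fun j m n hmn L L' hL hL' x r hr => ?_⟩
  · cases j with
    | zero =>
      obtain ⟨L, hL⟩ := hE m n hmn
      exact ⟨fun _ => L, fun r _ x => hL x, fun x => continuousOn_const, ‖L‖, fun r _ => le_rfl⟩
    | succ j =>
      exact ⟨fun _ => 0, fun r _ x => by simp, fun x => continuousOn_const, 0, fun r _ => by simp⟩
  · have h1 : L' r x = 0 := E.emb_injective m (by rw [hL' r hr, map_zero, if_neg (by omega)])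
    rw [h1]
    refine (hasDerivWithinAt_const r V (L r x)).congr (fun r' hr' => ?_) rfl
    exact E.emb_injective m (by rw [hL r hr, hL r' hr'])

/-! ### The projections -/

section Projection

variable {N : ℕ} {β : ℝ → ℝ}

/-- The function `β² + (1 - β)²`. -/
noncomputable def cutoffDet (β : ℝ → ℝ) (s : ℝ) : ℝ := β s ^ 2 + (1 - β s) ^ 2

/-- The function `β² / (β² + (1 - β)²)`. -/
noncomputable def cutoffMain (β : ℝ → ℝ) (s : ℝ) : ℝ := β s ^ 2 / cutoffDet β s

/-- The function `β (1 - β) / (β² + (1 - β)²)`. -/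
noncomputable def cutoffMixed (β : ℝ → ℝ) (s : ℝ) : ℝ := β s * (1 - β s) / cutoffDet β s

theorem cutoffDet_pos (β : ℝ → ℝ) (s : ℝ) : 0 < cutoffDet β s := by
  rw [cutoffDet]
  nlinarith [sq_nonneg (2 * β s - 1)]

theorem IsGluingCutoff.eq_zero (hβ : IsGluingCutoff β) {s : ℝ} (hs : 1 ≤ s) : β s = 0 := by
  have h1 := hβ.add_neg s
  rw [hβ.eq_one (-s) (by linarith)] at h1
  linarith

theorem IsGluingCutoff.contDiff_det (hβ : IsGluingCutoff β) : ContDiff ℝ ∞ (cutoffDet β) :=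
  (hβ.smooth.pow 2).add ((contDiff_const.sub hβ.smooth).pow 2)

theorem IsGluingCutoff.contDiff_main (hβ : IsGluingCutoff β) : ContDiff ℝ ∞ (cutoffMain β) :=
  (hβ.smooth.pow 2).div hβ.contDiff_det fun s => (cutoffDet_pos β s).ne'

theorem IsGluingCutoff.contDiff_mixed (hβ : IsGluingCutoff β) : ContDiff ℝ ∞ (cutoffMixed β) :=
  (hβ.smooth.mul (contDiff_const.sub hβ.smooth)).div hβ.contDiff_det
    fun s => (cutoffDet_pos β s).ne'

theorem IsGluingCutoff.main_eq_one (hβ : IsGluingCutoff β) {s : ℝ} (hs : s ≤ -1) :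
    cutoffMain β s = 1 := by
  simp [cutoffMain, cutoffDet, hβ.eq_one s hs]

theorem IsGluingCutoff.main_eq_zero (hβ : IsGluingCutoff β) {s : ℝ} (hs : 1 ≤ s) :
    cutoffMain β s = 0 := by
  simp [cutoffMain, hβ.eq_zero hs]

theorem IsGluingCutoff.mixed_eq_zero (hβ : IsGluingCutoff β) {s : ℝ} (hs : s ∉ Icc (-1 : ℝ) 1) :
    cutoffMixed β s = 0 := by
  rcases not_and_or.1 hs with h | h
  · simp [cutoffMixed, hβ.eq_one s (not_le.1 h).le]
  · simp [cutoffMixed, hβ.eq_zero (not_le.1 h).le]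

theorem IsGluingCutoff.bddDerivs_mixed (hβ : IsGluingCutoff β) : BddDerivs (cutoffMixed β) :=
  .of_hasCompactSupport hβ.contDiff_mixed
    (HasCompactSupport.intro isCompact_Icc fun _ hs => hβ.mixed_eq_zero hs)

/-- The shift is c = 1 for the first component and c = 0 for the second, chosen so that the function
vanishes on the side required of an unshifted term. -/
theorem IsGluingCutoff.bddDerivs_main_sub (hβ : IsGluingCutoff β) (c : ℝ) :
    BddDerivs (fun s => cutoffMain β s - c) ∧
      ∀ s ∉ Icc (-1 : ℝ) 1, deriv (fun s => cutoffMain β s - c) s = 0 := by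
  have h1 : ∀ s ∉ Icc (-1 : ℝ) 1, deriv (fun s => cutoffMain β s - c) s = 0 := fun s hs => by
    rcases not_and_or.1 hs with h | h
    · refine (Filter.EventuallyEq.deriv_eq (f := fun _ => 1 - c) ?_).trans (deriv_const _ _)
      filter_upwards [Iio_mem_nhds (not_le.1 h)] with t ht
      rw [hβ.main_eq_one (mem_Iio.1 ht).le]
    · refine (Filter.EventuallyEq.deriv_eq (f := fun _ => 0 - c) ?_).trans (deriv_const _ _)
      filter_upwards [Ioi_mem_nhds (not_le.1 h)] with t ht
      rw [hβ.main_eq_zero (mem_Ioi.1 ht).le]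
  refine ⟨.of_deriv (hβ.contDiff_main.sub contDiff_const) ⟨1 + |c|, fun s => ?_⟩
    (HasCompactSupport.intro isCompact_Icc h1), h1⟩
  refine (abs_sub _ _).trans (add_le_add_left ?_ _)
  have h2 := cutoffDet_pos β s
  rw [cutoffMain, abs_of_nonneg (by positivity), div_le_one h2, cutoffDet]
  linarith [sq_nonneg (1 - β s)]

/-- The projection onto `ker ⊖_R` along `ker ⊕_R`, where `R = φ(r)`. -/
noncomputable def glueProj (β : ℝ → ℝ) (r : ℝ) (x : PathPairs N) : PathPairs N :=
  if r = 0 then x else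
    -- Written as a perturbation of the identity, so that each added term vanishes on a fixed test
    -- function as r → 0. In the second component the variable is s - R renamed to s, whence θ =
    -- -1/2 and η = -1.
    (x.1 + shiftMul (fun s => cutoffMain β s - 1) x.1 (1 / 2) 0 (profile r) +
      shiftMul (cutoffMixed β) x.2 (1 / 2) 1 (profile r),
    x.2 + shiftMul (cutoffMixed β) x.1 (-(1 / 2)) (-1) (profile r) +
      -shiftMul (cutoffMain β) x.2 (-(1 / 2)) 0 (profile r))

theorem expProfile_of_ne {r : ℝ} (hr : r ≠ 0) : expProfile r = ((profile r : ℝ) : WithTop ℝ) := by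
  rw [expProfile, if_neg hr, profile, one_div]

theorem kerGlue_coe (R : ℝ) :
    kerGlue (N := N) β ((R : ℝ) : WithTop ℝ) = LinearMap.ker (glue β R) := rfl

theorem kerAntiGlue_coe (R : ℝ) :
    kerAntiGlue (N := N) β ((R : ℝ) : WithTop ℝ) = LinearMap.ker (antiGlue β R) := rfl

theorem glueProj_mem_kerAntiGlue (r : ℝ) (x : PathPairs N) :
    glueProj β r x ∈ kerAntiGlue β (expProfile r) := by
  by_cases hr : r = 0
  · subst hr
    rw [expProfile, if_pos rfl]
    exact Submodule.mem_top
  · rw [expProfile_of_ne hr, kerAntiGlue_coe, LinearMap.mem_ker, glueProj, if_neg hr]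
    funext s
    have h := (cutoffDet_pos β (s - profile r / 2)).ne'
    have e1 : s - 1 / 2 * profile r = s - profile r / 2 := by ring
    have e2 : s - profile r - -(1 / 2) * profile r = s - profile r / 2 := by ring
    have e3 : s - profile r - -1 * profile r = s := by ring
    simp only [antiGlue, shiftMul, LinearMap.coe_mk, AddHom.coe_mk, Pi.add_apply, Pi.neg_apply,
      Pi.zero_apply, e1, e2, e3, one_mul, zero_mul, sub_zero, cutoffMain, cutoffMixed]
    have hg : cutoffDet β (s - profile r / 2) =
      β (s - profile r / 2) ^ 2 + (1 - β (s - profile r / 2)) ^ 2 := rfl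
    generalize cutoffDet β (s - profile r / 2) = g at h hg
    generalize β (s - profile r / 2) = b at hg
    match_scalars <;> (field_simp; rw [hg]; ring)

theorem sub_glueProj_mem_kerGlue (r : ℝ) (x : PathPairs N) :
    x - glueProj β r x ∈ kerGlue β (expProfile r) := by
  by_cases hr : r = 0
  · subst hr
    rw [expProfile, if_pos rfl, glueProj, if_pos rfl, sub_self]
    exact zero_mem _
  · rw [expProfile_of_ne hr, kerGlue_coe, LinearMap.mem_ker, glueProj, if_neg hr]
    funext s
    have h := (cutoffDet_pos β (s - profile r / 2)).ne'
    have e1 : s - 1 / 2 * profile r = s - profile r / 2 := by ring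
    have e2 : s - profile r - -(1 / 2) * profile r = s - profile r / 2 := by ring
    have e3 : s - profile r - -1 * profile r = s := by ring
    simp only [glue, shiftMul, LinearMap.coe_mk, AddHom.coe_mk, Pi.add_apply, Pi.neg_apply,
      Pi.zero_apply, Prod.fst_sub, Prod.snd_sub, Pi.sub_apply, e1, e2, e3, one_mul, zero_mul,
      sub_zero, cutoffMain, cutoffMixed]
    have hg : cutoffDet β (s - profile r / 2) =
      β (s - profile r / 2) ^ 2 + (1 - β (s - profile r / 2)) ^ 2 := rfl
    generalize cutoffDet β (s - profile r / 2) = g at h hg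
    generalize β (s - profile r / 2) = b at hg
    match_scalars <;> (field_simp; rw [hg]; ring)

/-- Multiplying the two equations by the adjugate matrix gives det · h(s) = 0 and det · k(s-R) = 0.
-/
theorem disjoint_kerAntiGlue_kerGlue (R : WithTop ℝ) :
    Disjoint (kerAntiGlue (N := N) β R) (kerGlue β R) := by
  induction R with
  | top => exact disjoint_bot_right
  | coe R =>
    rw [kerGlue_coe, kerAntiGlue_coe, Submodule.disjoint_def]
    intro x h1 h2
    have key : ∀ s, x.1 s = 0 ∧ x.2 (s - R) = 0 := fun s => by
      have h1 : -((1 - β (s - R / 2)) • x.1 s) + β (s - R / 2) • x.2 (s - R) = 0 := congrFun h1 s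
      have h2 : β (s - R / 2) • x.1 s + (1 - β (s - R / 2)) • x.2 (s - R) = 0 := congrFun h2 s
      have h := (cutoffDet_pos β (s - R / 2)).ne'
      constructor
      · refine (smul_eq_zero.1 (?_ : cutoffDet β (s - R / 2) • x.1 s = 0)).resolve_left h
        calc _ = β (s - R / 2) • (β (s - R / 2) • x.1 s + (1 - β (s - R / 2)) • x.2 (s - R)) -
              (1 - β (s - R / 2)) •
                (-((1 - β (s - R / 2)) • x.1 s) + β (s - R / 2) • x.2 (s - R)) := by
              rw [cutoffDet]
              module
          _ = 0 := by rw [h1, h2, smul_zero, smul_zero, sub_zero]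
      · refine (smul_eq_zero.1 (?_ : cutoffDet β (s - R / 2) • x.2 (s - R) = 0)).resolve_left h
        calc _ = (1 - β (s - R / 2)) •
                (β (s - R / 2) • x.1 s + (1 - β (s - R / 2)) • x.2 (s - R)) +
              β (s - R / 2) • (-((1 - β (s - R / 2)) • x.1 s) + β (s - R / 2) • x.2 (s - R)) := by
              rw [cutoffDet]
              module
          _ = 0 := by rw [h1, h2, smul_zero, smul_zero, add_zero]
    refine Prod.ext (funext fun s => (key s).1) (funext fun s => ?_)
    simpa using (key (s + R)).2

variable {S S' : Submodule ℝ (EuclideanSpace ℝ (Fin N))} {δ : ℕ → ℝ} {V : Set ℝ}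

theorem exists_smoothFam_glueProj (hβ : IsGluingCutoff β) (hδ₀ : δ 0 = 0) (hδ : StrictMono δ)
    (hV : V ⊆ Ico 0 1) (hVc : Convex ℝ V)
    (hS : ∀ r ∈ V, r ≠ 0 → S = ⊤ ∧ S' = ⊤ ∨ 2 < profile r) :
    ∃ A, SmoothFam (pathPairScale δ S S') (pathPairScale δ S S') V A ∧
      ∀ r ∈ V, ∀ x : (pathPairScale δ S S').Lvl 0,
        A 0 r ((pathPairScale δ S S').emb 0 x) = glueProj β r ((pathPairScale δ S S').emb 0 x) := by
  have hS₁ : ∀ r ∈ V, r ≠ 0 → S = ⊤ ∨ 2 < profile r := fun r h h' => (hS r h h').imp_left And.left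
  have hS₂ : ∀ r ∈ V, r ≠ 0 → S' = ⊤ ∨ 2 < profile r := fun r h h' => (hS r h h').imp_left And.right
  have ha : |(1 / 2 : ℝ)| = 1 / 2 := by norm_num
  have ha' : |(-(1 / 2) : ℝ)| = 1 / 2 := by norm_num
  obtain ⟨A₁, hA₁, h₁⟩ := exists_smoothFam_of_movingFam_term hδ₀ hδ hV hVc hS₁
    (.diag (S := S) (fun s => cutoffMain β s - 1) (1 / 2) (hβ.bddDerivs_main_sub 1).1
      (hβ.bddDerivs_main_sub 1).2 ha
      (fun s hs => by rw [hβ.main_eq_one (by linarith), sub_self]) le_rfl)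
  obtain ⟨A₂, hA₂, h₂⟩ := exists_smoothFam_of_movingFam_term hδ₀ hδ hV hVc hS₁
    (.term (S := S') 0 0 0 0 (cutoffMixed β) (1 / 2) 1 hβ.bddDerivs_mixed
      (fun s => hβ.mixed_eq_zero) ha (by norm_num) le_rfl (fun _ => ⟨rfl, rfl⟩))
  obtain ⟨A₃, hA₃, h₃⟩ := exists_smoothFam_of_movingFam_term hδ₀ hδ hV hVc hS₂
    (.term (S := S) 0 0 0 0 (cutoffMixed β) (-(1 / 2)) (-1) hβ.bddDerivs_mixed
      (fun s => hβ.mixed_eq_zero) ha' (by norm_num) le_rfl (fun _ => ⟨rfl, rfl⟩))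
  obtain ⟨A₄, hA₄, h₄⟩ := exists_smoothFam_of_movingFam_term hδ₀ hδ hV hVc hS₂
    (.diag (S := S') (fun s => cutoffMain β s - 0) (-(1 / 2)) (hβ.bddDerivs_main_sub 0).1
      (hβ.bddDerivs_main_sub 0).2 ha'
      (fun s hs => by rw [hβ.main_eq_zero (by linarith), sub_zero]) le_rfl)
  have hE := (isScStructure_pathPairScale (S := S) (S' := S') hδ₀ hδ).nested
  have hinr : ∀ m, Bdd (pathScale δ S') m (pathPairScale δ S S') m (fun x => (0, -x)) := fun m =>
    bdd_inr.comp ⟨-ContinuousLinearMap.id ℝ _, fun x => map_neg _ x⟩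
  refine ⟨_, ((((smoothFam_id hE V).add (hA₁.comp (fun _ => bdd_fst) fun _ => bdd_inl)).add
    (hA₂.comp (fun _ => bdd_snd) fun _ => bdd_inl)).add
    (hA₃.comp (fun _ => bdd_fst) fun _ => bdd_inr)).add (hA₄.comp (fun _ => bdd_snd) hinr),
    fun r hr x => ?_⟩
  have e₁ := h₁ r hr x.1
  have e₂ := h₂ r hr x.2
  have e₃ := h₃ r hr x.1
  have e₄ := h₄ r hr x.2
  change (pathPairScale δ S S').emb 0 x + ((A₁ 0 r ((pathScale δ S).emb 0 x.1), 0) : PathPairs N) +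
    (A₂ 0 r ((pathScale δ S').emb 0 x.2), 0) + (0, A₃ 0 r ((pathScale δ S).emb 0 x.1)) +
    (0, -A₄ 0 r ((pathScale δ S').emb 0 x.2)) = _
  rw [e₁, e₂, e₃, e₄, glueProj]
  simp only [sub_zero]
  by_cases h : r = 0
  · simp only [if_pos h, neg_zero, ← Prod.zero_eq_mk, add_zero]
  · simp only [if_neg h]
    refine Prod.ext ?_ ?_
    · simp only [Prod.fst_add, add_zero]
      rfl
    · simp only [Prod.snd_add, add_zero]
      rfl

end Projection

/-! ### From smooth families of projections to splicings. -/

section Splicing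

variable {X : Type u} [AddCommGroup X] [Module ℝ X] {E : NormedScale X}

/-- Uniqueness of the decomposition identifies an arbitrary projection π with the explicit one on
E₀. -/
theorem IsProjectionAlong.eq_of_mem {K L : Submodule ℝ X} {p : X → X} (hp : IsProjectionAlong E K L p)
    (h : Disjoint K L) {x y : E.Lvl 0} (hy : E.emb 0 y ∈ K) (hxy : E.emb 0 (x - y) ∈ L) :
    p (E.emb 0 x) = E.emb 0 y := by
  obtain ⟨z, hz, h1, h2⟩ := hp x
  rw [hz, ← sub_eq_zero]
  refine Submodule.disjoint_def.1 h _ (K.sub_mem h1 hy) ?_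
  have e : E.emb 0 z - E.emb 0 y = E.emb 0 (x - y) - E.emb 0 (x - z) := by
    simp only [map_sub]
    abel
  rw [e]
  exact L.sub_mem hxy h2

theorem nested_constScale (A : Type u) [NormedAddCommGroup A] [NormedSpace ℝ A] :
    (constScale A).Nested := fun _ _ _ => ⟨ContinuousLinearMap.id ℝ A, fun _ => rfl⟩

theorem isPartialCone_Ici : IsPartialCone (Ici (0 : ℝ)) := by
  refine ⟨1, 1, (LinearEquiv.funUnique (Fin 1) ℝ ℝ).symm, le_rfl, ?_⟩
  ext a
  simp

/-- A smooth family of operators `A 0 r` such that `A 0 r x ∈ K r` and `x - A 0 r x ∈ L r`, with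
`K r ∩ L r = 0`, defines a sc-smooth splicing. -/
theorem SmoothFam.isScSmoothSplicing {X : Type} [AddCommGroup X] [Module ℝ X] {E : NormedScale X} {A : ℕ → ℝ → X → X} {c : ℝ}
    (hA : SmoothFam E E (Ico (0 : ℝ) c) A) (hE : E.IsScStructure) {K L : ℝ → Submodule ℝ X}
    (hKL : ∀ r, Disjoint (K r) (L r)) (hK : ∀ r ∈ Ico (0 : ℝ) c, ∀ x : E.Lvl 0, A 0 r (E.emb 0 x) ∈ K r)
    (hL : ∀ r ∈ Ico (0 : ℝ) c, ∀ x : E.Lvl 0, E.emb 0 x - A 0 r (E.emb 0 x) ∈ L r) :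
    (∀ r ∈ Ico (0 : ℝ) c, AreScComplementary E (K r) (L r)) ∧ ∀ π : ℝ → X → X,
      (∀ r ∈ Ico (0 : ℝ) c, IsProjectionAlong E (K r) (L r) (π r)) →
        IsScSmoothSplicing π E (Ico 0 c) := by
  have h0 : ∀ m (x : E.Lvl m), ∃ x₀ : E.Lvl 0, E.emb 0 x₀ = E.emb m x := fun m x => by
    obtain ⟨ι, hι⟩ := hE.nested 0 m (Nat.zero_le m)
    exact ⟨ι x, hι x⟩
  refine ⟨fun r hr m => ?_, fun π hπ => ?_⟩
  · obtain ⟨P, hP, -⟩ := hA.op 0 m m le_rfl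
    refine ⟨Submodule.disjoint_def.2 fun x h1 h2 => ?_, codisjoint_iff.2 ?_⟩
    · exact E.emb_injective m ((Submodule.disjoint_def.1 (hKL r) _ h1 h2).trans (map_zero _).symm)
    · refine eq_top_iff.2 fun x _ => ?_
      obtain ⟨x₀, hx₀⟩ := h0 m x
      have h1 : P r x ∈ (K r).comap (E.emb m) := by
        rw [Submodule.mem_comap, hP r hr, ← hx₀]
        exact hK r hr x₀
      have h2 : x - P r x ∈ (L r).comap (E.emb m) := by
        rw [Submodule.mem_comap, map_sub, hP r hr, ← hx₀]
        exact hL r hr x₀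
      have := Submodule.add_mem_sup h1 h2
      rwa [add_sub_cancel] at this
  · obtain ⟨P, hP, -⟩ := hA.op 0 0 0 le_rfl
    have hπA : ∀ r ∈ Ico (0 : ℝ) c, ∀ m (x : E.Lvl m), A 0 r (E.emb m x) = π r (E.emb m x) := by
      intro r hr m x
      obtain ⟨x₀, hx₀⟩ := h0 m x
      rw [← hx₀, ← hP r hr]
      refine ((hπ r hr).eq_of_mem (hKL r) ?_ ?_).symm
      · rw [hP r hr]
        exact hK r hr x₀
      · rw [map_sub, hP r hr]
        exact hL r hr x₀
    refine ⟨hE, ⟨Ici 0, Iio c, isPartialCone_Ici, isOpen_Iio, Ici_inter_Iio.symm⟩,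
      fun r hr => ⟨fun m => ?_, fun x => ?_⟩, fun k => ?_⟩
    · obtain ⟨P, hP, -⟩ := hA.op 0 m m le_rfl
      exact ⟨P r, fun x => by rw [hP r hr, hπA r hr]⟩
    · obtain ⟨y, hy, h1, -⟩ := hπ r hr x
      rw [hy]
      refine (hπ r hr).eq_of_mem (hKL r) h1 ?_
      rw [sub_self, map_zero]
      exact zero_mem _
    · have hF : ((constScale ℝ).prod E).Nested := (nested_constScale ℝ).prod hE.nested
      have hρ : ∀ m, Continuous fun x =>
          LinearMap.fst ℝ ℝ X (((constScale ℝ).prod E).emb m x) := fun m =>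
        continuous_fst (X := ℝ) (Y := E.Lvl m)
      -- The map (r, x) ↦ A 0 r x is a single atom without gain or loss of levels.
      have hadm : Adm A E E ((constScale ℝ).prod E) E (LinearMap.fst ℝ ℝ X)
          (fun x => id (A 0 (LinearMap.fst ℝ ℝ X x) x.2)) :=
        .atom 0 0 0 Prod.snd id le_rfl (fun m n h => (hE.nested n m h).comp bdd_snd)
          (fun m n h => hE.nested m n h)
      refine (hadm.isScOfOrder hA (convex_Ico (0 : ℝ) c) k hF hρ).congr k fun m x hx => ?_
      exact hπA _ hx m x.2

end Splicing

/-! ### The parameter domain and the theorem. -/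

/-- For r > 0 the condition reads 1/r > log(e + 2). The interval form supplies the convexity of V
for the mean value arguments and its relative openness in [0,∞). -/
theorem setOf_two_lt_expProfile :
    {r ∈ Ico (0 : ℝ) 1 | ((2 : ℝ) : WithTop ℝ) < expProfile r} =
      Ico 0 (Real.log (Real.exp 1 + 2))⁻¹ := by
  have he : 0 < Real.exp 1 := Real.exp_pos 1
  have hl : 1 < Real.log (Real.exp 1 + 2) := by
    rw [Real.lt_log_iff_exp_lt (by positivity)]
    linarith
  ext r
  by_cases h : r = 0
  · subst h
    simp only [mem_ofPred_eq, mem_Ico, le_refl, zero_lt_one, expProfile, if_pos, inv_pos, true_and]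
    exact ⟨fun _ => by linarith, fun _ => WithTop.coe_lt_top 2⟩
  · rw [mem_ofPred_eq, expProfile_of_ne h, WithTop.coe_lt_coe, profile, mem_Ico, mem_Ico]
    refine ⟨fun ⟨⟨h0, _⟩, h2⟩ => ⟨h0, ?_⟩, fun ⟨h0, h1⟩ => ⟨⟨h0, h1.trans (inv_lt_one_of_one_lt₀ hl)⟩, ?_⟩⟩
    · have hr := lt_of_le_of_ne h0 (Ne.symm h)
      rw [lt_inv_comm₀ hr (by linarith), Real.log_lt_iff_lt_exp (by positivity)]
      linarith
    · have hr := lt_of_le_of_ne h0 (Ne.symm h)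
      rw [lt_inv_comm₀ hr (by linarith), Real.log_lt_iff_lt_exp (by positivity)] at h1
      linarith

theorem two_lt_profile_of_lt {r : ℝ} (hr : r ≠ 0) (h : ((2 : ℝ) : WithTop ℝ) < expProfile r) :
    2 < profile r := by
  rwa [expProfile_of_ne hr, WithTop.coe_lt_coe] at h

theorem isScSmoothSplicing_pathPairScale {N : ℕ} {β : ℝ → ℝ} (hβ : IsGluingCutoff β) {δ : ℕ → ℝ}
    (hδ₀ : δ 0 = 0) (hδ : StrictMono δ) (S S' : Submodule ℝ (EuclideanSpace ℝ (Fin N))) {c : ℝ}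
    (hc : Ico (0 : ℝ) c ⊆ Ico 0 1)
    (hS : ∀ r ∈ Ico (0 : ℝ) c, r ≠ 0 → S = ⊤ ∧ S' = ⊤ ∨ 2 < profile r) :
    (∀ r ∈ Ico (0 : ℝ) c, AreScComplementary (pathPairScale δ S S')
      (kerAntiGlue β (expProfile r)) (kerGlue β (expProfile r))) ∧
    ∀ π : ℝ → PathPairs N → PathPairs N, (∀ r ∈ Ico (0 : ℝ) c,
        IsProjectionAlong (pathPairScale δ S S')
          (kerAntiGlue β (expProfile r)) (kerGlue β (expProfile r)) (π r)) →
      IsScSmoothSplicing π (pathPairScale δ S S') (Ico 0 c) := by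
  obtain ⟨A, hA, h⟩ := exists_smoothFam_glueProj hβ hδ₀ hδ hc (convex_Ico 0 c) hS
  exact hA.isScSmoothSplicing (isScStructure_pathPairScale hδ₀ hδ)
    (fun r => disjoint_kerAntiGlue_kerGlue (β := β) (expProfile r))
    (fun r hr x => by rw [h r hr]; exact glueProj_mem_kerAntiGlue r _)
    (fun r hr x => by rw [h r hr]; exact sub_glueProj_mem_kerGlue r _)

theorem mainTheorem8 (N : ℕ) (β : ℝ → ℝ) (hβ : IsGluingCutoff β)
    (δ : ℕ → ℝ) (hδ₀ : δ 0 = 0) (hδ : StrictMono δ) :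
    -- the space `E` of all pairs of vector fields, with `V = [0,1)`
    ((∀ r ∈ Set.Ico (0 : ℝ) 1,
        AreScComplementary (pathPairScale (N := N) δ ⊤ ⊤)
          (kerAntiGlue β (expProfile r)) (kerGlue β (expProfile r))) ∧
      ∀ π : ℝ → PathPairs N → PathPairs N,
        (∀ r ∈ Set.Ico (0 : ℝ) 1,
          IsProjectionAlong (pathPairScale δ ⊤ ⊤)
            (kerAntiGlue β (expProfile r)) (kerGlue β (expProfile r)) (π r)) →
        IsScSmoothSplicing π (pathPairScale δ ⊤ ⊤) (Set.Ico (0 : ℝ) 1)) ∧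
    -- the space `E` of pairs with `h(0) ∈ S`, `k(0) ∈ S'`, with `V = {r ∈ [0,1) | φ(r) > 2}`
    ∀ S S' : Submodule ℝ (EuclideanSpace ℝ (Fin N)),
      (∀ r ∈ {r ∈ Set.Ico (0 : ℝ) 1 | ((2 : ℝ) : WithTop ℝ) < expProfile r},
        AreScComplementary (pathPairScale δ S S')
          (kerAntiGlue β (expProfile r)) (kerGlue β (expProfile r))) ∧
      ∀ π : ℝ → PathPairs N → PathPairs N,
        (∀ r ∈ {r ∈ Set.Ico (0 : ℝ) 1 | ((2 : ℝ) : WithTop ℝ) < expProfile r},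
          IsProjectionAlong (pathPairScale δ S S')
            (kerAntiGlue β (expProfile r)) (kerGlue β (expProfile r)) (π r)) →
        IsScSmoothSplicing π (pathPairScale δ S S')
          {r ∈ Set.Ico (0 : ℝ) 1 | ((2 : ℝ) : WithTop ℝ) < expProfile r} := by
  refine ⟨isScSmoothSplicing_pathPairScale hβ hδ₀ hδ ⊤ ⊤ Subset.rfl fun r _ _ => Or.inl ⟨rfl, rfl⟩, fun S S' => ?_⟩
  have hV := setOf_two_lt_expProfile
  rw [hV]
  refine isScSmoothSplicing_pathPairScale hβ hδ₀ hδ S S' (hV ▸ sep_subset _ _) fun r hr h => Or.inr (two_lt_profile_of_lt h ?_)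
  rw [← hV] at hr
  exact hr.2
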